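/- **Theorem 5.2.** Let $n\ge 1$, let $G=GA(\mathbb R^n)=\mathbb R^n\rtimes GL(\mathbb R^n)$ be the group of affine transformations $(x,T)\colon v\mapsto Tv+x$ of $\mathbb R^n$, with Lie algebra $\mathcal G=\mathbb R^n\times gl(\mathbb R^n)$, and let $H=\mathbb R^n$ be the normal subgroup of translations. Let $g\in(\mathbb R^n)^*$ and $M\in gl(\mathbb R^n)$, let $\alpha\equiv(g,M)\in\mathcal G^*$ be the linear form $\alpha(x,u)=g(x)+\operatorname{tr}(M\circ u)$, and suppose that the coadjoint orbit of $\alpha$ is open in $\mathcal G^*$. Put $\omega=\delta\alpha$, i.e. $\omega(a,b)=-\alpha([a,b])$, and let $\omega^+$ be the left-invariant 2-form on $G$ with value $\omega$ at the identity. Let $J(\sigma)=\mathrm{Ad}^*_\sigma(\alpha)=\alpha\circ\mathrm{Ad}_{\sigma^{-1}}$ and let $J_H\colon G\to(\mathbb R^n)^*$ be the restriction of $J$ to the Lie algebra $\mathbb R^n$ of $H$. By a left-invariant affine structure on a Lie group we mean a left-invariant, torsion-free, flat connection; a Lie group with such a structure is an affine Lie group. A left-invariant symplectic form $\Omega^+$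 on a Lie group (with value $\Omega$ at the identity) determines one by $\Omega^+(\nabla_{a^+}b^+,c^+)=-\Omega^+(b^+,[a^+,c^+])$ for left-invariant vector fields $a^+,b^+,c^+$. Then $\omega^+$ is a symplectic form, $-J$ is a momentum map for the action of $G$ on $(G,\omega^+)$ by left translations (i.e. $d(-J_a)=i(a^-)\omega^+$ for every $a\in\mathcal G$, where $J_a(\sigma)=J(\sigma)(a)$ and $a^-$ is the right-invariant vector field of $a$), and, with $\nabla^+$ the left-invariant affine structure on $G$ determined by $\omega^+$: 1. $P:=J_H^{-1}(g)$ is a closed subgroup of $G$ containing $H$. 2. The canonical exact sequence of Lie groups $1\to H\to P\to P/H\to 1$ splits, i.e. $P\to P/H$ has a smooth homomorphic section. Moreover it is a sequence of affine Lie groups: $H$, $P$ and $P/H$ carry left-invariant affine structures for which $H\to P$ and $P\to P/H$ are affine maps; here the structure of $P$ is the one for which $P\to(G,\nabla^+)$ is affine. 3. $P/H$ carries a left-invariant symplectic form (the reduced form) whose pullback to $P$ is the restriction of $\omega^+$ and which determines the affine structure of $P/H$ in 2; the Lie group $P/H$ is isomorphic to $GA(\mathbb R^{n-1})$. 4. $J_H\colon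 G\to(\mathbb R^n)^*\setminus\{0\}$ is a smooth principal bundle with fiber $P$ (acting on $G$ by right translations). Its fiber $P$ is an affine Lie subgroup of $(G,\nabla^+)$, i.e. an embedded Lie subgroup whose inclusion is an affine map, and its projection $J_H$ is an affine map from $(G,\nabla^+)$ to $(\mathbb R^n)^*\setminus\{0\}$ with its usual affine structure. -/

import Mathlib

open scoped Manifold ContDiff

noncomputable section

/-! ## The classical affine group -/

namespace AffGrp

/-- The space `ℝⁿ`. -/
abbrev E (n : ℕ) : Type := EuclideanSpace ℝ (Fin n)

/-- The vector space `ℝⁿ × gl(ℝⁿ)`. -/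
abbrev Model (n : ℕ) : Type := E n × (E n →L[ℝ] E n)

/-- The classical affine group `GA(ℝⁿ) = ℝⁿ ⋊ GL(ℝⁿ)`; the element `(vec, lin)` is the affine
transformation `v ↦ lin v + vec`. -/
@[ext]
structure GA (n : ℕ) : Type where
  vec : E n
  lin : (E n →L[ℝ] E n)ˣ

namespace GA

variable {n : ℕ}

instance : Mul (GA n) := ⟨fun a b => ⟨a.vec + (a.lin : E n →L[ℝ] E n) b.vec, a.lin * b.lin⟩⟩
instance : One (GA n) := ⟨⟨0, 1⟩⟩
instance : Inv (GA n) :=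
  ⟨fun a => ⟨-(((a.lin⁻¹ : (E n →L[ℝ] E n)ˣ) : E n →L[ℝ] E n) a.vec), a.lin⁻¹⟩⟩

@[simp] theorem mul_vec (a b : GA n) :
    (a * b).vec = a.vec + (a.lin : E n →L[ℝ] E n) b.vec := rfl
@[simp] theorem mul_lin (a b : GA n) : (a * b).lin = a.lin * b.lin := rfl
@[simp] theorem one_vec : (1 : GA n).vec = 0 := rfl
@[simp] theorem one_lin : (1 : GA n).lin = 1 := rfl
@[simp] theorem inv_vec (a : GA n) :
    (a⁻¹).vec = -(((a.lin⁻¹ : (E n →L[ℝ] E n)ˣ) : E n →L[ℝ] E n) a.vec) := rfl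
@[simp] theorem inv_lin (a : GA n) : (a⁻¹).lin = a.lin⁻¹ := rfl

instance : Group (GA n) :=
  Group.ofLeftAxioms
    (by intro a b c; ext1 <;> simp [add_assoc, mul_assoc])
    (by intro a; ext1 <;> simp)
    (by intro a; ext1 <;> simp)

instance : Nonempty (GA n) := ⟨1⟩

/-- `GA(ℝⁿ)` carries the product topology. -/
def equivProd (n : ℕ) : GA n ≃ E n × (E n →L[ℝ] E n)ˣ where
  toFun a := (a.vec, a.lin)
  invFun p := ⟨p.1, p.2⟩
  left_inv _ := rfl
  right_inv _ := rfl

instance : TopologicalSpace (GA n) := TopologicalSpace.induced (equivProd n) inferInstance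

/-- The coordinates `(x, T) ↦ (x, T)` of `GA(ℝⁿ)` in the vector space `ℝⁿ × gl(ℝⁿ)`. -/
def coord (a : GA n) : Model n := (a.vec, (a.lin : E n →L[ℝ] E n))

theorem isOpenEmbedding_coord : Topology.IsOpenEmbedding (coord : GA n → Model n) := by
  have h1 : Topology.IsOpenEmbedding (equivProd n) :=
    ((equivProd n).toHomeomorphOfIsInducing ⟨rfl⟩).isOpenEmbedding
  have h2 : Topology.IsOpenEmbedding
      (Prod.map id Units.val : E n × (E n →L[ℝ] E n)ˣ → Model n) :=
    Topology.IsOpenEmbedding.id.prodMap Units.isOpenEmbedding_val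
  exact h2.comp h1

/-- The manifold structure of `GA(ℝⁿ)` as an open subset of `ℝⁿ × gl(ℝⁿ)`. -/
instance : ChartedSpace (Model n) (GA n) := isOpenEmbedding_coord.singletonChartedSpace

instance {m : WithTop ℕ∞} : IsManifold 𝓘(ℝ, Model n) m (GA n) :=
  isOpenEmbedding_coord.isManifold_singleton

theorem contMDiff_coord {m : WithTop ℕ∞} :
    ContMDiff 𝓘(ℝ, Model n) 𝓘(ℝ, Model n) m (coord : GA n → Model n) :=
  contMDiff_isOpenEmbedding isOpenEmbedding_coord

instance {m : WithTop ℕ∞} : LieGroup 𝓘(ℝ, Model n) m (GA n) where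
  contMDiff_mul := by
    apply ContMDiff.of_comp_isOpenEmbedding isOpenEmbedding_coord
    have h : ContMDiff (𝓘(ℝ, Model n).prod 𝓘(ℝ, Model n)) 𝓘(ℝ, Model n × Model n) m
        (fun x : GA n × GA n => (coord x.1, coord x.2)) :=
      (contMDiff_coord.comp contMDiff_fst).prodMk_space (contMDiff_coord.comp contMDiff_snd)
    have h2 : ContDiff ℝ m (fun p : Model n × Model n =>
        ((p.1.1 + p.1.2 p.2.1, p.1.2 * p.2.2) : Model n)) := by
      refine ContDiff.prodMk ?_ ?_
      · exact (contDiff_fst.comp contDiff_fst).add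
          ((contDiff_snd.comp contDiff_fst).clm_apply (contDiff_fst.comp contDiff_snd))
      · exact (contDiff_snd.comp contDiff_fst).clm_comp (contDiff_snd.comp contDiff_snd)
    exact h2.contMDiff.comp h
  contMDiff_inv := by
    apply ContMDiff.of_comp_isOpenEmbedding isOpenEmbedding_coord
    have he : (coord ∘ fun a : GA n => a⁻¹) =
        (fun p : Model n => ((-(Ring.inverse p.2 p.1), Ring.inverse p.2) : Model n)) ∘ coord := by
      funext a
      simp [coord]
    rw [he]
    intro a
    refine ContMDiffAt.comp a ?_ (contMDiff_coord a)
    rw [contMDiffAt_iff_contDiffAt]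
    have hi : ContDiffAt ℝ m (fun p : Model n => Ring.inverse p.2) (coord a) :=
      (contDiffAt_ringInverse ℝ a.lin).comp (coord a) contDiffAt_snd
    exact ((hi.clm_apply contDiffAt_fst).neg).prodMk hi

end GA

/-- The normal subgroup `H = ℝⁿ` of translations of `GA(ℝⁿ)`. -/
def translations (n : ℕ) : Subgroup (GA n) where
  carrier := {a | a.lin = 1}
  one_mem' := rfl
  mul_mem' := by
    intro a b ha hb
    simp only [Set.mem_ofPred_eq] at ha hb ⊢
    simp [ha, hb]
  inv_mem' := by
    intro a ha
    simp only [Set.mem_ofPred_eq] at ha ⊢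
    simp [ha]

instance (n : ℕ) : (translations n).Normal where
  conj_mem := by
    intro a ha b
    have ha' : a.lin = 1 := ha
    change (b * a * b⁻¹).lin = 1
    simp [ha']

end AffGrp

/-! ## Symplectic and affine structures on Lie groups -/

namespace LieGrp

instance : ENat.LEInfty (minSmoothness ℝ 3) :=
  ⟨by rw [minSmoothness_of_isRCLikeNormedField]; exact ENat.LEInfty.out⟩

section General

variable {F : Type*} [NormedAddCommGroup F] [NormedSpace ℝ F] [CompleteSpace F]
  {X : Type*} [TopologicalSpace X] (I : ModelWithCorners ℝ F X)
  {K : Type*} [TopologicalSpace K] [ChartedSpace X K] [Group K]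

/-- The left-invariant vector field `x⁺` with value `x` at the identity. -/
abbrev leftField (x : GroupLieAlgebra I K) : Π σ : K, TangentSpace I σ :=
  mulInvariantVectorField x

/-- The right-invariant vector field `x⁻` with value `x` at the identity; it is the fundamental
vector field of `x` for the action of `K` on itself by left translations. The differential of a
right translation lands in the tangent space at `1 * σ = σ`. -/
def rightField (x : GroupLieAlgebra I K) (σ : K) : TangentSpace I σ :=
  (mfderiv I I (fun τ : K => τ * σ) 1 : F →L[ℝ] F) x

/-- The differential at the identity of a group homomorphism, as a map of Lie algebras. -/
def lieMap {F' : Type*} [NormedAddCommGroup F'] [NormedSpace ℝ F']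
    {X' : Type*} [TopologicalSpace X'] (I' : ModelWithCorners ℝ F' X')
    {K' : Type*} [TopologicalSpace K'] [ChartedSpace X' K'] [Group K'] (φ : K →* K') :
    GroupLieAlgebra I K →L[ℝ] GroupLieAlgebra I' K' :=
  (mfderiv I I' φ 1 : F →L[ℝ] F')

/-- The adjoint representation: `Ad σ` is the differential at the identity of `τ ↦ σ τ σ⁻¹`. -/
def Ad (σ : K) : GroupLieAlgebra I K →L[ℝ] GroupLieAlgebra I K :=
  lieMap I I (MulAut.conj σ).toMonoidHom

/-- The coadjoint representation: `Ad* σ α = α ∘ Ad σ⁻¹`. -/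
def coAd (σ : K) (α : GroupLieAlgebra I K →L[ℝ] ℝ) : GroupLieAlgebra I K →L[ℝ] ℝ :=
  α.comp (Ad I σ⁻¹)

/-- The value at `σ` of the left-invariant 2-form with value `Ω` at the identity. -/
def leftForm (Ω : LinearMap.BilinForm ℝ (GroupLieAlgebra I K)) (σ : K)
    (u v : TangentSpace I σ) : ℝ :=
  Ω ((mfderiv I I (fun τ : K => σ⁻¹ * τ) σ : F →L[ℝ] F) u)
    ((mfderiv I I (fun τ : K => σ⁻¹ * τ) σ : F →L[ℝ] F) v)

/-- `J : K → 𝔨*` is a momentum map for the action of `K` on itself by left translations with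
respect to the left-invariant form `Ω⁺`: the functions `J_x = J(·)(x)` are smooth and
`d J_x = i(x⁻) Ω⁺` for all `x` in the Lie algebra. -/
def IsMomentumMap (Ω : LinearMap.BilinForm ℝ (GroupLieAlgebra I K))
    (J : K → (GroupLieAlgebra I K →L[ℝ] ℝ)) : Prop :=
  ∀ x : GroupLieAlgebra I K,
    ContMDiff I 𝓘(ℝ, ℝ) ∞ (fun σ => J σ x) ∧
    ∀ (σ : K) (v : TangentSpace I σ),
      (mfderiv I 𝓘(ℝ, ℝ) (fun τ => J τ x) σ v : ℝ) = leftForm I Ω σ (rightField I x σ) v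

variable [LieGroup I ∞ K]

/-- The bilinear form `δα(x, y) = -α([x, y])`, the value at the identity of `d(α⁺)`. -/
def coboundary (α : GroupLieAlgebra I K →L[ℝ] ℝ) :
    LinearMap.BilinForm ℝ (GroupLieAlgebra I K) :=
  LinearMap.mk₂ ℝ (fun x y => -α ⁅x, y⁆)
    (by intro x x' y; rw [add_lie, map_add]; ring)
    (by intro c x y; rw [smul_lie, map_smul, smul_eq_mul, smul_eq_mul]; ring)
    (by intro x y y'; rw [lie_add, map_add]; ring)
    (by intro c x y; rw [lie_smul, map_smul, smul_eq_mul, smul_eq_mul]; ring)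

/-- The left-invariant 2-form `Ω⁺` is symplectic: `Ω` is alternating, nondegenerate, and satisfies
the cocycle identity, which says that `Ω⁺` is closed. -/
structure IsSymplectic (Ω : LinearMap.BilinForm ℝ (GroupLieAlgebra I K)) : Prop where
  alt : Ω.IsAlt
  nondegenerate : Ω.Nondegenerate
  closed : ∀ x y z : GroupLieAlgebra I K, Ω ⁅x, y⁆ z + Ω ⁅y, z⁆ x + Ω ⁅z, x⁆ y = 0

variable (K) in
/-- A left-invariant affine structure on the Lie group `K`: a left-invariant, torsion-free and flat
connection `∇` on its tangent bundle. Here `cov Y σ v` is `(∇_v Y)(σ)`. As torsion and curvature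
are tensors, their vanishing is expressed on the global frames of left-invariant vector fields. -/
structure AffineStructure where
  cov : CovariantDerivative I F (fun σ : K => TangentSpace I σ)
  left_invariant : ∀ (x y : GroupLieAlgebra I K) (σ : K),
    cov (leftField I y) σ (leftField I x σ) = leftField I (cov (leftField I y) 1 x) σ
  torsion_free : ∀ (x y : GroupLieAlgebra I K) (σ : K),
    cov (leftField I y) σ (leftField I x σ) - cov (leftField I x) σ (leftField I y σ) =
      VectorField.mlieBracket I (leftField I x) (leftField I y) σ
  flat : ∀ (x y z : GroupLieAlgebra I K) (σ : K),
    cov (fun τ => cov (leftField I z) τ (leftField I y τ)) σ (leftField I x σ) -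
      cov (fun τ => cov (leftField I z) τ (leftField I x τ)) σ (leftField I y σ) =
    cov (leftField I z) σ (VectorField.mlieBracket I (leftField I x) (leftField I y) σ)

variable {I}

/-- `∇` is the connection determined by the left-invariant form `Ω⁺` through
`Ω⁺(∇_{x⁺} y⁺, z⁺) = -Ω⁺(y⁺, [x⁺, z⁺])`. -/
def AffineStructure.IsAssociatedTo (A : AffineStructure I K)
    (Ω : LinearMap.BilinForm ℝ (GroupLieAlgebra I K)) : Prop :=
  ∀ (x y z : GroupLieAlgebra I K) (σ : K),
    leftForm I Ω σ (A.cov (leftField I y) σ (leftField I x σ)) (leftField I z σ) =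
      -leftForm I Ω σ (leftField I y σ)
        (VectorField.mlieBracket I (leftField I x) (leftField I z) σ)

/-- A morphism of affine Lie groups: a smooth homomorphism `φ` which is an affine map. Since `φ`
relates `x⁺` to `(dφ x)⁺`, affinity means that `dφ (∇_{x⁺} y⁺) = ∇'_{(dφ x)⁺} (dφ y)⁺` along `φ`
for all `x`, `y` in the Lie algebra. -/
def IsAffineHom (A : AffineStructure I K)
    {F' : Type*} [NormedAddCommGroup F'] [NormedSpace ℝ F'] [CompleteSpace F']
    {X' : Type*} [TopologicalSpace X'] {I' : ModelWithCorners ℝ F' X'}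
    {K' : Type*} [TopologicalSpace K'] [ChartedSpace X' K'] [Group K'] [LieGroup I' ∞ K']
    (A' : AffineStructure I' K') (φ : K →* K') : Prop :=
  ContMDiff I I' ∞ φ ∧
  ∀ (x y : GroupLieAlgebra I K) (σ : K),
    mfderiv I I' φ σ (A.cov (leftField I y) σ (leftField I x σ)) =
      A'.cov (leftField I' (lieMap I I' φ y)) (φ σ) (leftField I' (lieMap I I' φ x) (φ σ))

/-- A smooth map `f` from an affine Lie group to (an open subset of) a vector space `V` with its
usual flat connection is affine: `∇ df = 0`, that is, `x⁺ (y⁺ f) = (∇_{x⁺} y⁺) f` for all `x`, `y`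
in the Lie algebra. -/
def IsAffineMapToSpace (A : AffineStructure I K)
    {V : Type*} [NormedAddCommGroup V] [NormedSpace ℝ V] (f : K → V) : Prop :=
  ContMDiff I 𝓘(ℝ, V) ∞ f ∧
  ∀ (x y : GroupLieAlgebra I K) (σ : K),
    (mfderiv I 𝓘(ℝ, V) (fun τ => (mfderiv I 𝓘(ℝ, V) f τ (leftField I y τ) : V)) σ
        (leftField I x σ) : V) =
      mfderiv I 𝓘(ℝ, V) f σ (A.cov (leftField I y) σ (leftField I x σ))

end General

/-- `f : K → B` is, over the subset `U ⊆ B`, a smooth principal bundle with structure group the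
embedded subgroup `P` of `K` acting on `K` by right translations: `f` maps into `U`, it is
invariant under right multiplication by `P`, and every
point of `U` has a neighbourhood over which there is a smooth trivialization with fiber `P` that is
equivariant for right multiplication by `P`. -/
def IsPrincipalBundleOver {F : Type*} [NormedAddCommGroup F] [NormedSpace ℝ F]
    {X : Type*} [TopologicalSpace X] (I : ModelWithCorners ℝ F X)
    {K : Type*} [TopologicalSpace K] [ChartedSpace X K] [Group K] (P : Subgroup K)
    {F' : Type*} [NormedAddCommGroup F'] [NormedSpace ℝ F']
    {X' : Type*} [TopologicalSpace X'] (I' : ModelWithCorners ℝ F' X') [ChartedSpace X' P]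
    {B : Type*} [NormedAddCommGroup B] [NormedSpace ℝ B] (f : K → B) (U : Set B) : Prop :=
  (∀ σ, f σ ∈ U) ∧ (∀ (σ : K) (p : P), f (σ * p) = f σ) ∧
  ∀ b ∈ U, ∃ e : Bundle.Trivialization P f,
    b ∈ e.baseSet ∧
    ContMDiffOn I (𝓘(ℝ, B).prod I') ∞ e e.source ∧
    ContMDiffOn (𝓘(ℝ, B).prod I') I ∞ e.toOpenPartialHomeomorph.symm e.target ∧
    ∀ σ ∈ e.source, ∀ p : P, (e (σ * p)).2 = (e σ).2 * p

/-- The sequence `1 → H → P → Q → 1` of group homomorphisms is exact. -/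
def IsShortExact {H P Q : Type*} [Group H] [Group P] [Group Q] (i : H →* P) (p : P →* Q) : Prop :=
  Function.Injective i ∧ i.range = p.ker ∧ Function.Surjective p

end LieGrp

namespace AffGrp

open LieGrp

/-- The Lie algebra of `GA(ℝⁿ)`, which as a vector space is `ℝⁿ × gl(ℝⁿ)`. -/
abbrev ga (n : ℕ) : Type := GroupLieAlgebra 𝓘(ℝ, Model n) (GA n)

/-- The linear form `α ≡ (g, M)`, `α(x, u) = g(x) + tr(M ∘ u)`, on the Lie algebra of `GA(ℝⁿ)`. -/
def covector {n : ℕ} (g : E n →L[ℝ] ℝ) (M : E n →L[ℝ] E n) : ga n →L[ℝ] ℝ :=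
  (LinearMap.toContinuousLinearMap
    { toFun := fun p : Model n =>
        g p.1 + LinearMap.trace ℝ (E n) ((M ∘L p.2 : E n →L[ℝ] E n) : E n →ₗ[ℝ] E n)
      map_add' := by intro p q; simp [ContinuousLinearMap.comp_add]; ring
      map_smul' := by intro c p; simp; ring } :
    Model n →L[ℝ] ℝ)

/-- The map `J : GA(ℝⁿ) → ga(ℝⁿ)*`, `J(σ) = Ad*_σ(α)`. -/
def J {n : ℕ} (α : ga n →L[ℝ] ℝ) (σ : GA n) : ga n →L[ℝ] ℝ := coAd 𝓘(ℝ, Model n) σ α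

/-- The map `J_H : GA(ℝⁿ) → (ℝⁿ)*`: the restriction of `J(σ)` to the Lie algebra `ℝⁿ × 0` of the
group `H` of translations. -/
def JH {n : ℕ} (α : ga n →L[ℝ] ℝ) (σ : GA n) : E n →L[ℝ] ℝ :=
  (J α σ : Model n →L[ℝ] ℝ).comp (ContinuousLinearMap.inl ℝ (E n) (E n →L[ℝ] E n))

/-- The quotient group `P / H` of a subgroup `P` of `GA(ℝⁿ)`, where `H` is the group of
translations; it carries the quotient topology. -/
abbrev quotTranslations {n : ℕ} (P : Subgroup (GA n)) : Type := P ⧸ (translations n).subgroupOf P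

/-- The canonical projection `P → P / H`. -/
abbrev proj {n : ℕ} (P : Subgroup (GA n)) : P →* quotTranslations P :=
  QuotientGroup.mk' ((translations n).subgroupOf P)

end AffGrp

end

open scoped Manifold ContDiff

/-! Regard $\mathbb R^n\times gl(\mathbb R^n)$ as an associative algebra with product
$(a,u)(b,w)=(ub,uw)$ and adjoin a unit. Then $(x,T)\mapsto s=(x,T-1)$ identifies $G$ with the open
set of those $s$ for which $1+s$ is invertible, and the group law becomes $(1+s)(1+t)$.
Left-invariant fields are $x^+(s)=x+sx$, the Lie bracket is the commutator, and a bilinear product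
`B` satisfying `IsLeftSymmetric` yields a left-invariant affine structure with
$\nabla_{x^+}y^+=B(x,y)^+$. The groups $H$, $P$, $P/H$ are of the same kind, for the algebras
$\mathbb R^n$ (zero product), $\mathbb R^n\times\mathrm{Ann}(g)$ and $\mathrm{Ann}(g)=\{u : g\circ
u=0\}$, and every map of the exact sequence is linear in these coordinates. Smoothness and affinity
of those maps thus reduce to identities between products.

An open orbit forces $\omega$ to be nondegenerate: a vector $y$ of its radical gives a field $y^+$
killed by the derivative of the orbit map at every point, so the orbit would have measure zero
(`eq_zero_of_isOpen_range_modelCoAd`). Then $B(x,\cdot)$ is minus the $\omega$-adjoint of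
$\mathrm{ad}\,x$ (`exists_leftSymmetric`); flatness is the Jacobi identity, and vanishing torsion is
closedness of $\omega$.

Write $\mathfrak h$, $\mathfrak p$ for the Lie algebras of $H$, $P$. Since
$\omega((a,u),(v,0))=-g(uv)$, one has $\mathfrak h^\perp=\mathfrak p\supseteq\mathfrak h$ and
$\mathfrak p^\perp=\mathfrak h$. Hence $B$ preserves $\mathfrak p$ and maps $\mathfrak
p\times\mathfrak h$ and $\mathfrak h\times\mathfrak p$ into $\mathfrak h$, so it descends to
$\mathfrak p/\mathfrak h$ (`IsFormProduct.linProj_transfer`), while $\omega|_{\mathfrak p}$ has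
radical $\mathfrak h$ and descends to the reduced form. The map $u\mapsto(0,u)$ is multiplicative
and splits the sequence. If $g(y_0)=1$, then $u\mapsto(uy_0,u|_{\ker g})$ identifies
$\mathrm{Ann}(g)$ with the algebra of $GA(\mathbb R^{n-1})$ (`exists_annihilating_equiv`).

Finally $J_H(x,T)=g\circ T^{-1}$. Its fibers are the left cosets of $P$ and it has smooth local
sections, so it is a principal bundle. It is affine because the linear part of $B(x,y)$ composed
with $g$ is $-g\circ y_2\circ x_2$, where $x_2$, $y_2$ are the linear parts of $x$, $y$
(`comp_snd_leftSymmetric`). -/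

noncomputable section

/-! ### Calculus on manifolds with global coordinates in a vector space -/

namespace LieGrp

/-- A global coordinate system of a manifold `M` modelled on `V`: an open embedding which differs
from the charts of `M` by a translation. -/
structure IsGlobalCoord {V : Type*} [NormedAddCommGroup V] {M : Type*}
    [TopologicalSpace M] [ChartedSpace V M] (c : M → V) : Prop where
  isOpenEmbedding : Topology.IsOpenEmbedding c
  chart_eq : ∃ e : V, ∀ x y : M, chartAt V x y = c y + e

namespace IsGlobalCoord

variable {V : Type*} [NormedAddCommGroup V] [NormedSpace ℝ V] {M : Type*}
    [TopologicalSpace M] [ChartedSpace V M] {c : M → V}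
  {V' : Type*} [NormedAddCommGroup V'] [NormedSpace ℝ V'] {M' : Type*}
    [TopologicalSpace M'] [ChartedSpace V' M'] {c' : M' → V'}
  {F : Type*} [NormedAddCommGroup F] [NormedSpace ℝ F]
  {X : Type*} [TopologicalSpace X] {I : ModelWithCorners ℝ F X}
  {N : Type*} [TopologicalSpace N] [ChartedSpace X N] {m : WithTop ℕ∞}

theorem contMDiff [IsManifold 𝓘(ℝ, V) m M] (hc : IsGlobalCoord c) :
    ContMDiff 𝓘(ℝ, V) 𝓘(ℝ, V) m c := by
  obtain ⟨e, he⟩ := hc.chart_eq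
  intro x
  have h : ContMDiffAt 𝓘(ℝ, V) 𝓘(ℝ, V) m (extChartAt 𝓘(ℝ, V) x) x := contMDiffAt_extChartAt
  have h2 : c = fun y => extChartAt 𝓘(ℝ, V) x y - e := by
    funext y
    simp [he]
  rw [h2]
  exact h.sub contMDiffAt_const

theorem contMDiffAt_of_comp (hc : IsGlobalCoord c) {f : N → M} {x : N}
    (h : ContMDiffAt I 𝓘(ℝ, V) m (c ∘ f) x) : ContMDiffAt I 𝓘(ℝ, V) m f x := by
  obtain ⟨e, he⟩ := hc.chart_eq
  rw [contMDiffAt_iff_target]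
  refine ⟨hc.isOpenEmbedding.isInducing.continuousAt_iff.2 h.continuousAt, ?_⟩
  have h2 : (extChartAt 𝓘(ℝ, V) (f x) ∘ f) = fun y => (c ∘ f) y + e := by
    funext y
    simp [he]
  rw [h2]
  exact h.add contMDiffAt_const

theorem contMDiff_of_comp (hc : IsGlobalCoord c) {f : N → M}
    (h : ContMDiff I 𝓘(ℝ, V) m (c ∘ f)) : ContMDiff I 𝓘(ℝ, V) m f :=
  fun x => hc.contMDiffAt_of_comp (h x)

/-- A chart read in itself has identity derivative, and a translation does not change this. Every
tangent space is thereby identified with `V` without any correction factor. -/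
theorem hasMFDerivAt (hc : IsGlobalCoord c) (x : M) :
    HasMFDerivAt 𝓘(ℝ, V) 𝓘(ℝ, V) c x (ContinuousLinearMap.id ℝ V : V →L[ℝ] V) := by
  obtain ⟨e, he⟩ := hc.chart_eq
  refine ⟨hc.isOpenEmbedding.continuous.continuousAt, ?_⟩
  have h : HasFDerivWithinAt (fun z : V => z - e) (ContinuousLinearMap.id ℝ V)
      (Set.range 𝓘(ℝ, V)) (extChartAt 𝓘(ℝ, V) x x) :=
    ((hasFDerivAt_id _).sub_const e).hasFDerivWithinAt
  refine h.congr_of_eventuallyEq ?_ ?_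
  · have : (chartAt V x).target ∈ nhds (extChartAt 𝓘(ℝ, V) x x) :=
      (chartAt V x).open_target.mem_nhds (by simp)
    filter_upwards [mem_nhdsWithin_of_mem_nhds this] with z hz
    have h3 := (chartAt V x).right_inv hz
    rw [he] at h3
    simp only [writtenInExtChartAt, mfld_simps]
    exact eq_sub_of_add_eq h3
  · simp only [writtenInExtChartAt, mfld_simps]
    rw [he, add_sub_cancel_right]
    rfl

theorem mfderiv_eq (hc : IsGlobalCoord c) (x : M) :
    (mfderiv 𝓘(ℝ, V) 𝓘(ℝ, V) c x : V →L[ℝ] V) = ContinuousLinearMap.id ℝ V :=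
  (hc.hasMFDerivAt x).mfderiv

theorem hasMFDerivAt_comp (hc : IsGlobalCoord c) {F' : V →L[ℝ] F} {f : V → F} {x : M}
    (hf : HasFDerivAt f F' (c x)) :
    HasMFDerivAt 𝓘(ℝ, V) 𝓘(ℝ, F) (f ∘ c) x (F' : V →L[ℝ] F) := by
  have := hf.hasMFDerivAt.comp x (hc.hasMFDerivAt x)
  exact this

theorem hasMFDerivAt_of_comp (hc : IsGlobalCoord c) {f : N → M} {x : N}
    (hfc : ContinuousAt f x) {F' : F →L[ℝ] V}
    (h : HasMFDerivAt I 𝓘(ℝ, V) (c ∘ f) x (F' : F →L[ℝ] V)) :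
    HasMFDerivAt I 𝓘(ℝ, V) f x (F' : F →L[ℝ] V) := by
  obtain ⟨e, he⟩ := hc.chart_eq
  refine ⟨hfc, ?_⟩
  have h2 := HasFDerivWithinAt.add_const e h.2
  have h3 : writtenInExtChartAt I 𝓘(ℝ, V) x f =
      fun z => writtenInExtChartAt I 𝓘(ℝ, V) x (c ∘ f) z + e := by
    funext z
    simp only [writtenInExtChartAt, mfld_simps]
    rw [he]
    rfl
  rw [h3]
  exact h2

/-- The derivative of a map between manifolds with global coordinates can be computed in these
coordinates. -/
theorem hasMFDerivAt_of_eq (hc : IsGlobalCoord c) (hc' : IsGlobalCoord c') {f : M → M'} {x : M}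
    {g : V → V'} {F' : V →L[ℝ] V'} (hfg : c' ∘ f = g ∘ c) (hg : HasFDerivAt g F' (c x)) :
    HasMFDerivAt 𝓘(ℝ, V) 𝓘(ℝ, V') f x (F' : V →L[ℝ] V') := by
  refine hc'.hasMFDerivAt_of_comp ?_ ?_
  · rw [hc'.isOpenEmbedding.isInducing.continuousAt_iff, hfg]
    exact hg.continuousAt.comp hc.isOpenEmbedding.continuous.continuousAt
  · rw [hfg]
    exact hc.hasMFDerivAt_comp hg

theorem contMDiff_of_eq [IsManifold 𝓘(ℝ, V) m M] (hc : IsGlobalCoord c) (hc' : IsGlobalCoord c')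
    {f : M → M'} {g : V → V'} (hfg : c' ∘ f = g ∘ c) (hg : ContDiff ℝ m g) :
    ContMDiff 𝓘(ℝ, V) 𝓘(ℝ, V') m f := by
  refine hc'.contMDiff_of_comp ?_
  rw [hfg]
  exact hg.contMDiff.comp hc.contMDiff

/-- All charts are the same function `c + e`, so the tangent bundle is trivialized by the identity,
and a vector field may be differentiated as a `V`-valued function. -/
theorem mdifferentiableAt_of_section [IsManifold 𝓘(ℝ, V) 1 M] (hc : IsGlobalCoord c)
    {Y : Π x : M, TangentSpace 𝓘(ℝ, V) x} {x : M}
    (hY : MDiffAt (T% Y) x) :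
    MDifferentiableAt 𝓘(ℝ, V) 𝓘(ℝ, V) (fun y => (Y y : V)) x := by
  obtain ⟨e, he⟩ := hc.chart_eq
  rw [mdifferentiableAt_section] at hY
  have key : ∀ y : M, fderivWithin ℝ ((chartAt V x).extend 𝓘(ℝ, V) ∘
      ((chartAt V y).extend 𝓘(ℝ, V)).symm) (Set.range 𝓘(ℝ, V))
      ((chartAt V y).extend 𝓘(ℝ, V) y) = ContinuousLinearMap.id ℝ V := by
    intro y
    have h : HasFDerivAt (fun z : V => z) (ContinuousLinearMap.id ℝ V) (chartAt V y y) :=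
      hasFDerivAt_id _
    have h2 : HasFDerivAt (fun z : V => (chartAt V x) ((chartAt V y).symm z))
        (ContinuousLinearMap.id ℝ V) (chartAt V y y) := by
      refine h.congr_of_eventuallyEq ?_
      have : (chartAt V y).target ∈ nhds (chartAt V y y) :=
        (chartAt V y).open_target.mem_nhds (by simp)
      filter_upwards [this] with z hz
      rw [he x, ← he y, (chartAt V y).right_inv hz]
    have h3 := h2.fderiv
    simp only [mfld_simps, fderivWithin_univ]
    exact h3
  have h4 : (fun b => (trivializationAt V (TangentSpace 𝓘(ℝ, V)) x ⟨b, Y b⟩).2) =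
      fun y => (Y y : V) := by
    funext y
    change fderivWithin ℝ ((chartAt V x).extend 𝓘(ℝ, V) ∘
      ((chartAt V y).extend 𝓘(ℝ, V)).symm) (Set.range 𝓘(ℝ, V))
      ((chartAt V y).extend 𝓘(ℝ, V) y) (Y y) = Y y
    rw [key]
    rfl
  rw [h4] at hY
  exact hY

end IsGlobalCoord

end LieGrp

/-! ### Immersions, embeddings and submersions that are linear in coordinates -/

namespace LieGrp

namespace IsGlobalCoord

section Chart

variable {V : Type*} [NormedAddCommGroup V] {M : Type*}
    [TopologicalSpace M] [ChartedSpace V M] {c : M → V}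

/-- The global chart given by global coordinates. -/
def chart [Nonempty M] (hc : IsGlobalCoord c) : OpenPartialHomeomorph M V :=
  hc.isOpenEmbedding.toOpenPartialHomeomorph c

theorem chart_symm_apply [Nonempty M] (hc : IsGlobalCoord c) {z : V}
    (hz : z ∈ hc.chart.target) : c (hc.chart.symm z) = z :=
  hc.chart.right_inv hz

end Chart

variable {V : Type*} [NormedAddCommGroup V] [NormedSpace ℝ V] {M : Type*}
    [TopologicalSpace M] [ChartedSpace V M] {c : M → V}
  {V' : Type*} [NormedAddCommGroup V'] [NormedSpace ℝ V'] {M' : Type*}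
    [TopologicalSpace M'] [ChartedSpace V' M'] {c' : M' → V'} {m : WithTop ℕ∞}

theorem chart_mem_maximalAtlas [Nonempty M] [IsManifold 𝓘(ℝ, V) m M] (hc : IsGlobalCoord c) :
    hc.chart ∈ IsManifold.maximalAtlas 𝓘(ℝ, V) m M := by
  refine hc.chart.mem_maximalAtlas_of_contMDiffOn hc.contMDiff.contMDiffOn ?_
  intro z hz
  refine ContMDiffAt.contMDiffWithinAt (hc.contMDiffAt_of_comp ?_)
  refine contMDiffAt_id.congr_of_eventuallyEq ?_
  filter_upwards [hc.chart.open_target.mem_nhds hz] with w hw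
  exact hc.chart_symm_apply hw

theorem isImmersion [Nonempty M] [Nonempty M'] [IsManifold 𝓘(ℝ, V) m M]
    [IsManifold 𝓘(ℝ, V') m M'] (hc : IsGlobalCoord c) (hc' : IsGlobalCoord c')
    {f : M → M'} {L : V →L[ℝ] V'} {π : V' →L[ℝ] V} (hπ : ∀ v, π (L v) = v)
    (hf : ∀ x, c' (f x) = L (c x)) :
    Manifold.IsImmersion 𝓘(ℝ, V) 𝓘(ℝ, V') m f := by
  -- The left inverse `π` of `L` splits `V'` as `V × ker π`, so `ker π` serves as the complement
  -- required by the normal form. For submersions `ker Q` plays this role.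
  refine Manifold.IsImmersionOfComplement.isImmersion (F := π.ker) fun x => ?_
  refine Manifold.IsImmersionAtOfComplement.mk_of_charts
    (ContinuousLinearEquiv.equivOfRightInverse π L hπ).symm hc.chart hc'.chart
    (Set.mem_univ _) (Set.mem_univ _) hc.chart_mem_maximalAtlas hc'.chart_mem_maximalAtlas
    (fun _ _ => Set.mem_univ _) ?_
  intro z hz
  have hz' : z ∈ hc.chart.target := by simpa using hz
  simp only [Function.comp_apply, mfld_simps,
    ContinuousLinearEquiv.equivOfRightInverse_symm_apply]
  change c' (f (hc.chart.symm z)) = _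
  rw [hf, hc.chart_symm_apply hz']
  simp

theorem isSmoothEmbedding [Nonempty M] [Nonempty M'] [IsManifold 𝓘(ℝ, V) m M]
    [IsManifold 𝓘(ℝ, V') m M'] (hc : IsGlobalCoord c) (hc' : IsGlobalCoord c')
    {f : M → M'} {L : V →L[ℝ] V'} {π : V' →L[ℝ] V} (hπ : ∀ v, π (L v) = v)
    (hf : ∀ x, c' (f x) = L (c x)) :
    Manifold.IsSmoothEmbedding 𝓘(ℝ, V) 𝓘(ℝ, V') m f := by
  refine ⟨hc.isImmersion hc' hπ hf, ?_⟩
  have h1 : Topology.IsEmbedding L :=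
    Topology.IsEmbedding.of_leftInverse hπ π.continuous L.continuous
  have h2 : c' ∘ f = L ∘ c := funext hf
  have h3 : Topology.IsEmbedding (c' ∘ f) := by
    rw [h2]
    exact h1.comp hc.isOpenEmbedding.isEmbedding
  refine Topology.IsEmbedding.of_comp_iff hc'.isOpenEmbedding.isEmbedding |>.1 h3

theorem isSubmersion [Nonempty M] [Nonempty M'] [IsManifold 𝓘(ℝ, V) m M]
    [IsManifold 𝓘(ℝ, V') m M'] (hc : IsGlobalCoord c) (hc' : IsGlobalCoord c')
    {f : M → M'} {Q : V →L[ℝ] V'} {S : V' →L[ℝ] V} (hS : ∀ v, Q (S v) = v)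
    (hf : ∀ x, c' (f x) = Q (c x)) :
    Manifold.IsSubmersion 𝓘(ℝ, V) 𝓘(ℝ, V') m f := by
  refine Manifold.IsSubmersionOfComplement.isSubmersion (F := Q.ker) fun x => ?_
  refine Manifold.IsSubmersionAtOfComplement.mk_of_charts
    (ContinuousLinearEquiv.equivOfRightInverse Q S hS) hc.chart hc'.chart
    (Set.mem_univ _) (Set.mem_univ _) hc.chart_mem_maximalAtlas hc'.chart_mem_maximalAtlas
    (fun _ _ => Set.mem_univ _) ?_
  intro z hz
  have hz' : z ∈ hc.chart.target := by simpa using hz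
  simp only [Function.comp_apply, mfld_simps,
    ContinuousLinearEquiv.fst_equivOfRightInverse]
  change c' (f (hc.chart.symm z)) = _
  rw [hf, hc.chart_symm_apply hz']

end IsGlobalCoord

/-! ### Lie groups of elements `1 + s` of an associative algebra -/

/-- Left multiplication by `1 + c σ`. -/
def leftMul {V : Type*} [NormedAddCommGroup V] [NormedSpace ℝ V] {K : Type*} (c : K → V)
    (μ : V →L[ℝ] V →L[ℝ] V) (σ : K) : V →L[ℝ] V :=
  ContinuousLinearMap.id ℝ V + μ (c σ)

@[simp] theorem leftMul_apply {V : Type*} [NormedAddCommGroup V] [NormedSpace ℝ V] {K : Type*}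
    (c : K → V) (μ : V →L[ℝ] V →L[ℝ] V) (σ : K) (x : V) :
    leftMul c μ σ x = x + μ (c σ) x := rfl

/-- Coordinates `c` of a group `K` in an algebra `(V, μ)` in which the group law reads
`(1 + s) (1 + t) = 1 + (s + t + s t)`. -/
structure IsAlgebraCoord {V : Type*} [NormedAddCommGroup V] [NormedSpace ℝ V] {K : Type*}
    [TopologicalSpace K] [ChartedSpace V K] [Group K] (c : K → V) (μ : V →L[ℝ] V →L[ℝ] V) : Prop
    extends IsGlobalCoord c where
  map_one : c 1 = 0
  map_mul : ∀ σ τ, c (σ * τ) = c σ + c τ + μ (c σ) (c τ)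
  assoc : ∀ x y z, μ (μ x y) z = μ x (μ y z)

namespace IsAlgebraCoord

variable {V : Type*} [NormedAddCommGroup V] [NormedSpace ℝ V]
  {K : Type*} [TopologicalSpace K] [ChartedSpace V K] [Group K] {c : K → V}
  {μ : V →L[ℝ] V →L[ℝ] V}
  {V' : Type*} [NormedAddCommGroup V'] [NormedSpace ℝ V']
  {K' : Type*} [TopologicalSpace K'] [ChartedSpace V' K'] [Group K'] {c' : K' → V'}
  {μ' : V' →L[ℝ] V' →L[ℝ] V'}

theorem leftMul_mul (h : IsAlgebraCoord c μ) (σ τ : K) (x : V) :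
    leftMul c μ (σ * τ) x = leftMul c μ σ (leftMul c μ τ x) := by
  simp only [leftMul_apply, h.map_mul, map_add, _root_.add_apply, h.assoc]
  abel

theorem leftMul_one (h : IsAlgebraCoord c μ) (x : V) : leftMul c μ 1 x = x := by
  simp [h.map_one]

theorem leftMul_inv_leftMul (h : IsAlgebraCoord c μ) (σ : K) (x : V) :
    leftMul c μ σ⁻¹ (leftMul c μ σ x) = x := by
  rw [← h.leftMul_mul, inv_mul_cancel, h.leftMul_one]

theorem leftMul_leftMul_inv (h : IsAlgebraCoord c μ) (σ : K) (x : V) :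
    leftMul c μ σ (leftMul c μ σ⁻¹ x) = x := by
  rw [← h.leftMul_mul, mul_inv_cancel, h.leftMul_one]

/-- Left multiplication by `1 + c σ` as a unit of the algebra of endomorphisms. -/
def leftMulUnit (h : IsAlgebraCoord c μ) (σ : K) : (V →L[ℝ] V)ˣ :=
  ⟨leftMul c μ σ, leftMul c μ σ⁻¹, by ext x; simpa using h.leftMul_leftMul_inv σ x,
    by ext x; simpa using h.leftMul_inv_leftMul σ x⟩

theorem map_mul' (h : IsAlgebraCoord c μ) (σ τ : K) :
    c (σ * τ) = c σ + leftMul c μ σ (c τ) := by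
  rw [h.map_mul, leftMul_apply, add_assoc]

theorem hasMFDerivAt_mul_left (h : IsAlgebraCoord c μ) (σ τ : K) :
    HasMFDerivAt 𝓘(ℝ, V) 𝓘(ℝ, V) (fun ρ : K => σ * ρ) τ (leftMul c μ σ : V →L[ℝ] V) := by
  refine h.hasMFDerivAt_of_eq h.toIsGlobalCoord (g := fun z => c σ + leftMul c μ σ z) ?_ ?_
  · funext ρ
    exact h.map_mul' σ ρ
  · exact (leftMul c μ σ).hasFDerivAt.const_add _

theorem lieGroup [CompleteSpace V] [IsManifold 𝓘(ℝ, V) ∞ K] (h : IsAlgebraCoord c μ) :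
    LieGroup 𝓘(ℝ, V) ∞ K where
  contMDiff_mul := by
    refine h.contMDiff_of_comp ?_
    have h1 : ContMDiff (𝓘(ℝ, V).prod 𝓘(ℝ, V)) 𝓘(ℝ, V × V) ∞
        (fun x : K × K => (c x.1, c x.2)) :=
      (h.contMDiff.comp contMDiff_fst).prodMk_space (h.contMDiff.comp contMDiff_snd)
    have h2 : ContDiff ℝ ∞ (fun p : V × V => p.1 + p.2 + μ p.1 p.2) :=
      (contDiff_fst.add contDiff_snd).add
        ((μ.contDiff.comp contDiff_fst).clm_apply contDiff_snd)
    have h3 := h2.contMDiff.comp h1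
    refine h3.congr ?_
    intro x
    exact h.map_mul x.1 x.2
  contMDiff_inv := by
    refine h.contMDiff_of_comp ?_
    -- Solving $s+(1+s)s'=0$ for the coordinate $s'$ of the inverse gives $s'=-(1+s)^{-1}s$, and
    -- inversion of operators is smooth at units.
    have hinv : ∀ σ : K, c σ⁻¹ = -(Ring.inverse (ContinuousLinearMap.id ℝ V + μ (c σ))) (c σ) := by
      intro σ
      have h1 : Ring.inverse (ContinuousLinearMap.id ℝ V + μ (c σ)) = leftMul c μ σ⁻¹ :=
        Ring.inverse_unit (h.leftMulUnit σ)
      rw [h1, eq_neg_iff_add_eq_zero, ← h.map_mul', inv_mul_cancel, h.map_one]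
    intro σ
    have h2 : c ∘ (fun a : K => a⁻¹) =
        (fun z => -(Ring.inverse (ContinuousLinearMap.id ℝ V + μ z)) z) ∘ c := funext hinv
    rw [h2]
    refine ContMDiffAt.comp σ ?_ (h.contMDiff σ)
    rw [contMDiffAt_iff_contDiffAt]
    have h3 : ContDiffAt ℝ ∞ (fun z => ContinuousLinearMap.id ℝ V + μ z) (c σ) :=
      (contDiff_const.add μ.contDiff).contDiffAt
    have h4 : ContDiffAt ℝ ∞ (fun z => Ring.inverse (ContinuousLinearMap.id ℝ V + μ z)) (c σ) :=
      ContDiffAt.comp (c σ) (g := Ring.inverse) (contDiffAt_ringInverse ℝ (h.leftMulUnit σ)) h3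
    exact (h4.clm_apply contDiffAt_id).neg

/-- A map which is linear in coordinates. -/
theorem hasMFDerivAt_linear (h : IsAlgebraCoord c μ) (h' : IsAlgebraCoord c' μ') {f : K → K'}
    {L : V →L[ℝ] V'} (hf : ∀ σ, c' (f σ) = L (c σ)) (σ : K) :
    HasMFDerivAt 𝓘(ℝ, V) 𝓘(ℝ, V') f σ (L : V →L[ℝ] V') :=
  h.hasMFDerivAt_of_eq h'.toIsGlobalCoord (funext hf) L.hasFDerivAt

theorem contMDiff_linear [IsManifold 𝓘(ℝ, V) ∞ K] (h : IsAlgebraCoord c μ)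
    (h' : IsAlgebraCoord c' μ') {f : K → K'}
    {L : V →L[ℝ] V'} (hf : ∀ σ, c' (f σ) = L (c σ)) :
    ContMDiff 𝓘(ℝ, V) 𝓘(ℝ, V') ∞ f :=
  h.contMDiff_of_eq h'.toIsGlobalCoord (funext hf) L.contDiff

theorem lieMap_eq (h : IsAlgebraCoord c μ) (h' : IsAlgebraCoord c' μ') {f : K →* K'}
    {L : V →L[ℝ] V'} (hf : ∀ σ, c' (f σ) = L (c σ)) (x : V) :
    (lieMap 𝓘(ℝ, V) 𝓘(ℝ, V') f (x : GroupLieAlgebra 𝓘(ℝ, V) K) : V') = L x := by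
  have := (h.hasMFDerivAt_linear h' hf 1).mfderiv
  change (mfderiv 𝓘(ℝ, V) 𝓘(ℝ, V') f 1 : V →L[ℝ] V') x = _
  rw [this]
  rfl

end IsAlgebraCoord

end LieGrp

/-! ### Left-invariant fields, brackets, forms and connections as functions with values in the model
space -/

namespace LieGrp

/-- The derivative of a function on a manifold modelled on a vector space, as a linear map between
the model spaces. -/
def modelDeriv {V : Type*} [NormedAddCommGroup V] [NormedSpace ℝ V] {M : Type*}
    [TopologicalSpace M] [ChartedSpace V M] {F : Type*} [NormedAddCommGroup F] [NormedSpace ℝ F]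
    (f : M → F) (x : M) : V →L[ℝ] F :=
  mfderiv 𝓘(ℝ, V) 𝓘(ℝ, F) f x

section ModelDeriv

variable {V : Type*} [NormedAddCommGroup V] [NormedSpace ℝ V] {M : Type*}
    [TopologicalSpace M] [ChartedSpace V M] {F : Type*} [NormedAddCommGroup F] [NormedSpace ℝ F]

theorem modelDeriv_add {f g : M → F} {x : M}
    (hf : MDifferentiableAt 𝓘(ℝ, V) 𝓘(ℝ, F) f x) (hg : MDifferentiableAt 𝓘(ℝ, V) 𝓘(ℝ, F) g x) :
    modelDeriv (V := V) (fun y => f y + g y) x = modelDeriv f x + modelDeriv g x :=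
  (HasMFDerivAt.mfderiv ⟨hf.continuousAt.add hg.continuousAt,
    HasFDerivWithinAt.add hf.hasMFDerivAt.2 hg.hasMFDerivAt.2⟩ :
      mfderiv 𝓘(ℝ, V) 𝓘(ℝ, F) (fun y => f y + g y) x = _)

theorem modelDeriv_smul {f : M → ℝ} {g : M → F} {x : M}
    (hf : MDifferentiableAt 𝓘(ℝ, V) 𝓘(ℝ, ℝ) f x) (hg : MDifferentiableAt 𝓘(ℝ, V) 𝓘(ℝ, F) g x) :
    modelDeriv (V := V) (fun y => f y • g y) x =
      f x • modelDeriv g x + (modelDeriv f x).smulRight (g x) := by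
  have h2 : HasMFDerivAt 𝓘(ℝ, V) 𝓘(ℝ, F) (fun y => f y • g y) x
      (f x • modelDeriv g x + (modelDeriv f x).smulRight (g x) : V →L[ℝ] F) := by
    refine ⟨hf.continuousAt.smul hg.continuousAt, ?_⟩
    have h3 := HasFDerivWithinAt.smul hf.hasMFDerivAt.2 hg.hasMFDerivAt.2
    have hf4 : writtenInExtChartAt 𝓘(ℝ, V) 𝓘(ℝ, ℝ) x f (extChartAt 𝓘(ℝ, V) x x) = f x := by
      simp only [writtenInExtChartAt, mfld_simps]
      rfl
    have hg4 : writtenInExtChartAt 𝓘(ℝ, V) 𝓘(ℝ, F) x g (extChartAt 𝓘(ℝ, V) x x) = g x := by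
      simp only [writtenInExtChartAt, mfld_simps]
      rfl
    have key : ∀ a b, a = f x → b = g x →
        (a • modelDeriv g x + (modelDeriv f x).smulRight b : V →L[ℝ] F) =
          f x • modelDeriv g x + (modelDeriv f x).smulRight (g x) := by
      rintro _ _ rfl rfl
      rfl
    rw [← key _ _ hf4 hg4]
    exact h3
  exact h2.mfderiv

end ModelDeriv

section ModelFields

variable {V : Type*} [NormedAddCommGroup V] [NormedSpace ℝ V]
  {K : Type*} [TopologicalSpace K] [ChartedSpace V K]

/-- A function with values in the model space, seen as a vector field. -/
def toVectorField (X : K → V) : Π σ : K, TangentSpace 𝓘(ℝ, V) σ := X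

/-- The Lie bracket of vector fields on a manifold modelled on a vector space, seen as functions
with values in this vector space. -/
def modelBracket (X Y : K → V) (σ : K) : V :=
  VectorField.mlieBracket 𝓘(ℝ, V) (toVectorField X) (toVectorField Y) σ

variable [Group K]

/-- The left-invariant vector field `x⁺` as a function with values in the model space. -/
def modelField (x : V) (σ : K) : V :=
  leftField 𝓘(ℝ, V) (x : GroupLieAlgebra 𝓘(ℝ, V) K) σ

/-- The bracket of the Lie algebra as an operation on the model space. -/
def modelLie (x y : V) : V :=
  (fun a b : GroupLieAlgebra 𝓘(ℝ, V) K => ⁅a, b⁆) x y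

/-- A bilinear form on the Lie algebra as a function on the model space. -/
def formAtOne (Ω : LinearMap.BilinForm ℝ (GroupLieAlgebra 𝓘(ℝ, V) K)) (x y : V) : ℝ := Ω x y

/-- A left-invariant form as a function on the model space. -/
def modelForm (Ω : LinearMap.BilinForm ℝ (GroupLieAlgebra 𝓘(ℝ, V) K)) (σ : K) (x y : V) : ℝ :=
  leftForm 𝓘(ℝ, V) Ω σ x y

end ModelFields

/-- `B` is a left-symmetric product for the Lie bracket `μ x y - μ y x`. -/
structure IsLeftSymmetric {V : Type*} [NormedAddCommGroup V] [NormedSpace ℝ V]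
    (μ B : V →L[ℝ] V →L[ℝ] V) : Prop where
  torsion : ∀ x y, B x y - B y x = μ x y - μ y x
  flat : ∀ x y z, B x (B y z) - B y (B x z) = B (μ x y - μ y x) z

/-- The linear map `leftMul c μ σ ∘ B (y) ∘ (leftMul c μ σ)⁻¹ - μ (·) y` which expresses the
connection with Christoffel product `B` in the coordinates `c`. -/
def christoffel {V : Type*} [NormedAddCommGroup V] [NormedSpace ℝ V] {K : Type*} [Inv K]
    (c : K → V) (μ B : V →L[ℝ] V →L[ℝ] V) (σ : K) : V →L[ℝ] V →L[ℝ] V :=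
  (((ContinuousLinearMap.compL ℝ V V V (leftMul c μ σ)).comp
    ((ContinuousLinearMap.compL ℝ V V V).flip (leftMul c μ σ⁻¹))).comp
      (B.flip.comp (leftMul c μ σ⁻¹))) - μ.flip.comp (leftMul c μ σ⁻¹)

/-- The first term moves both vectors to the identity, multiplies them by `B` and moves the result
back. The second cancels the derivative `μ v y` of the left-invariant field $y+c\,y$, so that only
$B(x,y)^+$ remains in `covAux_modelField`. -/
theorem christoffel_apply {V : Type*} [NormedAddCommGroup V] [NormedSpace ℝ V] {K : Type*}
    [Inv K] (c : K → V) (μ B : V →L[ℝ] V →L[ℝ] V) (σ : K) (y v : V) :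
    christoffel c μ B σ y v =
      leftMul c μ σ (B (leftMul c μ σ⁻¹ v) (leftMul c μ σ⁻¹ y)) - μ v (leftMul c μ σ⁻¹ y) := rfl

namespace IsAlgebraCoord

variable {V : Type*} [NormedAddCommGroup V] [NormedSpace ℝ V]
  {K : Type*} [TopologicalSpace K] [ChartedSpace V K] [Group K] {c : K → V}
  {μ : V →L[ℝ] V →L[ℝ] V}
  {V' : Type*} [NormedAddCommGroup V'] [NormedSpace ℝ V']
  {K' : Type*} [TopologicalSpace K'] [ChartedSpace V' K'] [Group K'] {c' : K' → V'}
  {μ' : V' →L[ℝ] V' →L[ℝ] V'}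

theorem modelField_eq (h : IsAlgebraCoord c μ) (x : V) (σ : K) :
    modelField x σ = leftMul c μ σ x :=
  DFunLike.congr_fun (h.hasMFDerivAt_mul_left σ 1).mfderiv x

theorem modelField_one (h : IsAlgebraCoord c μ) (x : V) : modelField x (1 : K) = x :=
  (h.modelField_eq x 1).trans (h.leftMul_one x)

theorem modelField_sub (h : IsAlgebraCoord c μ) (x y : V) (σ : K) :
    modelField (x - y) σ = modelField x σ - modelField y σ := by
  rw [h.modelField_eq, h.modelField_eq, h.modelField_eq, map_sub]

/-- The field $x^+$ is the pullback along `c` of the affine field $z\mapsto x+zx$ on `V`, and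
pullback commutes with brackets. Associativity turns the bracket of two such affine fields into the
one attached to the commutator. -/
theorem modelBracket_modelField [CompleteSpace V] [LieGroup 𝓘(ℝ, V) ∞ K]
    (h : IsAlgebraCoord c μ) (x y : V) (σ : K) :
    modelBracket (modelField x) (modelField y) σ = modelField (μ x y - μ y x) σ := by
  let fld : V → Π z : V, TangentSpace 𝓘(ℝ, V) z := fun x z => (x + μ z x : V)
  have hinv : ∀ τ : K, (mfderiv 𝓘(ℝ, V) 𝓘(ℝ, V) c τ).inverse = ContinuousLinearMap.id ℝ V :=
    fun τ => (congrArg (ContinuousLinearMap.inverse : (V →L[ℝ] V) → _) (h.mfderiv_eq τ)).trans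
      ContinuousLinearMap.inverse_id
  have hpull : ∀ x : V, toVectorField (modelField x : K → V) =
      VectorField.mpullback 𝓘(ℝ, V) 𝓘(ℝ, V) c (fld x) := by
    intro x
    funext τ
    rw [VectorField.mpullback_apply, hinv]
    exact h.modelField_eq x τ
  have hdiff : ∀ (x : V) (z : V), HasFDerivAt (fun z : V => x + μ z x) (μ.flip x) z := by
    intro x z
    exact (μ.flip x).hasFDerivAt.const_add x
  have hsec : ∀ (x : V) (z : V), MDiffAt (T% (fld x)) z := by
    intro x z
    rw [mdifferentiableAt_section]
    have : MDifferentiableAt 𝓘(ℝ, V) 𝓘(ℝ, V) (fun z : V => x + μ z x) z :=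
      (hdiff x z).differentiableAt.mdifferentiableAt
    convert! this using 2
    simp [fld]
  have hc2 : ContMDiffAt 𝓘(ℝ, V) 𝓘(ℝ, V) ∞ c σ := h.contMDiff σ
  have h1 : modelBracket (modelField x) (modelField y) σ =
      VectorField.mpullback 𝓘(ℝ, V) 𝓘(ℝ, V) c
        (VectorField.mlieBracket 𝓘(ℝ, V) (fld x) (fld y)) σ := by
    rw [VectorField.mpullback_mlieBracket (n := ∞) (hsec x _) (hsec y _) hc2
      (by rw [minSmoothness_of_isRCLikeNormedField]; exact ENat.LEInfty.out),
      ← hpull, ← hpull]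
    rfl
  rw [h1, VectorField.mpullback_apply, hinv, ← VectorField.mlieBracketWithin_univ,
    VectorField.mlieBracketWithin_eq_lieBracketWithin, VectorField.lieBracketWithin_univ,
    VectorField.lieBracket, h.modelField_eq]
  change fderiv ℝ (fun z : V => y + μ z y) (c σ) (x + μ (c σ) x) -
    fderiv ℝ (fun z : V => x + μ z x) (c σ) (y + μ (c σ) y) =
      (μ x y - μ y x) + μ (c σ) (μ x y - μ y x)
  rw [(hdiff y _).fderiv, (hdiff x _).fderiv]
  simp only [ContinuousLinearMap.flip_apply, map_add, map_sub, h.assoc]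
  abel

theorem lie_eq [CompleteSpace V] [LieGroup 𝓘(ℝ, V) ∞ K] (h : IsAlgebraCoord c μ) (x y : V) :
    modelLie (K := K) x y = μ x y - μ y x :=
  (h.modelBracket_modelField x y 1).trans (h.modelField_one _)

theorem modelForm_modelField (h : IsAlgebraCoord c μ)
    (Ω : LinearMap.BilinForm ℝ (GroupLieAlgebra 𝓘(ℝ, V) K)) (x y : V) (σ : K) :
    modelForm Ω σ (modelField x σ) (modelField y σ) = formAtOne Ω x y := by
  have h1 := (h.hasMFDerivAt_mul_left σ⁻¹ σ).mfderiv
  have key : ∀ z : V,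
      (mfderiv 𝓘(ℝ, V) 𝓘(ℝ, V) (fun τ : K => σ⁻¹ * τ) σ : V →L[ℝ] V) (modelField (V := V) z σ) = z := by
    intro z
    rw [h.modelField_eq]
    exact (DFunLike.congr_fun h1 _).trans (h.leftMul_inv_leftMul σ z)
  exact congrArg₂ (formAtOne Ω) (key x) (key y)

/-- The covariant derivative, in the coordinates `c`, of the connection such that
`∇_{x⁺} y⁺ = (B x y)⁺`. -/
def covAux (c : K → V) (μ B : V →L[ℝ] V →L[ℝ] V) (Y : K → V) (σ : K) : V →L[ℝ] V :=
  modelDeriv Y σ + christoffel c μ B σ (Y σ)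

theorem covAux_modelField (h : IsAlgebraCoord c μ) (B : V →L[ℝ] V →L[ℝ] V) (x y : V) (σ : K) :
    covAux c μ B (modelField y) σ (modelField x σ) = modelField (B x y) σ := by
  have h1 : HasMFDerivAt 𝓘(ℝ, V) 𝓘(ℝ, V) (modelField y : K → V) σ (μ.flip y : V →L[ℝ] V) := by
    have h2 : (modelField y : K → V) = (fun z => y + μ z y) ∘ c :=
      funext fun τ => h.modelField_eq y τ
    rw [h2]
    exact h.hasMFDerivAt_comp ((μ.flip y).hasFDerivAt.const_add y)
  have h3 : modelDeriv (modelField y : K → V) σ = μ.flip y := h1.mfderiv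
  rw [covAux, h3, _root_.add_apply, h.modelField_eq, h.modelField_eq, h.modelField_eq,
    christoffel_apply, h.leftMul_inv_leftMul, h.leftMul_inv_leftMul,
    ContinuousLinearMap.flip_apply]
  abel

variable [LieGroup 𝓘(ℝ, V) ∞ K]

/-- The connection on a group with algebra coordinates such that
`∇_{x⁺} y⁺ = (B x y)⁺` for all left-invariant vector fields. -/
def connection (h : IsAlgebraCoord c μ) (B : V →L[ℝ] V →L[ℝ] V) :
    CovariantDerivative 𝓘(ℝ, V) V (fun σ : K => TangentSpace 𝓘(ℝ, V) σ) where
  toFun Y σ := covAux (V := V) c μ B Y σ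
  isCovariantDerivativeOnUniv := by
    have hadd : ∀ (Y Y' : K → V) (σ : K), MDifferentiableAt 𝓘(ℝ, V) 𝓘(ℝ, V) Y σ →
        MDifferentiableAt 𝓘(ℝ, V) 𝓘(ℝ, V) Y' σ →
        covAux c μ B (fun τ => Y τ + Y' τ) σ = covAux c μ B Y σ + covAux c μ B Y' σ := by
      intro Y Y' σ hY hY'
      rw [covAux, modelDeriv_add hY hY', map_add, covAux, covAux]
      abel
    have hsmul : ∀ (f : K → ℝ) (Y : K → V) (σ : K), MDifferentiableAt 𝓘(ℝ, V) 𝓘(ℝ, V) Y σ →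
        MDifferentiableAt 𝓘(ℝ, V) 𝓘(ℝ, ℝ) f σ →
        covAux c μ B (fun τ => f τ • Y τ) σ =
          f σ • covAux c μ B Y σ + (modelDeriv f σ).smulRight (Y σ) := by
      intro f Y σ hY hf
      rw [covAux, modelDeriv_smul hf hY, map_smul, covAux, smul_add]
      abel
    constructor
    · intro Y Y' σ hY hY' _
      exact hadd Y Y' σ (h.mdifferentiableAt_of_section hY) (h.mdifferentiableAt_of_section hY')
    · intro Y f σ hY hf _
      exact hsmul f Y σ (h.mdifferentiableAt_of_section hY) hf

variable [CompleteSpace V]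

/-- The left-invariant affine structure such that `∇_{x⁺} y⁺ = (B x y)⁺`, for a left-symmetric
product `B` whose commutator is the Lie bracket. -/
def affineStructure (h : IsAlgebraCoord c μ) {B : V →L[ℝ] V →L[ℝ] V}
    (hB : IsLeftSymmetric μ B) : AffineStructure 𝓘(ℝ, V) K where
  cov := h.connection B
  left_invariant := by
    have key : ∀ (x y : V) (σ : K), covAux c μ B (modelField y) σ (modelField x σ) =
        modelField (covAux c μ B (modelField y) (1 : K) x) σ := by
      intro x y σ
      have h1 := h.covAux_modelField B x y 1
      rw [h.modelField_one, h.modelField_one] at h1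
      rw [h.covAux_modelField, h1]
    exact key
  torsion_free := by
    have key : ∀ (x y : V) (σ : K), covAux c μ B (modelField y) σ (modelField x σ) -
        covAux c μ B (modelField x) σ (modelField y σ) =
          modelBracket (modelField x) (modelField y) σ := by
      intro x y σ
      rw [h.covAux_modelField, h.covAux_modelField, h.modelBracket_modelField, ← hB.torsion,
        h.modelField_sub]
    exact key
  flat := by
    have h1 : ∀ y z : V, (fun τ : K => covAux c μ B (modelField z) τ (modelField y τ)) =
        modelField (B y z) := fun y z => funext fun τ => h.covAux_modelField B y z τ
    have key : ∀ (x y z : V) (σ : K),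
        covAux c μ B (fun τ => covAux c μ B (modelField z) τ (modelField y τ)) σ
            (modelField x σ) -
          covAux c μ B (fun τ => covAux c μ B (modelField z) τ (modelField x τ)) σ
            (modelField y σ) =
        covAux c μ B (modelField z) σ (modelBracket (modelField x) (modelField y) σ) := by
      intro x y z σ
      rw [h1, h1, h.modelBracket_modelField, h.covAux_modelField, h.covAux_modelField,
        h.covAux_modelField, ← hB.flat, h.modelField_sub]
    exact key

theorem isAssociatedTo (h : IsAlgebraCoord c μ) {B : V →L[ℝ] V →L[ℝ] V}
    (hB : IsLeftSymmetric μ B) (Ω : LinearMap.BilinForm ℝ (GroupLieAlgebra 𝓘(ℝ, V) K))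
    (hΩ : ∀ x y z : V, formAtOne Ω (B x y) z = -formAtOne Ω y (μ x z - μ z x)) :
    (h.affineStructure hB).IsAssociatedTo Ω := by
  have key : ∀ (x y z : V) (σ : K),
      modelForm Ω σ (covAux c μ B (modelField y) σ (modelField x σ)) (modelField z σ) =
        -modelForm Ω σ (modelField y σ) (modelBracket (modelField x) (modelField z) σ) := by
    intro x y z σ
    rw [h.covAux_modelField, h.modelBracket_modelField, h.modelForm_modelField,
      h.modelForm_modelField, hΩ]
  exact key

theorem isAffineHom [CompleteSpace V'] [LieGroup 𝓘(ℝ, V') ∞ K']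
    (h : IsAlgebraCoord c μ) {B : V →L[ℝ] V →L[ℝ] V} (hB : IsLeftSymmetric μ B)
    (h' : IsAlgebraCoord c' μ') {B' : V' →L[ℝ] V' →L[ℝ] V'} (hB' : IsLeftSymmetric μ' B')
    {f : K →* K'} {L : V →L[ℝ] V'} (hf : ∀ σ, c' (f σ) = L (c σ))
    (hLμ : ∀ x y, L (μ x y) = μ' (L x) (L y))
    (hLB : ∀ x y, L (B x y) = B' (L x) (L y)) :
    IsAffineHom (h.affineStructure hB) (h'.affineStructure hB') f := by
  refine ⟨h.contMDiff_linear h' hf, ?_⟩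
  have hL : lieMap 𝓘(ℝ, V) 𝓘(ℝ, V') f = (L : V →L[ℝ] V') :=
    (h.hasMFDerivAt_linear h' hf 1).mfderiv
  have key : ∀ (x y : V) (σ : K),
      (mfderiv 𝓘(ℝ, V) 𝓘(ℝ, V') f σ : V →L[ℝ] V')
        (covAux c μ B (modelField y) σ (modelField x σ)) =
      covAux c' μ' B' (modelField (L y)) (f σ) (modelField (L x) (f σ)) := by
    intro x y σ
    rw [h.covAux_modelField, h'.covAux_modelField, h.modelField_eq, h'.modelField_eq]
    refine (DFunLike.congr_fun (h.hasMFDerivAt_linear h' hf σ).mfderiv _).trans ?_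
    change L (leftMul c μ σ (B x y)) = _
    rw [leftMul_apply, leftMul_apply, map_add, hLμ, hLB, hf]
  intro x y σ
  rw [hL]
  exact key x y σ

theorem isAffineMapToSpace {F : Type*} [NormedAddCommGroup F] [NormedSpace ℝ F]
    (h : IsAlgebraCoord c μ) {B : V →L[ℝ] V →L[ℝ] V} (hB : IsLeftSymmetric μ B)
    {f : K → F} (hf : ContMDiff 𝓘(ℝ, V) 𝓘(ℝ, F) ∞ f)
    (hfB : ∀ (x y : V) (σ : K),
      modelDeriv (fun τ => modelDeriv f τ (modelField y τ)) σ (modelField x σ) =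
        modelDeriv f σ (modelField (B x y) σ)) :
    IsAffineMapToSpace (h.affineStructure hB) f := by
  have key : ∀ (x y : V) (σ : K),
      modelDeriv (fun τ => modelDeriv f τ (modelField y τ)) σ (modelField x σ) =
        modelDeriv f σ (covAux c μ B (modelField y) σ (modelField x σ)) := by
    intro x y σ
    rw [h.covAux_modelField, hfB]
  exact ⟨hf, key⟩

end IsAlgebraCoord

end LieGrp

/-! ### Coadjoint action, momentum map and symplecticity in algebra coordinates -/

namespace LieGrp

section ModelFields

variable {V : Type*} [NormedAddCommGroup V] [NormedSpace ℝ V]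
  {K : Type*} [TopologicalSpace K] [ChartedSpace V K] [Group K]

/-- The coadjoint representation on the dual of the model space. -/
def modelCoAd (α : V →L[ℝ] ℝ) (σ : K) : V →L[ℝ] ℝ := coAd (K := K) 𝓘(ℝ, V) σ α

/-- The right-invariant vector field `x⁻` as a function with values in the model space. -/
def modelRightField (x : V) (σ : K) : V := rightField (K := K) 𝓘(ℝ, V) x σ

/-- The bilinear form `δα` as a function on the model space. -/
def modelCoboundary [CompleteSpace V] [LieGroup 𝓘(ℝ, V) ∞ K] (α : V →L[ℝ] ℝ) :
    LinearMap.BilinForm ℝ (GroupLieAlgebra 𝓘(ℝ, V) K) :=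
  coboundary (K := K) 𝓘(ℝ, V) α

end ModelFields

/-- The adjoint representation in algebra coordinates. -/
def adj {V : Type*} [NormedAddCommGroup V] [NormedSpace ℝ V] {K : Type*} [Inv K]
    (c : K → V) (μ : V →L[ℝ] V →L[ℝ] V) (σ : K) : V →L[ℝ] V :=
  (leftMul c μ σ).comp (ContinuousLinearMap.id ℝ V + μ.flip (c σ⁻¹))

theorem adj_apply {V : Type*} [NormedAddCommGroup V] [NormedSpace ℝ V] {K : Type*} [Inv K]
    (c : K → V) (μ : V →L[ℝ] V →L[ℝ] V) (σ : K) (x : V) :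
    adj c μ σ x = leftMul c μ σ (x + μ x (c σ⁻¹)) := rfl

/-- The polynomial map which expresses the coadjoint orbit map of `α` in terms of the coordinates
of a group element and of its inverse. -/
def orbitPoly {V : Type*} [NormedAddCommGroup V] [NormedSpace ℝ V]
    (μ : V →L[ℝ] V →L[ℝ] V) (α : V →L[ℝ] ℝ) (p : V × V) : V →L[ℝ] ℝ :=
  α.comp ((ContinuousLinearMap.id ℝ V + μ p.2).comp (ContinuousLinearMap.id ℝ V + μ.flip p.1))

namespace IsAlgebraCoord

variable {V : Type*} [NormedAddCommGroup V] [NormedSpace ℝ V]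
  {K : Type*} [TopologicalSpace K] [ChartedSpace V K] [Group K] {c : K → V}
  {μ : V →L[ℝ] V →L[ℝ] V}

/-- Conjugation fixes the identity, so its expression $z\mapsto(1+s)z(1+s)^{-1}$ in coordinates is
linear and equals its own derivative. -/
theorem lieMap_conj (h : IsAlgebraCoord c μ) (σ : K) :
    (Ad 𝓘(ℝ, V) σ : V →L[ℝ] V) = adj c μ σ := by
  have hf : ∀ τ, c ((MulAut.conj σ).toMonoidHom τ) = adj c μ σ (c τ) := by
    intro τ
    have h0 : c σ + leftMul c μ σ (c σ⁻¹) = 0 := by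
      rw [← h.map_mul', mul_inv_cancel, h.map_one]
    change c (σ * τ * σ⁻¹) = _
    rw [mul_assoc, h.map_mul', h.map_mul, adj_apply,
      show c τ + c σ⁻¹ + μ (c τ) (c σ⁻¹) = c σ⁻¹ + (c τ + μ (c τ) (c σ⁻¹)) by abel, map_add,
      ← add_assoc, h0, zero_add]
  exact (h.hasMFDerivAt_linear h hf 1).mfderiv

theorem modelCoAd_eq (h : IsAlgebraCoord c μ) (α : V →L[ℝ] ℝ) (σ : K) :
    modelCoAd α σ = α.comp (adj c μ σ⁻¹) :=
  congrArg (fun A : V →L[ℝ] V => α.comp A) (h.lieMap_conj σ⁻¹)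

/-- This is $x(1+s)=(1+s)\cdot(1+s)^{-1}x(1+s)$: a right-invariant vector is the left translate of
$\mathrm{Ad}_{\sigma^{-1}}x$. -/
theorem modelRightField_eq (h : IsAlgebraCoord c μ) (x : V) (σ : K) :
    modelRightField x σ = modelField (adj c μ σ⁻¹ x) σ := by
  have h1 : HasMFDerivAt 𝓘(ℝ, V) 𝓘(ℝ, V) (fun τ : K => τ * σ) 1
      (ContinuousLinearMap.id ℝ V + μ.flip (c σ) : V →L[ℝ] V) := by
    refine h.hasMFDerivAt_of_eq h.toIsGlobalCoord
      (g := fun z => c σ + (ContinuousLinearMap.id ℝ V + μ.flip (c σ) : V →L[ℝ] V) z) ?_ ?_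
    · funext τ
      simp only [Function.comp_apply, h.map_mul]
      change _ = c σ + (c τ + μ (c τ) (c σ))
      abel
    · exact (ContinuousLinearMap.hasFDerivAt _).const_add _
  refine (DFunLike.congr_fun h1.mfderiv x).trans ?_
  rw [h.modelField_eq, adj_apply, inv_inv, h.leftMul_leftMul_inv]
  rfl

theorem leftMul_μ (h : IsAlgebraCoord c μ) (σ : K) (x y : V) :
    leftMul c μ σ (μ x y) = μ (leftMul c μ σ x) y := by
  simp [leftMul_apply, h.assoc]

theorem μ_add_μ_inv (h : IsAlgebraCoord c μ) (σ : K) :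
    c σ + c σ⁻¹ + μ (c σ) (c σ⁻¹) = 0 := by
  rw [← h.map_mul, mul_inv_cancel, h.map_one]

/-- As a function of the coordinates of both `σ` and `σ⁻¹` the orbit map is polynomial, so inversion
is the only nonlinear map that has to be differentiated. -/
theorem modelCoAd_eq_orbitPoly (h : IsAlgebraCoord c μ) (α : V →L[ℝ] ℝ) (σ : K) :
    modelCoAd α σ = orbitPoly μ α (c σ, c σ⁻¹) := by
  rw [h.modelCoAd_eq, adj, inv_inv]
  rfl

variable [LieGroup 𝓘(ℝ, V) ∞ K]

theorem contMDiff_coord_inv (h : IsAlgebraCoord c μ) :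
    ContMDiff 𝓘(ℝ, V) 𝓘(ℝ, V) ∞ (fun σ : K => c σ⁻¹) :=
  h.contMDiff.comp (contMDiff_inv 𝓘(ℝ, V) ∞)

theorem hasMFDerivAt_comp_coord_inv {F : Type*} [NormedAddCommGroup F] [NormedSpace ℝ F]
    (h : IsAlgebraCoord c μ) {Φ : V × V → F} {Φ' : V × V →L[ℝ] F} {σ : K}
    (hΦ : HasFDerivAt Φ Φ' (c σ, c σ⁻¹)) :
    HasMFDerivAt 𝓘(ℝ, V) 𝓘(ℝ, F) (fun τ : K => Φ (c τ, c τ⁻¹)) σ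
      (Φ'.comp ((ContinuousLinearMap.id ℝ V).prod (modelDeriv (fun τ : K => c τ⁻¹) σ)) :
        V →L[ℝ] F) := by
  have hD : HasMFDerivAt 𝓘(ℝ, V) 𝓘(ℝ, V) (fun τ : K => c τ⁻¹) σ
      (modelDeriv (fun τ : K => c τ⁻¹) σ : V →L[ℝ] V) :=
    ((h.contMDiff_coord_inv σ).mdifferentiableAt (by simp)).hasMFDerivAt
  have hpair : HasMFDerivAt 𝓘(ℝ, V) 𝓘(ℝ, V × V) (fun τ : K => (c τ, c τ⁻¹)) σ
      ((ContinuousLinearMap.id ℝ V).prod (modelDeriv (fun τ : K => c τ⁻¹) σ) :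
        V →L[ℝ] V × V) :=
    ⟨(h.hasMFDerivAt σ).1.prodMk hD.1, HasFDerivWithinAt.prodMk (h.hasMFDerivAt σ).2 hD.2⟩
  exact hΦ.hasMFDerivAt.comp σ hpair

theorem modelDeriv_comp_coord_inv_apply {F : Type*} [NormedAddCommGroup F] [NormedSpace ℝ F]
    (h : IsAlgebraCoord c μ) {Φ : V × V → F} {Φ' : V × V →L[ℝ] F} {σ : K}
    (hΦ : HasFDerivAt Φ Φ' (c σ, c σ⁻¹)) (v : V) :
    modelDeriv (fun τ : K => Φ (c τ, c τ⁻¹)) σ v =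
      Φ' (v, modelDeriv (fun τ : K => c τ⁻¹) σ v) := by
  have h1 : modelDeriv (fun τ : K => Φ (c τ, c τ⁻¹)) σ = _ :=
    (h.hasMFDerivAt_comp_coord_inv hΦ).mfderiv
  rw [h1]
  rfl

/-- Differentiate $s+s'+ss'=0$ along $y^+$, where $s'$ is the coordinate of the inverse. This gives
$(1+s)\,ds'=-(1+s)\,y\,(1+s')$, and the factor $1+s$ cancels. -/
theorem modelDeriv_coord_inv (h : IsAlgebraCoord c μ) (σ : K) (y : V) :
    modelDeriv (fun τ : K => c τ⁻¹) σ (modelField y σ) = -(y + μ y (c σ⁻¹)) := by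
  set D : V →L[ℝ] V := modelDeriv (fun τ : K => c τ⁻¹) σ with hDdef
  have hfst : HasFDerivAt (fun p : V × V => p.1) (ContinuousLinearMap.fst ℝ V V)
    (c σ, c σ⁻¹) := hasFDerivAt_fst
  have hsnd : HasFDerivAt (fun p : V × V => p.2) (ContinuousLinearMap.snd ℝ V V)
    (c σ, c σ⁻¹) := hasFDerivAt_snd
  have hp := (hfst.add hsnd).add (μ.hasFDerivAt_of_bilinear hfst hsnd)
  have h1 := h.modelDeriv_comp_coord_inv_apply hp (modelField y σ)
  have h2 : (fun τ : K => c τ + c τ⁻¹ + μ (c τ) (c τ⁻¹)) = fun _ => 0 :=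
    funext fun τ => h.μ_add_μ_inv τ
  have h3 : modelDeriv (V := V) (fun _ : K => (0 : V)) σ = 0 := by
    unfold modelDeriv
    rw [mfderiv_const]
    rfl
  have h4 := h1
  change modelDeriv (fun τ : K => c τ + c τ⁻¹ + μ (c τ) (c τ⁻¹)) σ _ = _ at h4
  rw [h2, h3] at h4
  have h5 : modelField y σ + D (modelField y σ) +
      (μ (c σ) (D (modelField y σ)) + μ (modelField y σ) (c σ⁻¹)) = 0 := h4.symm
  have h6 : leftMul c μ σ (D (modelField y σ)) = leftMul c μ σ (-(y + μ y (c σ⁻¹))) := by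
    have h6 := h.modelField_eq y σ
    rw [map_neg, map_add, h.leftMul_μ, ← h6, leftMul_apply, eq_neg_iff_add_eq_zero,
      ← h5]
    abel
  have h7 := congrArg (leftMul c μ σ⁻¹) h6
  rwa [h.leftMul_inv_leftMul, h.leftMul_inv_leftMul] at h7

theorem modelDeriv_comp_coord_inv {F : Type*} [NormedAddCommGroup F] [NormedSpace ℝ F]
    (h : IsAlgebraCoord c μ) {Φ : V × V → F} {Φ' : V × V →L[ℝ] F} {σ : K}
    (hΦ : HasFDerivAt Φ Φ' (c σ, c σ⁻¹)) (y : V) :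
    modelDeriv (fun τ : K => Φ (c τ, c τ⁻¹)) σ (modelField y σ) =
      Φ' (leftMul c μ σ y, -(y + μ y (c σ⁻¹))) := by
  rw [h.modelDeriv_comp_coord_inv_apply hΦ, h.modelDeriv_coord_inv, h.modelField_eq]

theorem contMDiff_comp_coord_inv {F : Type*} [NormedAddCommGroup F] [NormedSpace ℝ F]
    (h : IsAlgebraCoord c μ) {Φ : V × V → F} (hΦ : ContDiff ℝ ∞ Φ) :
    ContMDiff 𝓘(ℝ, V) 𝓘(ℝ, F) ∞ (fun τ : K => Φ (c τ, c τ⁻¹)) :=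
  hΦ.contMDiff.comp (h.contMDiff.prodMk_space h.contMDiff_coord_inv)

theorem contMDiff_modelCoAd (h : IsAlgebraCoord c μ) (α : V →L[ℝ] ℝ) :
    ContMDiff 𝓘(ℝ, V) 𝓘(ℝ, V →L[ℝ] ℝ) ∞ (modelCoAd α : K → V →L[ℝ] ℝ) := by
  have h1 : (modelCoAd α : K → V →L[ℝ] ℝ) = fun σ => orbitPoly μ α (c σ, c σ⁻¹) :=
    funext fun σ => h.modelCoAd_eq_orbitPoly α σ
  rw [h1]
  refine h.contMDiff_comp_coord_inv ?_
  have h2 : ContDiff ℝ ∞ fun p : V × V => ContinuousLinearMap.id ℝ V + μ p.2 :=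
    contDiff_const.add (μ.contDiff.comp contDiff_snd)
  have h3 : ContDiff ℝ ∞ fun p : V × V => ContinuousLinearMap.id ℝ V + μ.flip p.1 :=
    contDiff_const.add (μ.flip.contDiff.comp contDiff_fst)
  exact contDiff_const.clm_comp (h2.clm_comp h3)

/-- Along $y^+$ the vector $\mathrm{Ad}_{\sigma^{-1}}x$ varies by its bracket with `y`. Both the
momentum identity and the degeneracy argument for open orbits rest on this formula. -/
theorem modelDeriv_modelCoAd_apply (h : IsAlgebraCoord c μ) (α : V →L[ℝ] ℝ) (x y : V) (σ : K) :
    modelDeriv (fun τ : K => modelCoAd α τ x) σ (modelField y σ) =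
      α (μ (adj c μ σ⁻¹ x) y - μ y (adj c μ σ⁻¹ x)) := by
  have h1 : (fun τ : K => modelCoAd α τ x) =
      fun τ => α ((x + μ x (c τ)) + μ (c τ⁻¹) (x + μ x (c τ))) := by
    funext τ
    rw [h.modelCoAd_eq_orbitPoly]
    rfl
  have hw : HasFDerivAt (fun p : V × V => x + μ x p.1)
      ((μ x).comp (ContinuousLinearMap.fst ℝ V V)) (c σ, c σ⁻¹) :=
    ((μ x).hasFDerivAt.comp _ hasFDerivAt_fst).const_add x
  have h2 := α.hasFDerivAt.comp (c σ, c σ⁻¹)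
    (hw.add (μ.hasFDerivAt_of_bilinear (f := fun p : V × V => p.2) hasFDerivAt_snd hw))
  rw [h1]
  refine (h.modelDeriv_comp_coord_inv h2 y).trans ?_
  change α (μ x (leftMul c μ σ y) + (μ (c σ⁻¹) (μ x (leftMul c μ σ y)) +
    μ (-(y + μ y (c σ⁻¹))) (x + μ x (c σ)))) = _
  congr 1
  rw [adj_apply, inv_inv]
  simp only [leftMul_apply, map_add, map_neg, _root_.add_apply, _root_.neg_apply, h.assoc]
  abel

/-- If $y\ne0$ were in the radical, the orbit map would have singular derivative everywhere. Source
and target have equal dimension, so its image would have Haar measure zero, which a nonempty open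
set does not. -/
theorem eq_zero_of_isOpen_range_modelCoAd [FiniteDimensional ℝ V] (h : IsAlgebraCoord c μ)
    (α : V →L[ℝ] ℝ) (hopen : IsOpen (Set.range (modelCoAd α : K → V →L[ℝ] ℝ))) (y : V)
    (hy : ∀ x, α (μ x y - μ y x) = 0) : y = 0 := by
  by_contra hy0
  let _ : MeasurableSpace V := borel V
  have : BorelSpace V := ⟨rfl⟩
  have hrank : Module.finrank ℝ (V →L[ℝ] ℝ) = Module.finrank ℝ V := by
    rw [← (LinearMap.toContinuousLinearMap (𝕜 := ℝ) (E := V) (F' := ℝ)).finrank_eq]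
    exact Subspace.dual_finrank_eq
  let e : (V →L[ℝ] ℝ) ≃L[ℝ] V := ContinuousLinearEquiv.ofFinrankEq hrank
  let ψ : V → V := fun z => e (modelCoAd α (h.chart.symm z))
  have himage : ψ '' h.chart.target = e '' Set.range (modelCoAd α : K → V →L[ℝ] ℝ) := by
    ext w
    constructor
    · rintro ⟨z, -, rfl⟩
      exact ⟨_, ⟨_, rfl⟩, rfl⟩
    · rintro ⟨_, ⟨σ, rfl⟩, rfl⟩
      refine ⟨h.chart σ, h.chart.map_source (Set.mem_univ _), ?_⟩
      exact congrArg (fun τ => e (modelCoAd α τ)) (h.chart.left_inv (Set.mem_univ σ))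
  have hderiv : ∀ z ∈ h.chart.target, HasFDerivAt ψ
      ((e : (V →L[ℝ] ℝ) →L[ℝ] V).comp (modelDeriv (modelCoAd α) (h.chart.symm z))) z := by
    intro z hz
    have h1 : HasMFDerivAt 𝓘(ℝ, V) 𝓘(ℝ, V) h.chart.symm z
        (ContinuousLinearMap.id ℝ V : V →L[ℝ] V) := by
      refine h.hasMFDerivAt_of_comp (h.chart.symm.continuousAt hz) ?_
      refine (hasMFDerivAt_id z).congr_of_eventuallyEq ?_
      filter_upwards [h.chart.open_target.mem_nhds hz] with w hw
      exact h.chart_symm_apply hw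
    have h2 : HasMFDerivAt 𝓘(ℝ, V) 𝓘(ℝ, V →L[ℝ] ℝ) (modelCoAd α : K → V →L[ℝ] ℝ)
        (h.chart.symm z) (modelDeriv (modelCoAd α) (h.chart.symm z) : V →L[ℝ] V →L[ℝ] ℝ) :=
      ((h.contMDiff_modelCoAd α _).mdifferentiableAt (by simp)).hasMFDerivAt
    have h3 : HasFDerivAt (fun z => (modelCoAd α (h.chart.symm z) : V →L[ℝ] ℝ))
        (modelDeriv (modelCoAd α) (h.chart.symm z)) z :=
      (h2.comp z h1).hasFDerivAt
    exact e.hasFDerivAt.comp z h3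
  have hdet : ∀ z ∈ h.chart.target,
      ((e : (V →L[ℝ] ℝ) →L[ℝ] V).comp (modelDeriv (modelCoAd α) (h.chart.symm z))).det = 0 := by
    intro z hz
    set σ := h.chart.symm z
    have hker : modelDeriv (modelCoAd α) σ (modelField y σ) = 0 := by
      ext x
      have h1 : modelDeriv (fun τ : K => modelCoAd α τ x) σ (modelField y σ) =
          modelDeriv (modelCoAd α) σ (modelField y σ) x := by
        have h2 : HasMFDerivAt 𝓘(ℝ, V) 𝓘(ℝ, V →L[ℝ] ℝ) (modelCoAd α : K → V →L[ℝ] ℝ)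
            σ (modelDeriv (modelCoAd α) σ : V →L[ℝ] V →L[ℝ] ℝ) :=
          ((h.contMDiff_modelCoAd α _).mdifferentiableAt (by simp)).hasMFDerivAt
        have h3 := (ContinuousLinearMap.apply ℝ ℝ x).hasFDerivAt
          (x := modelCoAd α σ) |>.hasMFDerivAt.comp σ h2
        exact DFunLike.congr_fun h3.mfderiv (modelField y σ)
      rw [← h1, h.modelDeriv_modelCoAd_apply, hy]
      rfl
    by_contra hne
    have h5 : modelField y σ = 0 := by
      refine (LinearMap.equivOfDetNeZero _ hne).injective ?_
      rw [map_zero]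
      change e (modelDeriv (modelCoAd α) σ (modelField y σ)) = 0
      rw [hker, map_zero]
    rw [h.modelField_eq] at h5
    apply hy0
    rw [← h.leftMul_inv_leftMul σ y, h5, map_zero]
  have hzero := MeasureTheory.addHaar_image_eq_zero_of_det_fderivWithin_eq_zero
    (MeasureTheory.Measure.addHaar (G := V))
    (fun z hz => (hderiv z hz).hasFDerivWithinAt) hdet
  rw [himage] at hzero
  have hopen' : IsOpen (e '' Set.range (modelCoAd α : K → V →L[ℝ] ℝ)) :=
    e.toHomeomorph.isOpenMap _ hopen
  exact (hopen'.measure_pos _ ⟨_, ⟨_, ⟨1, rfl⟩, rfl⟩⟩).ne' hzero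

variable [CompleteSpace V]

theorem formAtOne_modelCoboundary (h : IsAlgebraCoord c μ) (α : V →L[ℝ] ℝ) (x y : V) :
    formAtOne (modelCoboundary (K := K) α) x y = -α (μ x y - μ y x) := by
  rw [← h.lie_eq]
  rfl

theorem isMomentumMap_neg_coAd (h : IsAlgebraCoord c μ) (α : V →L[ℝ] ℝ) :
    IsMomentumMap 𝓘(ℝ, V) (modelCoboundary (K := K) α)
      (fun σ => -coAd (K := K) 𝓘(ℝ, V) σ α) := by
  have hsmooth : ∀ x : V, ContMDiff 𝓘(ℝ, V) 𝓘(ℝ, ℝ) ∞ (fun σ : K => modelCoAd α σ x) :=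
    fun x => (ContinuousLinearMap.apply ℝ ℝ x).contMDiff.comp (h.contMDiff_modelCoAd α)
  have key : ∀ (x : V) (σ : K) (v : V),
      modelDeriv (fun τ : K => -modelCoAd α τ x) σ v =
        modelForm (modelCoboundary α) σ (modelRightField x σ) v := by
    intro x σ v
    -- Every tangent vector is the value of a left-invariant field, so it suffices to compare both
    -- sides on such fields.
    have hv : v = modelField (leftMul c μ σ⁻¹ v) σ := by
      rw [h.modelField_eq, h.leftMul_leftMul_inv]
    have h1 : modelDeriv (V := V) (fun τ : K => -modelCoAd α τ x) σ =
        -modelDeriv (fun τ : K => modelCoAd α τ x) σ :=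
      ((hsmooth x σ).mdifferentiableAt (by simp)).hasMFDerivAt.neg.mfderiv
    rw [hv, h1, h.modelRightField_eq, h.modelForm_modelField, _root_.neg_apply,
      h.modelDeriv_modelCoAd_apply, h.formAtOne_modelCoboundary]
  exact fun x => ⟨(hsmooth x).neg, key x⟩

theorem isSymplectic_modelCoboundary (h : IsAlgebraCoord c μ) (α : V →L[ℝ] ℝ)
    (hsep : ∀ y, (∀ x, α (μ x y - μ y x) = 0) → y = 0) :
    IsSymplectic 𝓘(ℝ, V) (modelCoboundary (K := K) α) := by
  have hform := h.formAtOne_modelCoboundary α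
  have halt : ∀ x : V, formAtOne (modelCoboundary (K := K) α) x x = 0 := by
    intro x
    rw [hform, sub_self, map_zero, neg_zero]
  have hleft : ∀ x : V, (∀ y, formAtOne (modelCoboundary (K := K) α) x y = 0) → x = 0 := by
    intro x hx
    refine hsep x fun y => ?_
    have := hx y
    rw [hform, ← map_neg, neg_sub] at this
    exact this
  have hright : ∀ y : V, (∀ x, formAtOne (modelCoboundary (K := K) α) x y = 0) → y = 0 := by
    intro y hy
    refine hsep y fun x => ?_
    have := hy x
    rwa [hform, neg_eq_zero] at this
  have hclosed : ∀ x y z : V,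
      formAtOne (modelCoboundary (K := K) α) (modelLie (K := K) x y) z +
        formAtOne (modelCoboundary (K := K) α) (modelLie (K := K) y z) x +
        formAtOne (modelCoboundary (K := K) α) (modelLie (K := K) z x) y = 0 := by
    intro x y z
    rw [hform, hform, hform, h.lie_eq, h.lie_eq, h.lie_eq, ← neg_add, ← neg_add, ← map_add,
      ← map_add, neg_eq_zero]
    -- Closedness of `δα` is `α` applied to the Jacobi identity, which for commutators follows from
    -- associativity.
    simp only [map_sub, _root_.sub_apply, h.assoc]
    convert! map_zero α using 2
    abel
  exact ⟨halt, ⟨hleft, hright⟩, hclosed⟩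

end IsAlgebraCoord

end LieGrp

/-! ### Left-symmetric products and the commutator form -/

namespace LieGrp

section Algebra

variable {V : Type*} [NormedAddCommGroup V] [NormedSpace ℝ V]
  {V' : Type*} [NormedAddCommGroup V'] [NormedSpace ℝ V']

/-- The product `(x, y) ↦ π (μ (L x) (L y))`. -/
def transferMul (L : V' →L[ℝ] V) (π : V →L[ℝ] V') (μ : V →L[ℝ] V →L[ℝ] V) :
    V' →L[ℝ] V' →L[ℝ] V' :=
  (ContinuousLinearMap.compL ℝ V' V V' π).comp (μ.bilinearComp L L)

@[simp] theorem transferMul_apply (L : V' →L[ℝ] V) (π : V →L[ℝ] V') (μ : V →L[ℝ] V →L[ℝ] V)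
    (x y : V') : transferMul L π μ x y = π (μ (L x) (L y)) := rfl

theorem IsLeftSymmetric.restrict {μ B : V →L[ℝ] V →L[ℝ] V} (h : IsLeftSymmetric μ B)
    {μ' B' : V' →L[ℝ] V' →L[ℝ] V'} {L : V' →L[ℝ] V} (hL : Function.Injective L)
    (hμ : ∀ x y, L (μ' x y) = μ (L x) (L y)) (hB : ∀ x y, L (B' x y) = B (L x) (L y)) :
    IsLeftSymmetric μ' B' where
  torsion x y := hL (by simp only [map_sub, hμ, hB, h.torsion])
  flat x y z := hL (by
    rw [map_sub, hB, hB, hB, hB, hB, h.flat, map_sub L, hμ, hμ])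

theorem IsLeftSymmetric.quotient {μ B : V →L[ℝ] V →L[ℝ] V} (h : IsLeftSymmetric μ B)
    {μ' B' : V' →L[ℝ] V' →L[ℝ] V'} {Q : V →L[ℝ] V'} (hQ : Function.Surjective Q)
    (hμ : ∀ x y, Q (μ x y) = μ' (Q x) (Q y)) (hB : ∀ x y, Q (B x y) = B' (Q x) (Q y)) :
    IsLeftSymmetric μ' B' where
  torsion x y := by
    obtain ⟨x, rfl⟩ := hQ x
    obtain ⟨y, rfl⟩ := hQ y
    rw [← hB, ← hB, ← map_sub, h.torsion, map_sub, hμ, hμ]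
  flat x y z := by
    obtain ⟨x, rfl⟩ := hQ x
    obtain ⟨y, rfl⟩ := hQ y
    obtain ⟨z, rfl⟩ := hQ z
    rw [← hμ, ← hμ, ← hB, ← hB, ← hB, ← hB, ← map_sub, ← map_sub, h.flat, hB]

/-- The form `ω(x, y) = -α(x y - y x)` on an algebra. -/
def commForm (μ : V →L[ℝ] V →L[ℝ] V) (α : V →L[ℝ] ℝ) : LinearMap.BilinForm ℝ V :=
  LinearMap.mk₂ ℝ (fun x y => -α (μ x y - μ y x))
    (by intro x x' y; simp only [map_add, _root_.add_apply, map_sub]; ring)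
    (by intro c x y; simp only [map_smul, _root_.smul_apply, map_sub, smul_eq_mul]; ring)
    (by intro x y y'; simp only [map_add, _root_.add_apply, map_sub]; ring)
    (by intro c x y; simp only [map_smul, _root_.smul_apply, map_sub, smul_eq_mul]; ring)

theorem commForm_apply (μ : V →L[ℝ] V →L[ℝ] V) (α : V →L[ℝ] ℝ) (x y : V) :
    commForm μ α x y = -α (μ x y - μ y x) := rfl

theorem commForm_neg (μ : V →L[ℝ] V →L[ℝ] V) (α : V →L[ℝ] ℝ) (x y : V) :
    -commForm μ α x y = commForm μ α y x := by
  rw [commForm_apply, commForm_apply, ← map_neg, neg_sub]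

theorem commForm_isRefl (μ : V →L[ℝ] V →L[ℝ] V) (α : V →L[ℝ] ℝ) : (commForm μ α).IsRefl := by
  intro x y h
  rw [← commForm_neg, h, neg_zero]

theorem commForm_closed {μ : V →L[ℝ] V →L[ℝ] V} (assoc : ∀ x y z, μ (μ x y) z = μ x (μ y z))
    (α : V →L[ℝ] ℝ) (x y z : V) :
    commForm μ α (μ x y - μ y x) z + commForm μ α (μ y z - μ z y) x +
      commForm μ α (μ z x - μ x z) y = 0 := by
  rw [commForm_apply, commForm_apply, commForm_apply, ← neg_add, ← neg_add, ← map_add,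
    ← map_add, neg_eq_zero]
  simp only [map_sub, _root_.sub_apply, assoc]
  convert! map_zero α using 2
  abel

theorem commForm_nondegenerate {μ : V →L[ℝ] V →L[ℝ] V} {α : V →L[ℝ] ℝ}
    (h : ∀ y, (∀ x, α (μ x y - μ y x) = 0) → y = 0) : (commForm μ α).Nondegenerate := by
  have hr : ∀ y, (∀ x, commForm μ α x y = 0) → y = 0 := fun y hy => h y fun x => by
    have := hy x
    rwa [commForm_apply, neg_eq_zero] at this
  exact ⟨fun x hx => hr x fun y => by rw [← commForm_neg, hx, neg_zero], hr⟩

/-- The left-symmetric product determined by a nondegenerate form `ω = commForm μ α` through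
`ω(x * y, z) = -ω(y, [x, z])`. -/
theorem exists_leftSymmetric [FiniteDimensional ℝ V] {μ : V →L[ℝ] V →L[ℝ] V}
    (assoc : ∀ x y z, μ (μ x y) z = μ x (μ y z)) {α : V →L[ℝ] ℝ}
    (hω : (commForm μ α).Nondegenerate) :
    ∃ B : V →L[ℝ] V →L[ℝ] V, IsLeftSymmetric μ B ∧
      ∀ x y z, commForm μ α (B x y) z = -commForm μ α y (μ x z - μ z x) := by
  -- `φ x y` is the functional $z\mapsto-\omega(y,[x,z])$. Nondegeneracy represents it as
  -- $\omega(B(x,y),\cdot)$.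
  let φ : V → V → Module.Dual ℝ V := fun x y =>
    -(commForm μ α y ∘ₗ ((μ x - μ.flip x : V →L[ℝ] V) : V →ₗ[ℝ] V))
  let e := (commForm μ α).toDual hω
  let B₀ : V →ₗ[ℝ] V →ₗ[ℝ] V := LinearMap.mk₂ ℝ (fun x y => e.symm (φ x y))
    (by
      intro x x' y
      rw [← map_add]
      congr 1
      ext z
      simp [φ]
      ring)
    (by
      intro c x y
      rw [← map_smul]
      congr 1
      ext z
      simp [φ]
      ring)
    (by
      intro x y y'
      rw [← map_add]
      congr 1
      ext z
      simp [φ]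
      ring)
    (by
      intro c x y
      rw [← map_smul]
      congr 1
      ext z
      simp [φ])
  let B : V →L[ℝ] V →L[ℝ] V :=
    LinearMap.toContinuousLinearMap
      ((LinearMap.toContinuousLinearMap (𝕜 := ℝ) (E := V) (F' := V)).toLinearMap ∘ₗ B₀)
  have hB : ∀ x y z, commForm μ α (B x y) z = -commForm μ α y (μ x z - μ z x) := by
    intro x y z
    have h1 : e (B x y) = φ x y := e.apply_symm_apply _
    have h2 := DFunLike.congr_fun h1 z
    rw [LinearMap.BilinForm.toDual_def] at h2
    exact h2
  have hext : ∀ x y, (∀ z, commForm μ α x z = commForm μ α y z) → x = y := by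
    intro x y hxy
    rw [← sub_eq_zero]
    refine hω.1 _ fun z => ?_
    rw [map_sub, LinearMap.sub_apply, hxy, sub_self]
  refine ⟨B, ⟨fun x y => hext _ _ fun z => ?_, fun x y z => hext _ _ fun w => ?_⟩, hB⟩
  -- Torsion-freeness, paired with `z`, is the cocycle identity for the form.
  · rw [map_sub, LinearMap.sub_apply, hB, hB]
    have h1 := commForm_closed assoc α x y z
    rw [← commForm_neg μ α x, ← commForm_neg μ α y, ← neg_sub (μ x z), map_neg] at h1
    linarith
  -- Flatness says that minus the adjoint of `ad` is again a representation. Moving all operators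
  -- onto `w` leaves the Jacobi identity.
  · rw [map_sub, LinearMap.sub_apply, hB, hB, hB, hB, hB, neg_neg, neg_neg, ← map_sub, ← map_neg]
    congr 1
    simp only [map_sub, _root_.sub_apply, assoc]
    abel

end Algebra

end LieGrp

/-! ### Algebra coordinates of subgroups, quotients and homomorphisms -/

namespace LieGrp

theorem IsGlobalCoord.of_isOpenEmbedding {V : Type*} [NormedAddCommGroup V] {M : Type*}
    [TopologicalSpace M] [Nonempty M] {c : M → V} (hc : Topology.IsOpenEmbedding c) :
    @IsGlobalCoord V _ M _ hc.singletonChartedSpace c :=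
  let _ := hc.singletonChartedSpace
  { isOpenEmbedding := hc
    chart_eq := ⟨0, fun x y => by
      rw [add_zero, hc.singletonChartedSpace_chartAt_eq]⟩ }

/-- The group law in algebra coordinates, without any manifold structure. -/
structure IsAlgebraEmbedding {V : Type*} [NormedAddCommGroup V] [NormedSpace ℝ V] {K : Type*}
    [TopologicalSpace K] [Group K] (c : K → V) (μ : V →L[ℝ] V →L[ℝ] V) : Prop where
  isOpenEmbedding : Topology.IsOpenEmbedding c
  map_one : c 1 = 0
  map_mul : ∀ σ τ, c (σ * τ) = c σ + c τ + μ (c σ) (c τ)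
  assoc : ∀ x y z, μ (μ x y) z = μ x (μ y z)
  -- The group contains every `s` for which `1 + s` is invertible. Algebra homomorphisms preserve
  -- such `s`, which is what lets them lift to group homomorphisms.
  mem_range : ∀ s t, s + t + μ s t = 0 → t + s + μ t s = 0 → s ∈ Set.range c

namespace IsAlgebraEmbedding

variable {V : Type*} [NormedAddCommGroup V] [NormedSpace ℝ V]
  {K : Type*} [TopologicalSpace K] [Group K] {c : K → V} {μ : V →L[ℝ] V →L[ℝ] V}
  {V' : Type*} [NormedAddCommGroup V'] [NormedSpace ℝ V']
  {K' : Type*} [TopologicalSpace K'] [Group K'] {c' : K' → V'} {μ' : V' →L[ℝ] V' →L[ℝ] V'}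

theorem isAlgebraCoord (h : IsAlgebraEmbedding c μ) :
    @IsAlgebraCoord V _ _ K _ h.isOpenEmbedding.singletonChartedSpace _ c μ :=
  let _ := h.isOpenEmbedding.singletonChartedSpace
  { IsGlobalCoord.of_isOpenEmbedding h.isOpenEmbedding with
    map_one := h.map_one
    map_mul := h.map_mul
    assoc := h.assoc }

theorem lieGroup [CompleteSpace V] (h : IsAlgebraEmbedding c μ) :
    @LieGroup ℝ _ V _ V _ _ 𝓘(ℝ, V) ∞ K _ _ h.isOpenEmbedding.singletonChartedSpace :=
  let _ := h.isOpenEmbedding.singletonChartedSpace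
  have : IsManifold 𝓘(ℝ, V) ∞ K := h.isOpenEmbedding.isManifold_singleton
  h.isAlgebraCoord.lieGroup

theorem add_inv (h : IsAlgebraEmbedding c μ) (σ : K) : c σ + c σ⁻¹ + μ (c σ) (c σ⁻¹) = 0 := by
  rw [← h.map_mul, mul_inv_cancel, h.map_one]

theorem inv_add (h : IsAlgebraEmbedding c μ) (σ : K) : c σ⁻¹ + c σ + μ (c σ⁻¹) (c σ) = 0 := by
  rw [← h.map_mul, inv_mul_cancel, h.map_one]

/-- A homomorphism of algebras lifts to a homomorphism of groups. -/
theorem exists_monoidHom (h : IsAlgebraEmbedding c μ) (h' : IsAlgebraEmbedding c' μ')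
    (L : V →L[ℝ] V') (hL : ∀ x y, L (μ x y) = μ' (L x) (L y)) :
    ∃ f : K →* K', ∀ σ, c' (f σ) = L (c σ) := by
  have hmem : ∀ σ, ∃ τ, c' τ = L (c σ) := by
    intro σ
    refine h'.mem_range (L (c σ)) (L (c σ⁻¹)) ?_ ?_
    · rw [← hL, ← map_add, ← map_add, h.add_inv, map_zero]
    · rw [← hL, ← map_add, ← map_add, h.inv_add, map_zero]
  choose f hf using hmem
  refine ⟨MonoidHom.mk' f fun σ τ => h'.isOpenEmbedding.injective ?_, hf⟩
  rw [hf, h.map_mul, h'.map_mul, hf, hf, map_add, map_add, hL]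

/-- An isomorphism of algebras lifts to an isomorphism of groups. -/
theorem exists_mulEquiv (h : IsAlgebraEmbedding c μ) (h' : IsAlgebraEmbedding c' μ')
    (L : V ≃L[ℝ] V') (hL : ∀ x y, L (μ x y) = μ' (L x) (L y)) :
    ∃ f : K ≃* K', (∀ σ, c' (f σ) = L (c σ)) ∧ ∀ τ, c (f.symm τ) = L.symm (c' τ) := by
  have hL' : ∀ x y, L.symm (μ' x y) = μ (L.symm x) (L.symm y) := by
    intro x y
    apply L.injective
    rw [L.apply_symm_apply, hL, L.apply_symm_apply, L.apply_symm_apply]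
  obtain ⟨f, hf⟩ := h.exists_monoidHom h' (L : V →L[ℝ] V') hL
  obtain ⟨k, hk⟩ := h'.exists_monoidHom h (L.symm : V' →L[ℝ] V) hL'
  refine ⟨MonoidHom.toMulEquiv f k ?_ ?_, hf, hk⟩
  · ext σ
    apply h.isOpenEmbedding.injective
    change c (k (f σ)) = c σ
    rw [hk, hf]
    exact L.symm_apply_apply _
  · ext τ
    apply h'.isOpenEmbedding.injective
    change c' (f (k τ)) = c' τ
    rw [hf, hk]
    exact L.apply_symm_apply _

/-- Restriction of algebra coordinates to a subgroup given by a linear subspace. -/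
theorem restrict (h : IsAlgebraEmbedding c μ) {S : Subgroup K} {L : V' →L[ℝ] V}
    {π : V →L[ℝ] V'} (hπ : ∀ v, π (L v) = v) (hS : ∀ σ, σ ∈ S ↔ L (π (c σ)) = c σ)
    (hμ : ∀ x y, L (π (μ (L x) (L y))) = μ (L x) (L y)) :
    IsAlgebraEmbedding (fun σ : S => π (c σ)) (transferMul L π μ) := by
  have hc : ∀ σ : S, L (π (c σ)) = c σ := fun σ => (hS σ).1 σ.2
  have hL : Function.Injective L := Function.LeftInverse.injective hπ
  have hmem : ∀ s t, s + t + transferMul L π μ s t = 0 → t + s + transferMul L π μ t s = 0 →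
      s ∈ Set.range (fun σ : S => π (c σ)) := by
    intro s t h1 h2
    obtain ⟨σ, hσ⟩ := h.mem_range (L s) (L t)
      (by rw [← hμ, ← map_add, ← map_add, ← transferMul_apply, h1, map_zero])
      (by rw [← hμ, ← map_add, ← map_add, ← transferMul_apply, h2, map_zero])
    refine ⟨⟨σ, (hS σ).2 (by rw [hσ, hπ])⟩, ?_⟩
    change π (c σ) = s
    rw [hσ, hπ]
  have hcomp : (fun σ : S => L (π (c σ))) = c ∘ Subtype.val := funext hc
  have hrange : Set.range (fun σ : S => π (c σ)) = L ⁻¹' Set.range c := by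
    ext s
    constructor
    · rintro ⟨σ, rfl⟩
      exact ⟨σ, (hc σ).symm⟩
    · rintro ⟨σ, hσ⟩
      refine ⟨⟨σ, (hS σ).2 (by rw [hσ, hπ])⟩, ?_⟩
      change π (c σ) = s
      rw [hσ, hπ]
  refine ⟨⟨?_, ?_⟩, ?_, ?_, ?_, hmem⟩
  · have h1 : Topology.IsEmbedding L :=
      Topology.IsEmbedding.of_leftInverse hπ π.continuous L.continuous
    refine (Topology.IsEmbedding.of_comp_iff h1).1 ?_
    change Topology.IsEmbedding (fun σ : S => L (π (c σ)))
    rw [hcomp]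
    exact h.isOpenEmbedding.isEmbedding.comp Topology.IsEmbedding.subtypeVal
  · rw [hrange]
    exact h.isOpenEmbedding.isOpen_range.preimage L.continuous
  · change π (c 1) = 0
    rw [h.map_one, map_zero]
  · intro σ τ
    change π (c (σ * τ)) = _
    rw [h.map_mul, map_add, map_add, transferMul_apply, hc, hc]
  · intro x y z
    apply hL
    simp only [transferMul_apply, hμ, h.assoc]

/-- The coordinates of a quotient group given by a quotient algebra. -/
def quotCoord (c : K → V) (Q : V →L[ℝ] V') (N : Subgroup K)
    (hQ : ∀ σ τ, σ⁻¹ * τ ∈ N → Q (c σ) = Q (c τ)) : K ⧸ N → V' :=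
  Quotient.lift (fun σ => Q (c σ)) fun σ τ hστ => hQ σ τ (QuotientGroup.leftRel_apply.1 hστ)

/-- Since `Q` is multiplicative, $1+s\mapsto1+Qs$ is a homomorphism with kernel `N`, and its fibers
are the cosets of `N`. -/
theorem quotCoord_compat (h : IsAlgebraEmbedding c μ) {N : Subgroup K} {Q : V →L[ℝ] V'}
    (hN : ∀ σ, σ ∈ N ↔ Q (c σ) = 0)
    (hμ : ∀ x y, Q (μ x y) = μ' (Q x) (Q y)) (σ τ : K) :
    σ⁻¹ * τ ∈ N ↔ Q (c σ) = Q (c τ) := by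
  constructor
  · intro hστ
    have h1 := h.map_mul σ (σ⁻¹ * τ)
    rw [mul_inv_cancel_left] at h1
    rw [h1, map_add, map_add, hμ, (hN _).1 hστ, map_zero, add_zero, add_zero]
  · intro hστ
    rw [hN, h.map_mul, map_add, map_add, hμ, ← hστ, ← hμ, ← map_add, ← map_add, h.inv_add,
      map_zero]

/-- Algebra coordinates of a quotient group given by a quotient algebra. -/
theorem quotient (h : IsAlgebraEmbedding c μ) [IsTopologicalGroup K] {N : Subgroup K} [N.Normal]
    {Q : V →L[ℝ] V'}
    {S : V' →L[ℝ] V} (hS : ∀ v, Q (S v) = v) (hN : ∀ σ, σ ∈ N ↔ Q (c σ) = 0)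
    (hQ : ∀ σ τ, σ⁻¹ * τ ∈ N → Q (c σ) = Q (c τ))
    (hμ : ∀ x y, Q (μ x y) = μ' (Q x) (Q y)) (hSμ : ∀ x y, S (μ' x y) = μ (S x) (S y)) :
    IsAlgebraEmbedding (quotCoord c Q N hQ) μ' := by
  have hmk : ∀ σ : K, quotCoord c Q N hQ (QuotientGroup.mk' N σ) = Q (c σ) := fun _ => rfl
  have hsurj : Function.Surjective (QuotientGroup.mk' N) := QuotientGroup.mk'_surjective N
  have hQopen : IsOpenMap Q := by
    intro U hU
    have hadd : ∀ a : V, IsOpen {v | S v + a ∈ U} := fun a =>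
      hU.preimage (S.continuous.add continuous_const)
    -- The image is a union over the kernel of preimages of `U` under the translates of the section
    -- `S`, each of which is open.
    have : Q '' U = ⋃ a ∈ {a : V | Q a = 0}, {v | S v + a ∈ U} := by
      ext w
      simp only [Set.mem_image, Set.mem_iUnion, Set.mem_ofPred_eq, exists_prop]
      constructor
      · rintro ⟨u, hu, rfl⟩
        refine ⟨u - S (Q u), by rw [map_sub, hS, sub_self], ?_⟩
        rwa [add_sub_cancel]
      · rintro ⟨a, ha, hw⟩
        exact ⟨_, hw, by rw [map_add, hS, ha, add_zero]⟩
    rw [this]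
    exact isOpen_biUnion fun a _ => hadd a
  have hcont : Continuous (quotCoord c Q N hQ) :=
    Continuous.quotient_lift (Q.continuous.comp h.isOpenEmbedding.continuous) _
  have hinj : Function.Injective (quotCoord c Q N hQ) := by
    intro r r' hr
    obtain ⟨σ, rfl⟩ := hsurj r
    obtain ⟨τ, rfl⟩ := hsurj r'
    exact QuotientGroup.eq.2 ((h.quotCoord_compat hN hμ σ τ).2 hr)
  have hopen : IsOpenMap (quotCoord c Q N hQ) := by
    intro U hU
    have h1 : quotCoord c Q N hQ '' U = (fun σ => Q (c σ)) '' (QuotientGroup.mk' N ⁻¹' U) := by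
      ext w
      constructor
      · rintro ⟨r, hr, rfl⟩
        obtain ⟨σ, rfl⟩ := hsurj r
        exact ⟨σ, hr, rfl⟩
      · rintro ⟨σ, hσ, rfl⟩
        exact ⟨_, hσ, rfl⟩
    rw [h1]
    exact (hQopen.comp h.isOpenEmbedding.isOpenMap) _ (hU.preimage QuotientGroup.continuous_mk)
  refine ⟨.of_continuous_injective_isOpenMap hcont hinj hopen, ?_, ?_, ?_, ?_⟩
  · change Q (c 1) = 0
    rw [h.map_one, map_zero]
  · intro r r'
    obtain ⟨σ, rfl⟩ := hsurj r
    obtain ⟨τ, rfl⟩ := hsurj r'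
    refine (hmk (σ * τ)).trans ?_
    rw [hmk, hmk, h.map_mul, map_add, map_add, hμ]
  · intro x y z
    rw [← hS x, ← hS y, ← hS z, ← hμ, ← hμ, h.assoc, hμ, hμ]
  · intro s t h1 h2
    -- Multiplicativity of the section `S` carries a two-sided inverse upstairs, so the lifted
    -- element belongs to the group.
    obtain ⟨σ, hσ⟩ := h.mem_range (S s) (S t)
      (by rw [← hSμ, ← map_add, ← map_add, h1, map_zero])
      (by rw [← hSμ, ← map_add, ← map_add, h2, map_zero])
    refine ⟨QuotientGroup.mk' N σ, ?_⟩
    rw [hmk, hσ, hS]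

end IsAlgebraEmbedding

end LieGrp

/-! ### The affine group as a group of units, and the map `JH` -/

namespace AffGrp

open LieGrp

variable {n : ℕ}

/-- The associative product of `ℝⁿ × gl(ℝⁿ)`, seen as an algebra of affine maps. -/
def gaMul (n : ℕ) : Model n →L[ℝ] Model n →L[ℝ] Model n :=
  LinearMap.toContinuousLinearMap
    { toFun := fun a : Model n => (a.2.comp (ContinuousLinearMap.fst ℝ (E n) (E n →L[ℝ] E n))).prod
        ((ContinuousLinearMap.compL ℝ (E n) (E n) (E n) a.2).comp
          (ContinuousLinearMap.snd ℝ (E n) (E n →L[ℝ] E n)))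
      map_add' := by intro a b; ext x <;> simp
      map_smul' := by intro t a; ext x <;> simp }

theorem gaMul_apply (a b : Model n) : gaMul n a b = (a.2 b.1, a.2.comp b.2) := rfl

/-- The coordinates of `GA(ℝⁿ)` in `ℝⁿ × gl(ℝⁿ)` which vanish at the identity. -/
def gaCoord (σ : GA n) : Model n := (σ.vec, (σ.lin : E n →L[ℝ] E n) - 1)

theorem gaCoord_fst (σ : GA n) : (gaCoord σ).1 = σ.vec := rfl

theorem gaCoord_snd (σ : GA n) : (gaCoord σ).2 = (σ.lin : E n →L[ℝ] E n) - 1 := rfl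

theorem gaMul_assoc (x y z : Model n) : gaMul n (gaMul n x y) z = gaMul n x (gaMul n y z) := rfl

theorem isAlgebraEmbedding_gaCoord : IsAlgebraEmbedding (gaCoord : GA n → Model n) (gaMul n) where
  isOpenEmbedding := by
    have h : (gaCoord : GA n → Model n) =
        Homeomorph.addRight ((0, -1) : Model n) ∘ GA.coord := by
      funext σ
      exact Prod.ext (add_zero σ.vec).symm (sub_eq_add_neg _ _)
    rw [h]
    exact (Homeomorph.isOpenEmbedding _).comp GA.isOpenEmbedding_coord
  map_one := Prod.ext rfl (sub_self _)
  map_mul σ τ := by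
    refine Prod.ext ?_ ?_
    · simp only [gaMul_apply, Prod.fst_add, gaCoord_fst, gaCoord_snd, GA.mul_vec,
        _root_.sub_apply, one_apply_eq_self]
      abel
    · simp only [gaMul_apply, Prod.snd_add, gaCoord_snd, GA.mul_lin, Units.val_mul]
      change _ = _ + ((σ.lin : E n →L[ℝ] E n) - 1) * ((τ.lin : E n →L[ℝ] E n) - 1)
      rw [sub_mul, mul_sub, mul_one, one_mul]
      abel
  assoc := gaMul_assoc
  mem_range s t h1 h2 := by
    have key : ∀ s t : Model n, s + t + gaMul n s t = 0 → (1 + s.2) * (1 + t.2) = 1 := by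
      intro s t h
      have h' : s.2 + t.2 + s.2 * t.2 = 0 := congrArg Prod.snd h
      calc (1 + s.2) * (1 + t.2) = 1 + (s.2 + t.2 + s.2 * t.2) := by
              rw [add_mul, one_mul, mul_add, mul_one]; abel
        _ = 1 := by rw [h', add_zero]
    exact ⟨⟨s.1, ⟨1 + s.2, 1 + t.2, key s t h1, key t s h2⟩⟩,
      Prod.ext rfl (add_sub_cancel_left _ _)⟩

theorem isAlgebraCoord_gaCoord : IsAlgebraCoord (gaCoord : GA n → Model n) (gaMul n) where
  isOpenEmbedding := isAlgebraEmbedding_gaCoord.isOpenEmbedding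
  -- The charts of `GA n` record `(x, T)`, whereas `gaCoord` records `(x, T - 1)`.
  chart_eq := ⟨(0, 1), fun x y => by
    rw [show chartAt (Model n) x y = GA.coord y by
      rw [GA.isOpenEmbedding_coord.singletonChartedSpace_chartAt_eq]]
    exact Prod.ext (add_zero _).symm (sub_add_cancel _ _).symm⟩
  map_one := isAlgebraEmbedding_gaCoord.map_one
  map_mul := isAlgebraEmbedding_gaCoord.map_mul
  assoc := gaMul_assoc

theorem leftMul_gaCoord (σ : GA n) (x : Model n) :
    leftMul gaCoord (gaMul n) σ x =
      ((σ.lin : E n →L[ℝ] E n) x.1, (σ.lin : E n →L[ℝ] E n).comp x.2) := by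
  change x + gaMul n (gaCoord σ) x = _
  rw [gaMul_apply, gaCoord_snd]
  refine Prod.ext ?_ ?_
  · change x.1 + ((σ.lin : E n →L[ℝ] E n) x.1 - x.1) = _
    rw [add_sub_cancel]
  · change x.2 + ((σ.lin : E n →L[ℝ] E n) - 1) * x.2 = (σ.lin : E n →L[ℝ] E n) * x.2
    rw [sub_mul, one_mul, add_sub_cancel]

/-- The linear form `covector g M` on the model space. -/
def modelCovector (g : E n →L[ℝ] ℝ) (M : E n →L[ℝ] E n) : Model n →L[ℝ] ℝ := covector g M

theorem modelCovector_inl (g : E n →L[ℝ] ℝ) (M : E n →L[ℝ] E n) (v : E n) :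
    modelCovector g M (v, 0) = g v := by
  change g v + LinearMap.trace ℝ (E n) ((M ∘L (0 : E n →L[ℝ] E n) : E n →L[ℝ] E n) :
    E n →ₗ[ℝ] E n) = g v
  rw [ContinuousLinearMap.comp_zero, ContinuousLinearMap.toLinearMap_zero, map_zero, add_zero]

/-- Translations form an ideal on which $\mathrm{Ad}_{\sigma^{-1}}$ acts by the inverse linear part.
`M` therefore disappears. -/
theorem JH_eq (g : E n →L[ℝ] ℝ) (M : E n →L[ℝ] E n) (σ : GA n) :
    JH (covector g M) σ = g.comp ((σ.lin⁻¹ : (E n →L[ℝ] E n)ˣ) : E n →L[ℝ] E n) := by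
  ext v
  change modelCoAd (modelCovector g M) σ (v, 0) = _
  rw [isAlgebraCoord_gaCoord.modelCoAd_eq, ContinuousLinearMap.comp_apply, adj_apply, gaMul_apply,
    leftMul_gaCoord]
  have h1 : ((v, 0) + ((0 : E n →L[ℝ] E n) (gaCoord σ⁻¹⁻¹).1,
      (0 : E n →L[ℝ] E n).comp (gaCoord σ⁻¹⁻¹).2) : Model n) = (v, 0) := by
    rw [_root_.zero_apply, ContinuousLinearMap.zero_comp]
    exact add_zero _
  rw [h1, ContinuousLinearMap.comp_zero, modelCovector_inl]
  rfl

theorem JH_mul (g : E n →L[ℝ] ℝ) (M : E n →L[ℝ] E n) (τ σ : GA n) :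
    JH (covector g M) (τ * σ) =
      (JH (covector g M) σ).comp ((τ.lin⁻¹ : (E n →L[ℝ] E n)ˣ) : E n →L[ℝ] E n) := by
  rw [JH_eq, JH_eq, GA.mul_lin, mul_inv_rev]
  rfl

theorem commForm_inl (g : E n →L[ℝ] ℝ) (M : E n →L[ℝ] E n) (a : Model n) (v : E n) :
    commForm (gaMul n) (modelCovector g M) a (v, 0) = -g (a.2 v) := by
  have h : gaMul n a (v, 0) - gaMul n (v, 0) a = (a.2 v, 0) := by
    rw [gaMul_apply, gaMul_apply]
    refine Prod.ext ?_ ?_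
    · exact sub_zero _
    · change a.2 * 0 - 0 * a.2 = 0
      rw [mul_zero, zero_mul, sub_zero]
  rw [commForm_apply, h, modelCovector_inl]

theorem JH_eq_coord (g : E n →L[ℝ] ℝ) (M : E n →L[ℝ] E n) :
    JH (covector g M) = fun σ : GA n => g.comp (1 + (gaCoord σ⁻¹).2) := by
  funext σ
  rw [JH_eq, gaCoord_snd, add_sub_cancel]
  rfl

theorem contMDiff_JH (g : E n →L[ℝ] ℝ) (M : E n →L[ℝ] E n) :
    ContMDiff 𝓘(ℝ, Model n) 𝓘(ℝ, E n →L[ℝ] ℝ) ∞ (JH (covector g M)) := by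
  rw [JH_eq_coord]
  have h : ContDiff ℝ ∞ fun p : Model n × Model n => g.comp (1 + p.2.2) :=
    contDiff_const.clm_comp (contDiff_const.add (contDiff_snd.comp contDiff_snd))
  exact isAlgebraCoord_gaCoord.contMDiff_comp_coord_inv h

/-- The linear part of an affine function of the linear part of an inverse. -/
def compSnd (q : E n →L[ℝ] ℝ) : Model n × Model n →L[ℝ] (E n →L[ℝ] ℝ) :=
  (ContinuousLinearMap.compL ℝ (E n) (E n) ℝ q).comp
    ((ContinuousLinearMap.snd ℝ (E n) (E n →L[ℝ] E n)).comp
      (ContinuousLinearMap.snd ℝ (Model n) (Model n)))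

theorem modelDeriv_comp_snd_inv (p q : E n →L[ℝ] ℝ) (σ : GA n) (y : Model n) :
    modelDeriv (fun τ : GA n => p + q.comp (gaCoord τ⁻¹).2) σ (modelField y σ) =
      -(q.comp (y.2 + y.2.comp (gaCoord σ⁻¹).2)) := by
  have h : HasFDerivAt (fun z : Model n × Model n => p + compSnd q z) (compSnd q)
      (gaCoord σ, gaCoord σ⁻¹) := (compSnd q).hasFDerivAt.const_add p
  refine (isAlgebraCoord_gaCoord.modelDeriv_comp_coord_inv h y).trans ?_
  exact ContinuousLinearMap.comp_neg q (y.2 + y.2.comp (gaCoord σ⁻¹).2)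

/-- At $\sigma=(x_0,T)$, the derivative of $g\circ T^{-1}$ along $y^+$ is $-g\circ y_2\circ T^{-1}$,
which has the same shape with $-g\circ y_2$ in place of `g`. A second derivative along $x^+$ gives
$g\circ y_2\circ x_2\circ T^{-1}$, and `hgB` identifies this with the derivative along $B(x,y)^+$.
-/
theorem isAffineMapToSpace_JH (g : E n →L[ℝ] ℝ) (M : E n →L[ℝ] E n)
    {B : Model n →L[ℝ] Model n →L[ℝ] Model n} (hB : IsLeftSymmetric (gaMul n) B)
    (hgB : ∀ x y, g.comp (B x y).2 = -g.comp (y.2.comp x.2)) :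
    IsAffineMapToSpace (isAlgebraCoord_gaCoord.affineStructure hB) (JH (covector g M)) := by
  refine isAlgebraCoord_gaCoord.isAffineMapToSpace hB (contMDiff_JH g M) ?_
  have hJ : JH (covector g M) = fun σ : GA n => g + g.comp (gaCoord σ⁻¹).2 := by
    rw [JH_eq_coord]
    funext σ
    rw [ContinuousLinearMap.comp_add]
    rfl
  intro x y σ
  rw [hJ, modelDeriv_comp_snd_inv]
  have h1 : (fun τ : GA n => modelDeriv (fun σ : GA n => g + g.comp (gaCoord σ⁻¹).2) τ
      (modelField y τ)) =
      fun τ : GA n => -g.comp y.2 + (-g.comp y.2).comp (gaCoord τ⁻¹).2 := by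
    funext τ
    rw [modelDeriv_comp_snd_inv, ContinuousLinearMap.comp_add, neg_add]
    rfl
  rw [h1, modelDeriv_comp_snd_inv]
  ext v
  have h2 : ∀ w, g ((B x y).2 w) = -g (y.2 (x.2 w)) := fun w => DFunLike.congr_fun (hgB x y) w
  change -(-g (y.2 (x.2 v + x.2 ((gaCoord σ⁻¹).2 v)))) =
    -g ((B x y).2 v + (B x y).2 ((gaCoord σ⁻¹).2 v))
  rw [map_add g ((B x y).2 v), h2, h2, map_add, map_add, neg_add]

/-- Test the defining relation of `B` on a translation $z=(v,0)$: then $[x,z]=(x_2v,0)$, and pairing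
with a translation only sees `g` and the linear part. -/
theorem comp_snd_leftSymmetric (g : E n →L[ℝ] ℝ) (M : E n →L[ℝ] E n)
    {B : Model n →L[ℝ] Model n →L[ℝ] Model n}
    (hB : ∀ x y z, commForm (gaMul n) (modelCovector g M) (B x y) z =
      -commForm (gaMul n) (modelCovector g M) y (gaMul n x z - gaMul n z x)) (x y : Model n) :
    g.comp (B x y).2 = -g.comp (y.2.comp x.2) := by
  ext v
  have h := hB x y (v, 0)
  have h1 : gaMul n x (v, 0) - gaMul n (v, 0) x = (x.2 v, 0) := by
    rw [gaMul_apply, gaMul_apply]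
    refine Prod.ext ?_ ?_
    · exact sub_zero _
    · change x.2 * 0 - 0 * x.2 = 0
      rw [mul_zero, zero_mul, sub_zero]
  rw [h1, commForm_inl, commForm_inl] at h
  exact (neg_eq_iff_eq_neg.1 h).trans (by rw [neg_neg]; rfl)

end AffGrp

/-! ### The annihilator of `g`, its stabilizer, and linear coordinates on them -/

namespace AffGrp

open LieGrp

variable {n : ℕ}

/-- The endomorphisms `u` with `g ∘ u = 0`. -/
def annihilating (g : E n →L[ℝ] ℝ) : Submodule ℝ (E n →L[ℝ] E n) :=
  LinearMap.ker (ContinuousLinearMap.compL ℝ (E n) (E n) ℝ g).toLinearMap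

theorem mem_annihilating {g : E n →L[ℝ] ℝ} {u : E n →L[ℝ] E n} :
    u ∈ annihilating g ↔ g.comp u = 0 := Iff.rfl

/-- The projection onto `annihilating g` along the endomorphisms with values in `ℝ y₀`. -/
def projAnnihilating (g : E n →L[ℝ] ℝ) {y₀ : E n} (hy : g y₀ = 1) :
    (E n →L[ℝ] E n) →L[ℝ] annihilating g :=
  (ContinuousLinearMap.id ℝ (E n →L[ℝ] E n) -
    ((ContinuousLinearMap.smulRightL ℝ (E n) (E n)).flip y₀).comp
      (ContinuousLinearMap.compL ℝ (E n) (E n) ℝ g)).codRestrict (annihilating g) fun u => by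
    rw [mem_annihilating]
    ext v
    change g (u v - g (u v) • y₀) = 0
    rw [map_sub, map_smul, hy, smul_eq_mul, mul_one, sub_self]

theorem projAnnihilating_coe (g : E n →L[ℝ] ℝ) {y₀ : E n} (hy : g y₀ = 1) (u : annihilating g) :
    projAnnihilating g hy u = u := by
  apply Subtype.ext
  change (u : E n →L[ℝ] E n) - (g.comp (u : E n →L[ℝ] E n)).smulRight y₀ = u
  rw [mem_annihilating.1 u.2, ContinuousLinearMap.zero_smulRight, sub_zero]

/-- The subgroup of the affine transformations whose linear part fixes `g`. -/
def stab (g : E n →L[ℝ] ℝ) : Subgroup (GA n) where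
  carrier := {σ | g.comp (σ.lin : E n →L[ℝ] E n) = g}
  one_mem' := g.comp_id
  mul_mem' := by
    intro σ τ hσ hτ
    change (g.comp (σ.lin : E n →L[ℝ] E n)).comp (τ.lin : E n →L[ℝ] E n) = g
    rw [show g.comp (σ.lin : E n →L[ℝ] E n) = g from hσ]
    exact hτ
  inv_mem' := by
    intro σ hσ
    change g.comp ((σ.lin⁻¹ : (E n →L[ℝ] E n)ˣ) : E n →L[ℝ] E n) = g
    have hσ' : g.comp (σ.lin : E n →L[ℝ] E n) = g := hσ
    conv_lhs => rw [← hσ']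
    change g.comp ((σ.lin : E n →L[ℝ] E n) * ((σ.lin⁻¹ : (E n →L[ℝ] E n)ˣ) : E n →L[ℝ] E n)) = g
    rw [Units.mul_inv]
    exact g.comp_id

theorem mem_stab {g : E n →L[ℝ] ℝ} {σ : GA n} :
    σ ∈ stab g ↔ g.comp (σ.lin : E n →L[ℝ] E n) = g := Iff.rfl

theorem mem_stab_iff_coord {g : E n →L[ℝ] ℝ} {σ : GA n} :
    σ ∈ stab g ↔ (gaCoord σ).2 ∈ annihilating g := by
  rw [mem_stab, mem_annihilating, gaCoord_snd, ContinuousLinearMap.comp_sub, sub_eq_zero]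
  exact Iff.of_eq (congrArg _ g.comp_id.symm)

/-- The level condition is $g\circ T^{-1}=g$, that is, `σ⁻¹` stabilizes `g`. This is why the level
set is a subgroup. -/
theorem mem_stab_iff_JH {g : E n →L[ℝ] ℝ} {M : E n →L[ℝ] E n} {σ : GA n} :
    σ ∈ stab g ↔ JH (covector g M) σ = g := by
  rw [JH_eq, ← (stab g).inv_mem_iff]
  rfl

theorem translations_le_stab (g : E n →L[ℝ] ℝ) : translations n ≤ stab g := by
  intro σ hσ
  rw [mem_stab, show σ.lin = 1 from hσ]
  exact g.comp_id

section Coordinates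

variable {g : E n →L[ℝ] ℝ} {y₀ : E n}
  {VP : Type*} [NormedAddCommGroup VP] [NormedSpace ℝ VP] (eP : VP ≃L[ℝ] E n × annihilating g)
  {VR : Type*} [NormedAddCommGroup VR] [NormedSpace ℝ VR] (eR : VR ≃L[ℝ] annihilating g)

/-- The inclusion of the Lie algebra of `stab g`. -/
def stabIncl : VP →L[ℝ] Model n :=
  ((ContinuousLinearMap.id ℝ (E n)).prodMap (annihilating g).subtypeL).comp (eP : VP →L[ℝ] _)

/-- A projection onto the Lie algebra of `stab g`. -/
def stabProj (hy : g y₀ = 1) : Model n →L[ℝ] VP :=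
  (eP.symm : _ →L[ℝ] VP).comp
    ((ContinuousLinearMap.id ℝ (E n)).prodMap (projAnnihilating g hy))

/-- The projection of the Lie algebra of `stab g` onto its linear part. -/
def linProj : VP →L[ℝ] VR :=
  (eR.symm : _ →L[ℝ] VR).comp
    ((ContinuousLinearMap.snd ℝ (E n) (annihilating g)).comp (eP : VP →L[ℝ] _))

/-- The inclusion of the linear part into the Lie algebra of `stab g`. -/
def linIncl : VR →L[ℝ] VP :=
  (eP.symm : _ →L[ℝ] VP).comp
    ((ContinuousLinearMap.inr ℝ (E n) (annihilating g)).comp (eR : VR →L[ℝ] _))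

/-- The inclusion of the translations into the Lie algebra of `stab g`. -/
def translIncl : E n →L[ℝ] VP :=
  (eP.symm : _ →L[ℝ] VP).comp (ContinuousLinearMap.inl ℝ (E n) (annihilating g))

/-- The projection of the Lie algebra of `stab g` onto the translations. -/
def translProj : VP →L[ℝ] E n :=
  (ContinuousLinearMap.fst ℝ (E n) (annihilating g)).comp (eP : VP →L[ℝ] _)

theorem stabIncl_apply (x : VP) : stabIncl eP x = ((eP x).1, ((eP x).2 : E n →L[ℝ] E n)) := rfl

theorem stabIncl_snd_mem (x : VP) : (stabIncl eP x).2 ∈ annihilating g := (eP x).2.2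

theorem stabProj_stabIncl (hy : g y₀ = 1) (x : VP) : stabProj eP hy (stabIncl eP x) = x := by
  rw [stabIncl_apply]
  change eP.symm ((eP x).1, projAnnihilating g hy (eP x).2) = x
  rw [projAnnihilating_coe]
  exact eP.symm_apply_apply x

theorem stabIncl_injective : Function.Injective (stabIncl eP) := by
  intro x y hxy
  apply eP.injective
  rw [stabIncl_apply, stabIncl_apply] at hxy
  have h1 : (eP x).1 = (eP y).1 := (Prod.ext_iff.1 hxy).1
  have h2 : ((eP x).2 : E n →L[ℝ] E n) = (eP y).2 := (Prod.ext_iff.1 hxy).2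
  exact Prod.ext h1 (Subtype.ext h2)

theorem stabIncl_stabProj_iff (hy : g y₀ = 1) (a : Model n) :
    stabIncl eP (stabProj eP hy a) = a ↔ a.2 ∈ annihilating g := by
  constructor
  · intro h
    rw [← h]
    exact stabIncl_snd_mem eP _
  · intro h
    rw [stabIncl_apply]
    change ((eP (eP.symm (a.1, projAnnihilating g hy a.2))).1, _) = a
    have : projAnnihilating g hy a.2 = ⟨a.2, h⟩ := projAnnihilating_coe g hy ⟨a.2, h⟩
    change ((eP (eP.symm (a.1, projAnnihilating g hy a.2))).1,
      ((eP (eP.symm (a.1, projAnnihilating g hy a.2))).2 : E n →L[ℝ] E n)) = a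
    rw [this, eP.apply_symm_apply]

theorem coe_linProj (x : VP) :
    (eR (linProj eP eR x) : E n →L[ℝ] E n) = (stabIncl eP x).2 := by
  change (eR (eR.symm (eP x).2) : E n →L[ℝ] E n) = _
  rw [eR.apply_symm_apply]
  rfl

theorem linProj_eq_iff (x : VP) (r : VR) :
    linProj eP eR x = r ↔ (stabIncl eP x).2 = eR r := by
  rw [← coe_linProj eP eR, ← Subtype.ext_iff, eR.injective.eq_iff]

theorem linProj_eq_zero_iff (x : VP) : linProj eP eR x = 0 ↔ (stabIncl eP x).2 = 0 := by
  rw [linProj_eq_iff, map_zero]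
  rfl

theorem stabIncl_linIncl (r : VR) : stabIncl eP (linIncl eP eR r) = (0, (eR r : E n →L[ℝ] E n)) := by
  change ((eP (eP.symm (0, eR r))).1, ((eP (eP.symm (0, eR r))).2 : E n →L[ℝ] E n)) = _
  rw [eP.apply_symm_apply]

theorem stabIncl_translIncl (v : E n) : stabIncl eP (translIncl eP v) = (v, 0) := by
  change ((eP (eP.symm (v, 0))).1, ((eP (eP.symm (v, 0))).2 : E n →L[ℝ] E n)) = _
  rw [eP.apply_symm_apply]
  rfl

theorem linProj_linIncl (r : VR) : linProj eP eR (linIncl eP eR r) = r := by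
  rw [linProj_eq_iff, stabIncl_linIncl]

theorem translProj_translIncl (v : E n) : translProj eP (translIncl eP v) = v := by
  change (eP (eP.symm (v, 0))).1 = v
  rw [eP.apply_symm_apply]

/-- The endomorphisms annihilated by `g` on the left form a right ideal, so only the first factor
matters. -/
theorem gaMul_snd_mem (x y : Model n) (hx : x.2 ∈ annihilating g) :
    (gaMul n x y).2 ∈ annihilating g := by
  rw [mem_annihilating] at hx ⊢
  change (g.comp x.2).comp y.2 = 0
  rw [hx, ContinuousLinearMap.zero_comp]

/-- The product of the Lie algebra of `stab g`. -/
def stabMul (hy : g y₀ = 1) : VP →L[ℝ] VP →L[ℝ] VP :=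
  transferMul (stabIncl eP) (stabProj eP hy) (gaMul n)

/-- The product of the linear part of the Lie algebra of `stab g`. -/
def linMul (hy : g y₀ = 1) : VR →L[ℝ] VR →L[ℝ] VR :=
  transferMul (linIncl eP eR) (linProj eP eR) (stabMul eP hy)

variable (n) in
/-- The product of the Lie algebra of translations. -/
def translMul : E n →L[ℝ] E n →L[ℝ] E n :=
  transferMul (ContinuousLinearMap.inl ℝ (E n) (E n →L[ℝ] E n))
    (ContinuousLinearMap.fst ℝ (E n) (E n →L[ℝ] E n)) (gaMul n)

theorem stabIncl_stabProj_gaMul (hy : g y₀ = 1) (x y : VP) :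
    stabIncl eP (stabProj eP hy (gaMul n (stabIncl eP x) (stabIncl eP y))) =
      gaMul n (stabIncl eP x) (stabIncl eP y) :=
  (stabIncl_stabProj_iff eP hy _).2 (gaMul_snd_mem _ _ (stabIncl_snd_mem eP x))

theorem stabIncl_stabMul (hy : g y₀ = 1) (x y : VP) :
    stabIncl eP (stabMul eP hy x y) = gaMul n (stabIncl eP x) (stabIncl eP y) :=
  stabIncl_stabProj_gaMul eP hy x y

theorem coe_linMul (hy : g y₀ = 1) (x y : VR) :
    (eR (linMul eP eR hy x y) : E n →L[ℝ] E n) =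
      (eR x : E n →L[ℝ] E n).comp (eR y : E n →L[ℝ] E n) := by
  change (eR (linProj eP eR (stabMul eP hy (linIncl eP eR x) (linIncl eP eR y))) :
    E n →L[ℝ] E n) = _
  rw [coe_linProj, stabIncl_stabMul, stabIncl_linIncl, stabIncl_linIncl]
  rfl

theorem linProj_stabMul (hy : g y₀ = 1) (x y : VP) :
    linProj eP eR (stabMul eP hy x y) =
      linMul eP eR hy (linProj eP eR x) (linProj eP eR y) := by
  rw [linProj_eq_iff, coe_linMul, coe_linProj, coe_linProj, stabIncl_stabMul]
  rfl

theorem linIncl_linMul (hy : g y₀ = 1) (x y : VR) :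
    linIncl eP eR (linMul eP eR hy x y) =
      stabMul eP hy (linIncl eP eR x) (linIncl eP eR y) := by
  apply stabIncl_injective eP
  rw [stabIncl_linIncl, stabIncl_stabMul, stabIncl_linIncl, stabIncl_linIncl, coe_linMul,
    gaMul_apply, map_zero]

theorem inl_translMul (x y : E n) :
    ContinuousLinearMap.inl ℝ (E n) (E n →L[ℝ] E n) (translMul n x y) =
      gaMul n (ContinuousLinearMap.inl ℝ (E n) (E n →L[ℝ] E n) x)
        (ContinuousLinearMap.inl ℝ (E n) (E n →L[ℝ] E n) y) := rfl

theorem translIncl_translMul (hy : g y₀ = 1) (x y : E n) :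
    translIncl eP (translMul n x y) = stabMul eP hy (translIncl eP x) (translIncl eP y) := by
  apply stabIncl_injective eP
  rw [stabIncl_translIncl, stabIncl_stabMul, stabIncl_translIncl, stabIncl_translIncl]
  rfl

end Coordinates

end AffGrp

/-! ### Symplectic reduction at the level of Lie algebras -/

namespace AffGrp

open LieGrp

variable {n : ℕ} {g : E n →L[ℝ] ℝ} {M : E n →L[ℝ] E n} {y₀ : E n}

/-- The form `δα` on the model space. -/
def gaForm (g : E n →L[ℝ] ℝ) (M : E n →L[ℝ] E n) : LinearMap.BilinForm ℝ (Model n) :=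
  commForm (gaMul n) (modelCovector g M)

theorem gaForm_inl (a : Model n) (v : E n) : gaForm g M a (v, 0) = -g (a.2 v) :=
  commForm_inl g M a v

theorem gaForm_neg (x y : Model n) : -gaForm g M x y = gaForm g M y x := commForm_neg _ _ x y

/-- This is the inclusion $\mathfrak p\subseteq\mathfrak h^\perp$; in particular the ideal of
translations is isotropic. -/
theorem gaForm_eq_zero {h a : Model n} (hh : h.2 = 0) (ha : a.2 ∈ annihilating g) :
    gaForm g M h a = 0 := by
  have h1 : h = (h.1, 0) := Prod.ext rfl hh
  rw [h1, ← gaForm_neg, gaForm_inl, neg_neg]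
  exact DFunLike.congr_fun (mem_annihilating.1 ha) h.1

/-- This is $\mathfrak p^\perp\subseteq\mathfrak h$: a vector orthogonal to $\mathfrak p=\mathfrak
h^\perp$ lies in $\mathfrak h^{\perp\perp}=\mathfrak h$. -/
theorem snd_eq_zero_of_gaForm (hω : (gaForm g M).Nondegenerate) {b : Model n}
    (hb : ∀ a : Model n, a.2 ∈ annihilating g → gaForm g M a b = 0) : b.2 = 0 := by
  have horth := LinearMap.BilinForm.orthogonal_orthogonal hω (commForm_isRefl _ _)
    (LinearMap.range (LinearMap.inl ℝ (E n) (E n →L[ℝ] E n)))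
  have hmem : b ∈ LinearMap.range (LinearMap.inl ℝ (E n) (E n →L[ℝ] E n)) := by
    rw [← horth]
    intro a ha
    refine hb a ?_
    ext v
    have h1 : gaForm g M (v, 0) a = 0 := ha (v, 0) ⟨v, rfl⟩
    rw [← gaForm_neg, gaForm_inl, neg_neg] at h1
    exact h1
  obtain ⟨v, rfl⟩ := hmem
  rfl

theorem comm_snd_mem {x y : Model n} (hx : x.2 ∈ annihilating g) (hy : y.2 ∈ annihilating g) :
    (gaMul n x y - gaMul n y x).2 ∈ annihilating g :=
  (annihilating g).sub_mem (gaMul_snd_mem x y hx) (gaMul_snd_mem y x hy)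

/-- `B` is the product determined by the form `gaForm g M`. -/
structure IsFormProduct (g : E n →L[ℝ] ℝ) (M : E n →L[ℝ] E n)
    (B : Model n →L[ℝ] Model n →L[ℝ] Model n) : Prop where
  nondegenerate : (gaForm g M).Nondegenerate
  leftSymmetric : IsLeftSymmetric (gaMul n) B
  form : ∀ x y z, gaForm g M (B x y) z = -gaForm g M y (gaMul n x z - gaMul n z x)

namespace IsFormProduct

variable {B : Model n →L[ℝ] Model n →L[ℝ] Model n}

theorem snd_mem (h : IsFormProduct g M B) (x : Model n) {y : Model n}
    (hy : y.2 ∈ annihilating g) : (B x y).2 ∈ annihilating g := by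
  rw [mem_annihilating] at hy ⊢
  rw [comp_snd_leftSymmetric g M h.form x y, ← ContinuousLinearMap.comp_assoc, hy,
    ContinuousLinearMap.zero_comp, neg_zero]

/-- For $a\in\mathfrak p$ one has $\omega(B(x,y),a)=-\omega(y,[x,a])=0$, as $[x,a]\in\mathfrak p$
and $y\in\mathfrak h$. Hence $B(x,y)\in\mathfrak p^\perp=\mathfrak h$. -/
theorem snd_eq_zero_right (h : IsFormProduct g M B) {x y : Model n}
    (hx : x.2 ∈ annihilating g) (hy : y.2 = 0) : (B x y).2 = 0 := by
  refine snd_eq_zero_of_gaForm h.nondegenerate fun a ha => ?_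
  rw [← gaForm_neg, h.form, gaForm_eq_zero hy (comm_snd_mem hx ha), neg_zero, neg_zero]

/-- Torsion-freeness gives $B(x,y)=[x,y]+B(y,x)$. The bracket lies in the ideal $\mathfrak h$, and
the last term is covered by `snd_eq_zero_right`. -/
theorem snd_eq_zero_left (h : IsFormProduct g M B) {x y : Model n}
    (hx : x.2 = 0) (hy : y.2 ∈ annihilating g) : (B x y).2 = 0 := by
  have h1 := congrArg Prod.snd (h.leftSymmetric.torsion x y)
  have h2 : (gaMul n x y - gaMul n y x).2 = 0 := by
    change x.2 * y.2 - y.2 * x.2 = 0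
    rw [hx, zero_mul, mul_zero, sub_zero]
  rw [h2, Prod.snd_sub, h.snd_eq_zero_right hy hx, sub_zero] at h1
  exact h1

variable {VP : Type*} [NormedAddCommGroup VP] [NormedSpace ℝ VP]
  (eP : VP ≃L[ℝ] E n × annihilating g)
  {VR : Type*} [NormedAddCommGroup VR] [NormedSpace ℝ VR] (eR : VR ≃L[ℝ] annihilating g)

theorem stabIncl_transfer (h : IsFormProduct g M B) (hy : g y₀ = 1) (x y : VP) :
    stabIncl eP (transferMul (stabIncl eP) (stabProj eP hy) B x y) =
      B (stabIncl eP x) (stabIncl eP y) :=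
  (stabIncl_stabProj_iff eP hy _).2 (h.snd_mem _ (stabIncl_snd_mem eP y))

theorem leftSymmetric_stab (h : IsFormProduct g M B) (hy : g y₀ = 1) :
    IsLeftSymmetric (stabMul eP hy) (transferMul (stabIncl eP) (stabProj eP hy) B) :=
  h.leftSymmetric.restrict (stabIncl_injective eP) (stabIncl_stabMul eP hy)
    (h.stabIncl_transfer eP hy)

theorem inl_transfer (h : IsFormProduct g M B) (x y : E n) :
    ContinuousLinearMap.inl ℝ (E n) (E n →L[ℝ] E n)
      (transferMul (ContinuousLinearMap.inl ℝ (E n) (E n →L[ℝ] E n))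
        (ContinuousLinearMap.fst ℝ (E n) (E n →L[ℝ] E n)) B x y) =
      B (ContinuousLinearMap.inl ℝ (E n) (E n →L[ℝ] E n) x)
        (ContinuousLinearMap.inl ℝ (E n) (E n →L[ℝ] E n) y) :=
  Prod.ext rfl (h.snd_eq_zero_right (annihilating g).zero_mem rfl).symm

theorem leftSymmetric_transl (h : IsFormProduct g M B) :
    IsLeftSymmetric (translMul n)
      (transferMul (ContinuousLinearMap.inl ℝ (E n) (E n →L[ℝ] E n))
        (ContinuousLinearMap.fst ℝ (E n) (E n →L[ℝ] E n)) B) :=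
  h.leftSymmetric.restrict (fun _ _ hvw => (Prod.ext_iff.1 hvw).1) inl_translMul h.inl_transfer

theorem translIncl_transfer (h : IsFormProduct g M B) (hy : g y₀ = 1) (x y : E n) :
    translIncl eP (transferMul (ContinuousLinearMap.inl ℝ (E n) (E n →L[ℝ] E n))
        (ContinuousLinearMap.fst ℝ (E n) (E n →L[ℝ] E n)) B x y) =
      transferMul (stabIncl eP) (stabProj eP hy) B (translIncl eP x) (translIncl eP y) := by
  apply stabIncl_injective eP
  rw [h.stabIncl_transfer, stabIncl_translIncl, stabIncl_translIncl, stabIncl_translIncl]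
  exact h.inl_transfer x y

theorem stabIncl_sub_linIncl_snd (x : VP) :
    (stabIncl eP (x - linIncl eP eR (linProj eP eR x))).2 = 0 := by
  rw [← linProj_eq_zero_iff eP eR, map_sub, linProj_linIncl, sub_self]

/-- On $\mathfrak p$ the product with a translation on either side is a translation. Replacing `x`
and `y` by their linear parts therefore changes the result only inside the kernel of the projection.
-/
theorem linProj_transfer (h : IsFormProduct g M B) (hy : g y₀ = 1) (x y : VP) :
    linProj eP eR (transferMul (stabIncl eP) (stabProj eP hy) B x y) =
      transferMul (linIncl eP eR) (linProj eP eR)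
        (transferMul (stabIncl eP) (stabProj eP hy) B) (linProj eP eR x) (linProj eP eR y) := by
  rw [transferMul_apply (linIncl eP eR)]
  set x' := linIncl eP eR (linProj eP eR x) with hx'
  set y' := linIncl eP eR (linProj eP eR y) with hy'
  set BP := transferMul (stabIncl eP) (stabProj eP hy) B with hBP
  have h1 : BP x y = BP x' y' + (BP (x - x') y + BP x' (y - y')) := by
    rw [map_sub, map_sub, _root_.sub_apply]
    abel
  have h2 : linProj eP eR (BP (x - x') y) = 0 := by
    rw [linProj_eq_zero_iff, hBP, h.stabIncl_transfer]
    exact h.snd_eq_zero_left (stabIncl_sub_linIncl_snd eP eR x) (stabIncl_snd_mem eP y)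
  have h3 : linProj eP eR (BP x' (y - y')) = 0 := by
    rw [linProj_eq_zero_iff, hBP, h.stabIncl_transfer]
    exact h.snd_eq_zero_right (stabIncl_snd_mem eP x') (stabIncl_sub_linIncl_snd eP eR y)
  rw [h1, map_add, map_add, h2, h3, add_zero, add_zero]

theorem leftSymmetric_lin (h : IsFormProduct g M B) (hy : g y₀ = 1) :
    IsLeftSymmetric (linMul eP eR hy) (transferMul (linIncl eP eR) (linProj eP eR)
      (transferMul (stabIncl eP) (stabProj eP hy) B)) :=
  (h.leftSymmetric_stab eP hy).quotient (fun r => ⟨linIncl eP eR r, linProj_linIncl eP eR r⟩)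
    (linProj_stabMul eP eR hy) (h.linProj_transfer eP eR hy)

end IsFormProduct

section ReducedForm

variable {VP : Type*} [NormedAddCommGroup VP] [NormedSpace ℝ VP]
  (eP : VP ≃L[ℝ] E n × annihilating g)
  {VR : Type*} [NormedAddCommGroup VR] [NormedSpace ℝ VR] (eR : VR ≃L[ℝ] annihilating g)

/-- The restriction of the linear form to the linear part of the Lie algebra of `stab g`. -/
def linCovector (M : E n →L[ℝ] E n) : VR →L[ℝ] ℝ :=
  (modelCovector g M).comp ((stabIncl eP).comp (linIncl eP eR))

theorem commForm_linCovector (hy : g y₀ = 1) (r s : VR) :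
    commForm (linMul eP eR hy) (linCovector eP eR M) r s =
      gaForm g M (stabIncl eP (linIncl eP eR r)) (stabIncl eP (linIncl eP eR s)) := by
  change -modelCovector g M (stabIncl eP (linIncl eP eR (linMul eP eR hy r s -
    linMul eP eR hy s r))) = _
  rw [map_sub, linIncl_linMul, linIncl_linMul, map_sub, stabIncl_stabMul, stabIncl_stabMul]
  rfl

/-- The translations lie in the radical of the form on $\mathfrak p$, so its value depends only on
the linear parts. The reduced form is thus the coboundary of the linear form restricted to the
complement `linIncl`. -/
theorem commForm_linProj (hy : g y₀ = 1) (x y : VP) :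
    commForm (linMul eP eR hy) (linCovector eP eR M) (linProj eP eR x) (linProj eP eR y) =
      gaForm g M (stabIncl eP x) (stabIncl eP y) := by
  rw [commForm_linCovector]
  set x' := linIncl eP eR (linProj eP eR x) with hx'
  set y' := linIncl eP eR (linProj eP eR y) with hy'
  have h1 : gaForm g M (stabIncl eP (x - x')) (stabIncl eP y) = 0 :=
    gaForm_eq_zero (IsFormProduct.stabIncl_sub_linIncl_snd eP eR x) (stabIncl_snd_mem eP y)
  have h2 : gaForm g M (stabIncl eP x') (stabIncl eP (y - y')) = 0 := by
    rw [← gaForm_neg, gaForm_eq_zero (IsFormProduct.stabIncl_sub_linIncl_snd eP eR y)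
      (stabIncl_snd_mem eP x'), neg_zero]
  rw [map_sub, map_sub, LinearMap.sub_apply, sub_eq_zero] at h1
  rw [map_sub, map_sub, sub_eq_zero] at h2
  rw [h1, h2]

/-- A radical vector of the reduced form lifts to a vector of $\mathfrak p^\perp=\mathfrak h$, whose
linear part vanishes. -/
theorem linCovector_separating (hω : (gaForm g M).Nondegenerate) (hy : g y₀ = 1) (r : VR)
    (hr : ∀ s, linCovector eP eR M (linMul eP eR hy s r - linMul eP eR hy r s) = 0) : r = 0 := by
  have h1 : ∀ a : Model n, a.2 ∈ annihilating g →
      gaForm g M a (stabIncl eP (linIncl eP eR r)) = 0 := by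
    intro a ha
    rw [← (stabIncl_stabProj_iff eP hy a).2 ha, ← commForm_linProj eP eR hy, linProj_linIncl,
      commForm_apply, hr, neg_zero]
  have h2 := snd_eq_zero_of_gaForm hω h1
  rwa [← linProj_eq_zero_iff eP eR, linProj_linIncl] at h2

theorem IsFormProduct.commForm_lin {B : Model n →L[ℝ] Model n →L[ℝ] Model n}
    (h : IsFormProduct g M B) (hy : g y₀ = 1) (x y z : VR) :
    commForm (linMul eP eR hy) (linCovector eP eR M) (transferMul (linIncl eP eR) (linProj eP eR)
      (transferMul (stabIncl eP) (stabProj eP hy) B) x y) z =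
      -commForm (linMul eP eR hy) (linCovector eP eR M) y
        (linMul eP eR hy x z - linMul eP eR hy z x) := by
  rw [transferMul_apply (linIncl eP eR)]
  conv_lhs => rw [← linProj_linIncl eP eR z]
  rw [commForm_linProj, h.stabIncl_transfer, h.form, commForm_linCovector,
    map_sub (linIncl eP eR), linIncl_linMul, linIncl_linMul, map_sub (stabIncl eP), stabIncl_stabMul, stabIncl_stabMul]

end ReducedForm

end AffGrp

/-! ### The annihilator of `g` as the affine algebra in dimension `n - 1` -/

namespace AffGrp

open LieGrp

variable {n : ℕ} {g : E n →L[ℝ] ℝ} {y₀ : E n}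

/-- Here `j` parametrizes `ker g`, and `r` is the projection onto it along `y₀`. -/
theorem exists_ker_coordinates (hn : 1 ≤ n) (hy : g y₀ = 1) :
    ∃ (j : E (n - 1) →L[ℝ] E n) (r : E n →L[ℝ] E (n - 1)),
      (∀ z, g (j z) = 0) ∧ (∀ z, r (j z) = z) ∧ ∀ x, j (r x) = x - g x • y₀ := by
  have hrange : LinearMap.range (g : E n →ₗ[ℝ] ℝ) = ⊤ := by
    rw [LinearMap.range_eq_top]
    intro t
    refine ⟨t • y₀, ?_⟩
    change g (t • y₀) = t
    rw [map_smul, hy, smul_eq_mul, mul_one]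
  have hrank : Module.finrank ℝ (LinearMap.ker (g : E n →ₗ[ℝ] ℝ)) = n - 1 := by
    have h := LinearMap.finrank_range_add_finrank_ker (g : E n →ₗ[ℝ] ℝ)
    rw [hrange, finrank_top, Module.finrank_self, finrank_euclideanSpace_fin] at h
    omega
  let ι : LinearMap.ker (g : E n →ₗ[ℝ] ℝ) ≃L[ℝ] E (n - 1) :=
    ContinuousLinearEquiv.ofFinrankEq (by rw [hrank, finrank_euclideanSpace_fin])
  let k : E n →L[ℝ] LinearMap.ker (g : E n →ₗ[ℝ] ℝ) :=
    (ContinuousLinearMap.id ℝ (E n) - g.smulRight y₀).codRestrict _ fun x => by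
      change g (x - g x • y₀) = 0
      rw [map_sub, map_smul, hy, smul_eq_mul, mul_one, sub_self]
  refine ⟨(Submodule.subtypeL (LinearMap.ker (g : E n →ₗ[ℝ] ℝ))).comp
      (ι.symm : E (n - 1) →L[ℝ] LinearMap.ker (g : E n →ₗ[ℝ] ℝ)), (ι : LinearMap.ker (g : E n →ₗ[ℝ] ℝ) →L[ℝ] E (n - 1)).comp k, ?_, ?_, ?_⟩
  · intro z
    exact (ι.symm z).2
  · intro z
    change ι (k (ι.symm z)) = z
    have h : k (ι.symm z : E n) = ι.symm z := by
      apply Subtype.ext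
      change (ι.symm z : E n) - g (ι.symm z) • y₀ = ι.symm z
      rw [show g (ι.symm z) = 0 from (ι.symm z).2, zero_smul, sub_zero]
    rw [h, ι.apply_symm_apply]
  · intro x
    change (ι.symm (ι (k x)) : E n) = _
    rw [ι.symm_apply_apply]
    rfl

/-- The endomorphisms `u` with `g ∘ u = 0` form an algebra isomorphic to that of the affine maps of
a space of dimension `n - 1`. -/
theorem exists_annihilating_equiv (hn : 1 ≤ n) (hy : g y₀ = 1) :
    ∃ Θ : annihilating g ≃L[ℝ] Model (n - 1), ∀ u w v : annihilating g,
      (v : E n →L[ℝ] E n) = (u : E n →L[ℝ] E n).comp (w : E n →L[ℝ] E n) →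
        Θ v = gaMul (n - 1) (Θ u) (Θ w) := by
  obtain ⟨j, r, hj, hrj, hjr⟩ := exists_ker_coordinates hn hy
  have hjru : ∀ (u : annihilating g) (x : E n),
      j (r ((u : E n →L[ℝ] E n) x)) = (u : E n →L[ℝ] E n) x := by
    intro u x
    have h : g ((u : E n →L[ℝ] E n) x) = 0 := DFunLike.congr_fun (mem_annihilating.1 u.2) x
    rw [hjr, h, zero_smul, sub_zero]
  have hry : r y₀ = 0 := by
    have h := hjr y₀
    rw [hy, one_smul, sub_self] at h
    rw [← hrj (r y₀), h, map_zero]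
  have hmem : ∀ p : Model (n - 1),
      g.smulRight (j p.1) + j.comp (p.2.comp r) ∈ annihilating g := by
    intro p
    rw [mem_annihilating]
    ext x
    change g (g x • j p.1 + j (p.2 (r x))) = 0
    rw [map_add, map_smul, hj, hj, smul_zero, add_zero]
  -- An endomorphism `u` with values in `ker g` is determined by the vector $uy_0$ and the
  -- restriction of `u` to `ker g`. Since $wy_0$ lies in `ker g`, $(uw)y_0$ is the restriction of
  -- `u` applied to $wy_0$: this is the affine product.
  let Θ : annihilating g ≃ₗ[ℝ] Model (n - 1) :=
    { toFun := fun u =>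
        (r ((u : E n →L[ℝ] E n) y₀), r.comp ((u : E n →L[ℝ] E n).comp j))
      map_add' := by
        intro u w
        refine Prod.ext (map_add r _ _) ?_
        ext1 z
        exact map_add r _ _
      map_smul' := by
        intro t u
        refine Prod.ext (map_smul r _ _) ?_
        ext1 z
        exact map_smul r _ _
      invFun := fun p => ⟨g.smulRight (j p.1) + j.comp (p.2.comp r), hmem p⟩
      left_inv := by
        intro u
        apply Subtype.ext
        ext1 x
        change g x • j (r ((u : E n →L[ℝ] E n) y₀)) + j (r ((u : E n →L[ℝ] E n) (j (r x)))) =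
          (u : E n →L[ℝ] E n) x
        rw [hjru, hjru, hjr, map_sub, map_smul, add_sub_cancel]
      right_inv := by
        intro p
        refine Prod.ext ?_ ?_
        · change r (g y₀ • j p.1 + j (p.2 (r y₀))) = p.1
          rw [hry, map_zero, map_zero, add_zero, hy, one_smul, hrj]
        · ext1 z
          change r (g (j z) • j p.1 + j (p.2 (r (j z)))) = p.2 z
          rw [hj, zero_smul, zero_add, hrj, hrj] }
  refine ⟨LinearEquiv.toContinuousLinearEquiv (E := annihilating g) (F := Model (n - 1)) Θ, ?_⟩
  intro u w v hv
  have hv' : ∀ x, (v : E n →L[ℝ] E n) x = (u : E n →L[ℝ] E n) ((w : E n →L[ℝ] E n) x) :=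
    fun x => DFunLike.congr_fun hv x
  refine Prod.ext ?_ ?_
  · change r ((v : E n →L[ℝ] E n) y₀) =
      r ((u : E n →L[ℝ] E n) (j (r ((w : E n →L[ℝ] E n) y₀))))
    rw [hv', hjru]
  · ext1 z
    change r ((v : E n →L[ℝ] E n) (j z)) =
      r ((u : E n →L[ℝ] E n) (j (r ((w : E n →L[ℝ] E n) (j z)))))
    rw [hv', hjru]

end AffGrp

/-! ### Coordinates and homomorphisms of the groups `H`, `P` and `P / H` -/

namespace AffGrp

open LieGrp

variable {n : ℕ} {g : E n →L[ℝ] ℝ} {y₀ : E n}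

theorem isTopologicalGroup : IsTopologicalGroup (GA n) :=
  topologicalGroup_of_lieGroup 𝓘(ℝ, Model n) ∞

/-- The coordinates of the group of translations. -/
def translCoord (σ : translations n) : E n := (gaCoord (σ : GA n)).1

theorem inl_translCoord (σ : translations n) :
    ContinuousLinearMap.inl ℝ (E n) (E n →L[ℝ] E n) (translCoord σ) = gaCoord (σ : GA n) := by
  refine Prod.ext rfl ?_
  rw [gaCoord_snd, show (σ : GA n).lin = 1 from σ.2]
  exact (sub_self _).symm

theorem mem_translations_iff {σ : GA n} : σ ∈ translations n ↔ (gaCoord σ).2 = 0 := by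
  rw [gaCoord_snd, sub_eq_zero]
  exact Units.val_eq_one.symm

theorem isAlgebraEmbedding_translCoord :
    IsAlgebraEmbedding (translCoord : translations n → E n) (translMul n) :=
  isAlgebraEmbedding_gaCoord.restrict
    (L := ContinuousLinearMap.inl ℝ (E n) (E n →L[ℝ] E n))
    (π := ContinuousLinearMap.fst ℝ (E n) (E n →L[ℝ] E n)) (fun _ => rfl)
    (fun σ => by
      rw [mem_translations_iff]
      exact ⟨fun h => Prod.ext rfl h.symm, fun h => (Prod.ext_iff.1 h).2.symm⟩)
    (fun _ _ => rfl)

variable {VP : Type*} [NormedAddCommGroup VP] [NormedSpace ℝ VP]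
  (eP : VP ≃L[ℝ] E n × annihilating g)
  {VR : Type*} [NormedAddCommGroup VR] [NormedSpace ℝ VR] (eR : VR ≃L[ℝ] annihilating g)

/-- The coordinates of the group `stab g`. -/
def stabCoord (hy : g y₀ = 1) (σ : stab g) : VP := stabProj eP hy (gaCoord (σ : GA n))

theorem stabIncl_stabCoord (hy : g y₀ = 1) (σ : stab g) :
    stabIncl eP (stabCoord eP hy σ) = gaCoord (σ : GA n) :=
  (stabIncl_stabProj_iff eP hy _).2 (mem_stab_iff_coord.1 σ.2)

theorem isAlgebraEmbedding_stabCoord (hy : g y₀ = 1) :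
    IsAlgebraEmbedding (stabCoord eP hy) (stabMul eP hy) :=
  isAlgebraEmbedding_gaCoord.restrict (stabProj_stabIncl eP hy)
    (fun _ => mem_stab_iff_coord.trans (stabIncl_stabProj_iff eP hy _).symm)
    (stabIncl_stabProj_gaMul eP hy)

theorem stabCoord_inclusion (hy : g y₀ = 1) (σ : translations n) :
    stabCoord eP hy (Subgroup.inclusion (translations_le_stab g) σ) =
      translIncl eP (translCoord σ) := by
  apply stabIncl_injective eP
  rw [stabIncl_stabCoord, stabIncl_translIncl]
  exact (inl_translCoord σ).symm

theorem mem_subgroupOf_iff (hy : g y₀ = 1) (σ : stab g) :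
    σ ∈ (translations n).subgroupOf (stab g) ↔ linProj eP eR (stabCoord eP hy σ) = 0 := by
  rw [linProj_eq_zero_iff, stabIncl_stabCoord, Subgroup.mem_subgroupOf, mem_translations_iff]

/-- The coordinates of the quotient of `stab g` by the translations. -/
def linCoord (hy : g y₀ = 1) : quotTranslations (stab g) → VR :=
  IsAlgebraEmbedding.quotCoord (stabCoord eP hy) (linProj eP eR) _ fun σ τ =>
    ((isAlgebraEmbedding_stabCoord eP hy).quotCoord_compat (mem_subgroupOf_iff eP eR hy)
      (linProj_stabMul eP eR hy) σ τ).1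

theorem linCoord_proj (hy : g y₀ = 1) (σ : stab g) :
    linCoord eP eR hy (proj (stab g) σ) = linProj eP eR (stabCoord eP hy σ) := rfl

theorem isAlgebraEmbedding_linCoord (hy : g y₀ = 1) :
    IsAlgebraEmbedding (linCoord eP eR hy) (linMul eP eR hy) :=
  have : IsTopologicalGroup (GA n) := isTopologicalGroup
  (isAlgebraEmbedding_stabCoord eP hy).quotient (linProj_linIncl eP eR)
    (mem_subgroupOf_iff eP eR hy) _ (linProj_stabMul eP eR hy) (linIncl_linMul eP eR hy)

theorem exists_section (hy : g y₀ = 1) :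
    ∃ s : quotTranslations (stab g) →* stab g,
      (∀ r, stabCoord eP hy (s r) = linIncl eP eR (linCoord eP eR hy r)) ∧
      ∀ r, proj (stab g) (s r) = r := by
  obtain ⟨s, hs⟩ := (isAlgebraEmbedding_linCoord eP eR hy).exists_monoidHom
    (isAlgebraEmbedding_stabCoord eP hy) (linIncl eP eR) (linIncl_linMul eP eR hy)
  refine ⟨s, hs, fun r => (isAlgebraEmbedding_linCoord eP eR hy).isOpenEmbedding.injective ?_⟩
  rw [linCoord_proj, hs, linProj_linIncl]

theorem exists_mulEquiv_GA (hn : 1 ≤ n) (hy : g y₀ = 1) :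
    ∃ (φ : quotTranslations (stab g) ≃* GA (n - 1)) (L : VR ≃L[ℝ] Model (n - 1)),
      (∀ r, gaCoord (φ r) = L (linCoord eP eR hy r)) ∧
      ∀ τ, linCoord eP eR hy (φ.symm τ) = L.symm (gaCoord τ) := by
  obtain ⟨Θ, hΘ⟩ := exists_annihilating_equiv hn hy
  obtain ⟨φ, h1, h2⟩ := (isAlgebraEmbedding_linCoord eP eR hy).exists_mulEquiv
    isAlgebraEmbedding_gaCoord (eR.trans Θ)
    (fun x y => hΘ (eR x) (eR y) _ (coe_linMul eP eR hy x y))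
  exact ⟨φ, eR.trans Θ, h1, h2⟩

theorem isShortExact : IsShortExact (Subgroup.inclusion (translations_le_stab g))
    (proj (stab g)) := by
  refine ⟨Subgroup.inclusion_injective _, ?_, QuotientGroup.mk'_surjective _⟩
  rw [QuotientGroup.ker_mk', Subgroup.inclusion_range]

end AffGrp

/-! ### Principal bundles from smooth local sections -/

namespace LieGrp

open Classical in
/-- A retraction onto a subgroup. -/
def retract {K : Type*} [Group K] (P : Subgroup K) (σ : K) : P :=
  if h : σ ∈ P then ⟨σ, h⟩ else 1

theorem coe_retract {K : Type*} [Group K] {P : Subgroup K} {σ : K} (h : σ ∈ P) :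
    (retract P σ : K) = σ := by
  rw [retract, dif_pos h]

/-- A smooth map whose fibers are the left cosets of an embedded subgroup is a principal bundle as
soon as it has smooth local sections. -/
theorem isPrincipalBundleOver_of_sections {V : Type*} [NormedAddCommGroup V] [NormedSpace ℝ V]
    {K : Type*} [TopologicalSpace K] [ChartedSpace V K] [Group K] [LieGroup 𝓘(ℝ, V) ∞ K]
    {W : Type*} [NormedAddCommGroup W] [NormedSpace ℝ W] {P : Subgroup K} [ChartedSpace W P]
    {B : Type*} [NormedAddCommGroup B] [NormedSpace ℝ B] {f : K → B} {U : Set B}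
    {c : K → V} (hc : IsGlobalCoord c) {c' : P → W} (hc' : IsGlobalCoord c')
    {π : V →L[ℝ] W} (hπ : ∀ p : P, c' p = π (c p))
    (hval : ContMDiff 𝓘(ℝ, W) 𝓘(ℝ, V) ∞ (Subtype.val : P → K))
    (hf : ContMDiff 𝓘(ℝ, V) 𝓘(ℝ, B) ∞ f) (hfU : ∀ σ, f σ ∈ U)
    (hfP : ∀ σ τ, f σ = f τ ↔ σ⁻¹ * τ ∈ P)
    (hs : ∀ b ∈ U, ∃ (O : Set B) (s : B → K), IsOpen O ∧ b ∈ O ∧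
      ContMDiffOn 𝓘(ℝ, B) 𝓘(ℝ, V) ∞ s O ∧ ∀ x ∈ O, f (s x) = x) :
    IsPrincipalBundleOver 𝓘(ℝ, V) P 𝓘(ℝ, W) f U := by
  have : IsManifold 𝓘(ℝ, V) ∞ K :=
    (inferInstance : ContMDiffMul 𝓘(ℝ, V) ∞ K).toIsManifold
  have hfmul : ∀ (σ : K) (p : P), f (σ * p) = f σ := by
    intro σ p
    refine ((hfP _ _).2 ?_).symm
    rw [inv_mul_cancel_left]
    exact p.2
  refine ⟨hfU, hfmul, fun b hb => ?_⟩
  obtain ⟨O, s, hO, hbO, hsm, hfs⟩ := hs b hb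
  have hmem : ∀ σ, f σ ∈ O → (s (f σ))⁻¹ * σ ∈ P := fun σ hσ => (hfP _ _).1 (hfs _ hσ)
  -- The fiber coordinate is the element of `P` that carries the section to `σ`. Over `O` the
  -- argument of `retract` lies in `P`, so its default value `1` is never taken there.
  let T : K → B × P := fun σ => (f σ, retract P ((s (f σ))⁻¹ * σ))
  let S : B × P → K := fun q => s q.1 * q.2
  have hOpre : IsOpen (f ⁻¹' O) := hO.preimage hf.continuous
  have hT : ContMDiffOn 𝓘(ℝ, V) (𝓘(ℝ, B).prod 𝓘(ℝ, W)) ∞ T (f ⁻¹' O) := by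
    refine hf.contMDiffOn.prodMk ?_
    have h1 : ContMDiffOn 𝓘(ℝ, V) 𝓘(ℝ, V) ∞ (fun σ => (s (f σ))⁻¹ * σ) (f ⁻¹' O) :=
      ((hsm.comp hf.contMDiffOn fun _ h => h).inv).mul contMDiffOn_id
    -- The coordinate of `P` is the restriction of the smooth function `π ∘ c` on `K`, so smoothness
    -- into `P` can be checked in `K`.
    have h2 : ContMDiffOn 𝓘(ℝ, V) 𝓘(ℝ, W) ∞ (fun σ => π (c ((s (f σ))⁻¹ * σ))) (f ⁻¹' O) :=
      (π.contMDiff.comp hc.contMDiff).comp_contMDiffOn h1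
    intro σ hσ
    refine (hc'.contMDiffAt_of_comp ?_).contMDiffWithinAt
    refine (h2.contMDiffAt (hOpre.mem_nhds hσ)).congr_of_eventuallyEq ?_
    filter_upwards [hOpre.mem_nhds hσ] with τ hτ
    change c' (retract P ((s (f τ))⁻¹ * τ)) = _
    rw [hπ, coe_retract (hmem τ hτ)]
  have hS : ContMDiffOn (𝓘(ℝ, B).prod 𝓘(ℝ, W)) 𝓘(ℝ, V) ∞ S (O ×ˢ Set.univ) :=
    (hsm.comp contMDiffOn_fst fun _ h => h.1).mul (hval.comp contMDiff_snd).contMDiffOn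
  let e : Bundle.Trivialization P f :=
    { toFun := T
      invFun := S
      source := f ⁻¹' O
      target := O ×ˢ Set.univ
      map_source' := fun σ hσ => ⟨hσ, trivial⟩
      map_target' := by
        rintro ⟨x, p⟩ ⟨hx, -⟩
        change f (s x * p) ∈ O
        rwa [hfmul, hfs x hx]
      left_inv' := by
        intro σ hσ
        change s (f σ) * (retract P ((s (f σ))⁻¹ * σ) : K) = σ
        rw [coe_retract (hmem σ hσ), mul_inv_cancel_left]
      right_inv' := by
        rintro ⟨x, p⟩ ⟨hx, -⟩
        change (f (s x * p), retract P ((s (f (s x * p)))⁻¹ * (s x * p))) = (x, p)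
        rw [hfmul, hfs x hx, inv_mul_cancel_left]
        exact Prod.ext rfl (Subtype.ext (coe_retract p.2))
      open_source := hOpre
      open_target := hO.prod isOpen_univ
      continuousOn_toFun := hT.continuousOn
      continuousOn_invFun := hS.continuousOn
      baseSet := O
      open_baseSet := hO
      source_eq := rfl
      target_eq := rfl
      proj_toFun := fun _ _ => rfl }
  refine ⟨e, hbO, hT, hS, ?_⟩
  intro σ hσ p
  change retract P ((s (f (σ * p)))⁻¹ * (σ * p)) = retract P ((s (f σ))⁻¹ * σ) * p
  have hσO : f σ ∈ O := hσ
  apply Subtype.ext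
  rw [hfmul, ← mul_assoc, Subgroup.coe_mul, coe_retract (hmem σ hσO),
    coe_retract (P.mul_mem (hmem σ hσO) p.2)]

end LieGrp

/-! ### Fibers and local sections of `JH` -/

namespace AffGrp

open LieGrp

variable {n : ℕ} {g : E n →L[ℝ] ℝ} {M : E n →L[ℝ] E n} {y₀ : E n}

theorem exists_unit_comp_eq (hy : g y₀ = 1) {b : E n →L[ℝ] ℝ} (hb : b ≠ 0) :
    ∃ S : (E n →L[ℝ] E n)ˣ, g.comp (S : E n →L[ℝ] E n) = b := by
  obtain ⟨y₁, hy₁⟩ : ∃ y₁, b y₁ ≠ 0 := by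
    by_contra! h
    exact hb (ContinuousLinearMap.ext h)
  have hby : b ((b y₁)⁻¹ • y₁) = 1 := by
    rw [map_smul, smul_eq_mul, inv_mul_cancel₀ hy₁]
  have hne : ∀ (f : E n →L[ℝ] ℝ) (y : E n), f y = 1 → y ≠ 0 := by
    rintro f y h rfl
    rw [map_zero] at h
    exact zero_ne_one h
  obtain ⟨A, hA⟩ := SeparatingDual.exists_continuousLinearEquiv_apply_eq (R := ℝ)
    (hne g y₀ hy) (hne b _ hby)
  -- After moving by `A`, both functionals take the value `1` at `y₀`. Then $1+(b'-g)\otimes y_0$ is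
  -- a transvection, with inverse $1-(b'-g)\otimes y_0$, and it carries `g` to `b'`.
  set b' : E n →L[ℝ] ℝ := b.comp (A : E n →L[ℝ] E n) with hb'
  have hb'y : b' y₀ = 1 := by
    change b (A y₀) = 1
    rw [hA, hby]
  have hker : ∀ (t : ℝ) x, (b' - g) (x + t • (b' - g) x • y₀) = (b' - g) x := by
    intro t x
    have h0 : (b' - g) y₀ = 0 := by rw [_root_.sub_apply, hy, hb'y, sub_self]
    rw [map_add, map_smul, map_smul, h0, smul_zero, smul_zero, add_zero]
  let S : (E n →L[ℝ] E n)ˣ :=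
    { val := 1 + (1 : ℝ) • (b' - g).smulRight y₀
      inv := 1 + (-1 : ℝ) • (b' - g).smulRight y₀
      val_inv := by
        ext1 x
        change (x + (-1 : ℝ) • (b' - g) x • y₀) +
          (1 : ℝ) • (b' - g) (x + (-1 : ℝ) • (b' - g) x • y₀) • y₀ = x
        rw [hker, neg_one_smul, one_smul, neg_add_cancel_right]
      inv_val := by
        ext1 x
        change (x + (1 : ℝ) • (b' - g) x • y₀) +
          (-1 : ℝ) • (b' - g) (x + (1 : ℝ) • (b' - g) x • y₀) • y₀ = x
        rw [hker, neg_one_smul, one_smul, add_neg_cancel_right] }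
  have hS : ∀ x, g ((S : E n →L[ℝ] E n) x) = b' x := by
    intro x
    change g (x + (1 : ℝ) • (b' - g) x • y₀) = b' x
    rw [one_smul, map_add, map_smul, hy, smul_eq_mul, mul_one, _root_.sub_apply, add_sub_cancel]
  refine ⟨S * (ContinuousLinearEquiv.unitsEquiv ℝ (E n)).symm A.symm, ?_⟩
  ext1 x
  change g ((S : E n →L[ℝ] E n) (A.symm x)) = b x
  rw [hS]
  change b (A (A.symm x)) = b x
  rw [A.apply_symm_apply]

/-- The affine family $S(x)=S_0+(x-b)\otimes y_0$ satisfies $g\circ S(x)=x$ and stays invertible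
near `b`. As `JH` involves the inverse linear part, the section is the inverse of $(0,S(x))$. -/
theorem exists_smooth_section (hy : g y₀ = 1) {b : E n →L[ℝ] ℝ} (hb : b ≠ 0) :
    ∃ (O : Set (E n →L[ℝ] ℝ)) (s : (E n →L[ℝ] ℝ) → GA n), IsOpen O ∧ b ∈ O ∧
      ContMDiffOn 𝓘(ℝ, E n →L[ℝ] ℝ) 𝓘(ℝ, Model n) ∞ s O ∧
      ∀ x ∈ O, JH (covector g M) (s x) = x := by
  obtain ⟨S₀, hS₀⟩ := exists_unit_comp_eq hy hb
  let S : (E n →L[ℝ] ℝ) → (E n →L[ℝ] E n) := fun x => (S₀ : E n →L[ℝ] E n) + (x - b).smulRight y₀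
  have hgS : ∀ x, g.comp (S x) = x := by
    intro x
    ext1 v
    have h : g ((S₀ : E n →L[ℝ] E n) v) = b v := DFunLike.congr_fun hS₀ v
    change g ((S₀ : E n →L[ℝ] E n) v + (x v - b v) • y₀) = x v
    rw [map_add, h, map_smul, hy, smul_eq_mul, mul_one, add_sub_cancel]
  have hSsmooth : ContDiff ℝ ∞ S :=
    contDiff_const.add ((contDiff_id.sub contDiff_const).smulRight contDiff_const)
  have hO : IsOpen {x | IsUnit (S x)} := Units.isOpen.preimage hSsmooth.continuous
  classical
  let t : (E n →L[ℝ] ℝ) → GA n := fun x => if h : IsUnit (S x) then ⟨0, h.unit⟩ else 1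
  have ht : ∀ x, IsUnit (S x) → ((t x).lin : E n →L[ℝ] E n) = S x ∧ (t x).vec = 0 := by
    intro x hx
    rw [show t x = ⟨0, hx.unit⟩ from dif_pos hx]
    exact ⟨rfl, rfl⟩
  have htsmooth : ContMDiffOn 𝓘(ℝ, E n →L[ℝ] ℝ) 𝓘(ℝ, Model n) ∞ t {x | IsUnit (S x)} := by
    have h1 : ContMDiff 𝓘(ℝ, E n →L[ℝ] ℝ) 𝓘(ℝ, Model n) ∞
        (fun x : E n →L[ℝ] ℝ => ((0, S x - 1) : Model n)) :=
      (contDiff_const.prodMk (hSsmooth.sub contDiff_const)).contMDiff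
    intro x hx
    refine (isAlgebraCoord_gaCoord.contMDiffAt_of_comp ?_).contMDiffWithinAt
    refine (h1 x).congr_of_eventuallyEq ?_
    filter_upwards [hO.mem_nhds hx] with z hz
    obtain ⟨h2, h3⟩ := ht z hz
    refine Prod.ext h3 ?_
    change ((t z).lin : E n →L[ℝ] E n) - 1 = S z - 1
    rw [h2]
  refine ⟨_, fun x => (t x)⁻¹, hO, ?_, htsmooth.inv, ?_⟩
  · change IsUnit ((S₀ : E n →L[ℝ] E n) + (b - b).smulRight y₀)
    rw [sub_self, ContinuousLinearMap.zero_smulRight, add_zero]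
    exact S₀.isUnit
  · intro x hx
    rw [JH_eq, GA.inv_lin, inv_inv, (ht x hx).1, hgS]

/-- By the equivariance `JH_mul`, comparing values at `σ` and `τ` amounts to comparing those at `1`
and `σ⁻¹ * τ`. -/
theorem JH_eq_iff {σ τ : GA n} :
    JH (covector g M) σ = JH (covector g M) τ ↔ σ⁻¹ * τ ∈ stab g := by
  have h : JH (covector g M) τ = (JH (covector g M) (σ⁻¹ * τ)).comp
      ((σ.lin⁻¹ : (E n →L[ℝ] E n)ˣ) : E n →L[ℝ] E n) := by
    rw [← JH_mul, mul_inv_cancel_left]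
  rw [mem_stab_iff_JH (M := M), h, JH_eq]
  constructor
  · intro h1
    have h2 := congrArg (fun q : E n →L[ℝ] ℝ => q.comp (σ.lin : E n →L[ℝ] E n)) h1
    have h3 : ((σ.lin⁻¹ : (E n →L[ℝ] E n)ˣ) : E n →L[ℝ] E n).comp (σ.lin : E n →L[ℝ] E n) =
        ContinuousLinearMap.id ℝ (E n) := σ.lin.inv_mul
    simp only [ContinuousLinearMap.comp_assoc, h3, ContinuousLinearMap.comp_id] at h2
    exact h2.symm
  · intro h1
    rw [h1]

theorem JH_ne_zero (hy : g y₀ = 1) (σ : GA n) : JH (covector g M) σ ≠ 0 := by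
  intro h
  have h1 : g (((σ.lin⁻¹ : (E n →L[ℝ] E n)ˣ) : E n →L[ℝ] E n)
      ((σ.lin : E n →L[ℝ] E n) y₀)) = 0 := by
    rw [JH_eq] at h
    exact DFunLike.congr_fun h _
  have h2 : ((σ.lin⁻¹ : (E n →L[ℝ] E n)ˣ) : E n →L[ℝ] E n) ((σ.lin : E n →L[ℝ] E n) y₀) = y₀ :=
    DFunLike.congr_fun σ.lin.inv_mul y₀
  rw [h2, hy] at h1
  exact one_ne_zero h1

theorem isClosed_stab (g : E n →L[ℝ] ℝ) : IsClosed (stab g : Set (GA n)) := by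
  have h : (stab g : Set (GA n)) = JH (covector g 0) ⁻¹' {g} :=
    Set.ext fun _ => mem_stab_iff_JH
  rw [h]
  exact isClosed_singleton.preimage (contMDiff_JH g 0).continuous

/-- If `g` vanished, every translation would be in the radical of the form, and $n\ge1$ provides a
nonzero one. -/
theorem exists_apply_eq_one (hn : 1 ≤ n) (hω : (gaForm g M).Nondegenerate) :
    ∃ y₀, g y₀ = 1 := by
  by_contra! h
  have hg : ∀ v, g v = 0 := by
    intro v
    by_contra hv
    refine h ((g v)⁻¹ • v) ?_
    rw [map_smul, smul_eq_mul, inv_mul_cancel₀ hv]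
  have : Nonempty (Fin n) := ⟨⟨0, hn⟩⟩
  obtain ⟨v, hv⟩ := exists_ne (0 : E n)
  have h1 : ((v, 0) : Model n) = 0 := hω.2 _ fun a => by rw [gaForm_inl, hg, neg_zero]
  exact hv (Prod.ext_iff.1 h1).1

end AffGrp

/-! ### Forms under Lie algebra maps, and the proof of the theorem -/

namespace LieGrp

/-- The Lie algebra map of a homomorphism, as a map of the model spaces. -/
def modelLieMap {V : Type*} [NormedAddCommGroup V] [NormedSpace ℝ V]
    {K : Type*} [TopologicalSpace K] [ChartedSpace V K] [Group K]
    {V' : Type*} [NormedAddCommGroup V'] [NormedSpace ℝ V']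
    {K' : Type*} [TopologicalSpace K'] [ChartedSpace V' K'] [Group K'] (f : K →* K') :
    V →L[ℝ] V' :=
  lieMap 𝓘(ℝ, V) 𝓘(ℝ, V') f

theorem IsAlgebraCoord.modelLieMap_eq {V : Type*} [NormedAddCommGroup V] [NormedSpace ℝ V]
    {K : Type*} [TopologicalSpace K] [ChartedSpace V K] [Group K] {c : K → V}
    {μ : V →L[ℝ] V →L[ℝ] V}
    {V' : Type*} [NormedAddCommGroup V'] [NormedSpace ℝ V']
    {K' : Type*} [TopologicalSpace K'] [ChartedSpace V' K'] [Group K'] {c' : K' → V'}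
    {μ' : V' →L[ℝ] V' →L[ℝ] V'} (h : IsAlgebraCoord c μ) (h' : IsAlgebraCoord c' μ')
    {f : K →* K'} {L : V →L[ℝ] V'} (hf : ∀ σ, c' (f σ) = L (c σ)) : modelLieMap f = L :=
  ContinuousLinearMap.ext (h.lieMap_eq h' hf)

theorem IsAlgebraCoord.form_lieMap {V : Type*} [NormedAddCommGroup V] [NormedSpace ℝ V]
    {K : Type*} [TopologicalSpace K] [ChartedSpace V K] [Group K] {c : K → V}
    {μ : V →L[ℝ] V →L[ℝ] V}
    {V₁ : Type*} [NormedAddCommGroup V₁] [NormedSpace ℝ V₁]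
    {K₁ : Type*} [TopologicalSpace K₁] [ChartedSpace V₁ K₁] [Group K₁] {c₁ : K₁ → V₁}
    {μ₁ : V₁ →L[ℝ] V₁ →L[ℝ] V₁}
    {V₂ : Type*} [NormedAddCommGroup V₂] [NormedSpace ℝ V₂]
    {K₂ : Type*} [TopologicalSpace K₂] [ChartedSpace V₂ K₂] [Group K₂] {c₂ : K₂ → V₂}
    {μ₂ : V₂ →L[ℝ] V₂ →L[ℝ] V₂}
    (h : IsAlgebraCoord c μ) (h₁ : IsAlgebraCoord c₁ μ₁) (h₂ : IsAlgebraCoord c₂ μ₂)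
    {f₁ : K →* K₁} {L₁ : V →L[ℝ] V₁} (hf₁ : ∀ σ, c₁ (f₁ σ) = L₁ (c σ))
    {f₂ : K →* K₂} {L₂ : V →L[ℝ] V₂} (hf₂ : ∀ σ, c₂ (f₂ σ) = L₂ (c σ))
    (Ω₁ : LinearMap.BilinForm ℝ (GroupLieAlgebra 𝓘(ℝ, V₁) K₁))
    (Ω₂ : LinearMap.BilinForm ℝ (GroupLieAlgebra 𝓘(ℝ, V₂) K₂))
    (hΩ : ∀ x y : V, formAtOne Ω₁ (L₁ x) (L₁ y) = formAtOne Ω₂ (L₂ x) (L₂ y))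
    (x y : GroupLieAlgebra 𝓘(ℝ, V) K) :
    Ω₁ (lieMap 𝓘(ℝ, V) 𝓘(ℝ, V₁) f₁ x) (lieMap 𝓘(ℝ, V) 𝓘(ℝ, V₁) f₁ y) =
      Ω₂ (lieMap 𝓘(ℝ, V) 𝓘(ℝ, V₂) f₂ x) (lieMap 𝓘(ℝ, V) 𝓘(ℝ, V₂) f₂ y) := by
  have key : ∀ x y : V, formAtOne Ω₁ (modelLieMap f₁ x) (modelLieMap f₁ y) =
      formAtOne Ω₂ (modelLieMap f₂ x) (modelLieMap f₂ y) := by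
    intro x y
    rw [h.modelLieMap_eq h₁ hf₁, h.modelLieMap_eq h₂ hf₂, hΩ]
  exact key x y

theorem exists_euclidean_equiv (X : Type*) [NormedAddCommGroup X] [NormedSpace ℝ X]
    [FiniteDimensional ℝ X] : ∃ d : ℕ, Nonempty (EuclideanSpace ℝ (Fin d) ≃L[ℝ] X) :=
  ⟨Module.finrank ℝ X, ⟨ContinuousLinearEquiv.ofFinrankEq finrank_euclideanSpace_fin⟩⟩

end LieGrp

set_option maxHeartbeats 400000 in
open AffGrp LieGrp in
theorem theorem5p2 (n : ℕ) (hn : 1 ≤ n) (g : E n →L[ℝ] ℝ) (M : E n →L[ℝ] E n)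
    (hopen : IsOpen (Set.range fun σ : GA n => coAd 𝓘(ℝ, Model n) σ (covector g M))) :
    -- `δα⁺` is a symplectic form and `-J` is a momentum map for left translations
    IsSymplectic 𝓘(ℝ, Model n) (coboundary 𝓘(ℝ, Model n) (covector g M)) ∧
    IsMomentumMap 𝓘(ℝ, Model n) (coboundary 𝓘(ℝ, Model n) (covector g M))
      (fun σ => -J (covector g M) σ) ∧
    -- `J_H⁻¹(g)` is a closed subgroup containing `H`
    ∃ P : Subgroup (GA n),
      (P : Set (GA n)) = JH (covector g M) ⁻¹' {g} ∧
      IsClosed (P : Set (GA n)) ∧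
      ∃ hHP : translations n ≤ P,
    -- the affine structure of `GA(ℝⁿ)`, and affine Lie groups `H`, `P` and `P / H`
    ∃ (A : AffineStructure 𝓘(ℝ, Model n) (GA n)) (dH dP dR : ℕ)
      (_ : ChartedSpace (EuclideanSpace ℝ (Fin dH)) (translations n))
      (_ : LieGroup (𝓡 dH) ∞ (translations n))
      (_ : ChartedSpace (EuclideanSpace ℝ (Fin dP)) P)
      (_ : LieGroup (𝓡 dP) ∞ P)
      (_ : ChartedSpace (EuclideanSpace ℝ (Fin dR)) (quotTranslations P))
      (_ : LieGroup (𝓡 dR) ∞ (quotTranslations P))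
      (AH : AffineStructure (𝓡 dH) (translations n)) (AP : AffineStructure (𝓡 dP) P)
      (AR : AffineStructure (𝓡 dR) (quotTranslations P)),
      A.IsAssociatedTo (coboundary 𝓘(ℝ, Model n) (covector g M)) ∧
      -- the exact sequence of Lie groups `1 → H → P → P / H → 1`
      IsShortExact (Subgroup.inclusion hHP) (proj P) ∧
      Manifold.IsSmoothEmbedding (𝓡 dH) (𝓡 dP) ∞ (Subgroup.inclusion hHP) ∧
      Manifold.IsSubmersion (𝓡 dP) (𝓡 dR) ∞ (proj P) ∧
      -- it splits
      (∃ s : quotTranslations P →* P,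
        ContMDiff (𝓡 dR) (𝓡 dP) ∞ s ∧ ∀ r, proj P (s r) = r) ∧
      -- it is a sequence of affine Lie groups
      IsAffineHom AH AP (Subgroup.inclusion hHP) ∧
      IsAffineHom AP AR (proj P) ∧
      -- the reduced symplectic form on `P / H`, and its affine structure
      (∃ ΩR : LinearMap.BilinForm ℝ (GroupLieAlgebra (𝓡 dR) (quotTranslations P)),
        IsSymplectic (𝓡 dR) ΩR ∧
        (∀ x y : GroupLieAlgebra (𝓡 dP) P,
          ΩR (lieMap (𝓡 dP) (𝓡 dR) (proj P) x) (lieMap (𝓡 dP) (𝓡 dR) (proj P) y) =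
            coboundary 𝓘(ℝ, Model n) (covector g M)
              (lieMap (𝓡 dP) 𝓘(ℝ, Model n) P.subtype x)
              (lieMap (𝓡 dP) 𝓘(ℝ, Model n) P.subtype y)) ∧
        AR.IsAssociatedTo ΩR) ∧
      -- the reduced group is isomorphic to `GA(ℝⁿ⁻¹)` as a Lie group
      (∃ φ : quotTranslations P ≃* GA (n - 1),
        ContMDiff (𝓡 dR) 𝓘(ℝ, Model (n - 1)) ∞ φ ∧
        ContMDiff 𝓘(ℝ, Model (n - 1)) (𝓡 dR) ∞ φ.symm) ∧
      -- the fiber bundle `P → GA(ℝⁿ) → (ℝⁿ)* \ {0}`: affine fiber and affine projection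
      IsPrincipalBundleOver 𝓘(ℝ, Model n) P (𝓡 dP) (JH (covector g M)) {0}ᶜ ∧
      Manifold.IsSmoothEmbedding (𝓡 dP) 𝓘(ℝ, Model n) ∞ (P.subtype : P → GA n) ∧
      IsAffineHom AP A P.subtype ∧
      IsAffineMapToSpace A (JH (covector g M)) := by
  have hsep := isAlgebraCoord_gaCoord.eq_zero_of_isOpen_range_modelCoAd (modelCovector g M) hopen
  have hω : (gaForm g M).Nondegenerate := commForm_nondegenerate hsep
  obtain ⟨B, hB, hBω⟩ := exists_leftSymmetric gaMul_assoc hω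
  have hF : IsFormProduct g M B := ⟨hω, hB, hBω⟩
  obtain ⟨y₀, hy⟩ := exists_apply_eq_one hn hω
  -- The Lie groups `P` and `P / H` are to be modelled on Euclidean spaces, so their algebras are
  -- transported there by `eP` and `eR`. The algebra of `H` is already `E n`.
  obtain ⟨dP, ⟨eP⟩⟩ := exists_euclidean_equiv (E n × annihilating g)
  obtain ⟨dR, ⟨eR⟩⟩ := exists_euclidean_equiv (annihilating g)
  have hH := isAlgebraEmbedding_translCoord (n := n)
  have hP := isAlgebraEmbedding_stabCoord eP hy
  have hR := isAlgebraEmbedding_linCoord eP eR hy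
  let cH : ChartedSpace (EuclideanSpace ℝ (Fin n)) (translations n) :=
    hH.isOpenEmbedding.singletonChartedSpace
  let cP : ChartedSpace (EuclideanSpace ℝ (Fin dP)) (stab g) :=
    hP.isOpenEmbedding.singletonChartedSpace
  let cR : ChartedSpace (EuclideanSpace ℝ (Fin dR)) (quotTranslations (stab g)) :=
    hR.isOpenEmbedding.singletonChartedSpace
  have lH : LieGroup (𝓡 n) ∞ (translations n) := hH.lieGroup
  have lP : LieGroup (𝓡 dP) ∞ (stab g) := hP.lieGroup
  have lR : LieGroup (𝓡 dR) ∞ (quotTranslations (stab g)) := hR.lieGroup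
  have mH : IsManifold (𝓡 n) ∞ (translations n) := hH.isOpenEmbedding.isManifold_singleton
  have mP : IsManifold (𝓡 dP) ∞ (stab g) := hP.isOpenEmbedding.isManifold_singleton
  have mR : IsManifold (𝓡 dR) ∞ (quotTranslations (stab g)) :=
    hR.isOpenEmbedding.isManifold_singleton
  have kG : IsAlgebraCoord (gaCoord : GA n → Model n) (gaMul n) := isAlgebraCoord_gaCoord
  have kH : IsAlgebraCoord translCoord (translMul n) := hH.isAlgebraCoord
  have kP : IsAlgebraCoord (stabCoord eP hy) (stabMul eP hy) := hP.isAlgebraCoord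
  have kR : IsAlgebraCoord (linCoord eP eR hy) (linMul eP eR hy) := hR.isAlgebraCoord
  have hsub : ∀ σ : stab g, gaCoord ((stab g).subtype σ) = stabIncl eP (stabCoord eP hy σ) :=
    fun σ => (stabIncl_stabCoord eP hy σ).symm
  refine ⟨kG.isSymplectic_modelCoboundary _ hsep, kG.isMomentumMap_neg_coAd (modelCovector g M),
    stab g, Set.ext fun _ => mem_stab_iff_JH, isClosed_stab g, translations_le_stab g,
    kG.affineStructure hB, n, dP, dR, cH, lH, cP, lP, cR, lR,
    kH.affineStructure hF.leftSymmetric_transl,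
    kP.affineStructure (hF.leftSymmetric_stab eP hy),
    kR.affineStructure (hF.leftSymmetric_lin eP eR hy),
    ?_, isShortExact,
    kH.isSmoothEmbedding kP.toIsGlobalCoord (translProj_translIncl eP) (stabCoord_inclusion eP hy),
    kP.isSubmersion kR.toIsGlobalCoord (linProj_linIncl eP eR) (linCoord_proj eP eR hy), ?_,
    kH.isAffineHom hF.leftSymmetric_transl kP (hF.leftSymmetric_stab eP hy)
      (stabCoord_inclusion eP hy) (translIncl_translMul eP hy) (hF.translIncl_transfer eP hy),
    kP.isAffineHom (hF.leftSymmetric_stab eP hy) kR (hF.leftSymmetric_lin eP eR hy)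
      (linCoord_proj eP eR hy) (linProj_stabMul eP eR hy) (hF.linProj_transfer eP eR hy),
    ?_, ?_, ?_,
    kP.isSmoothEmbedding kG.toIsGlobalCoord (stabProj_stabIncl eP hy) hsub,
    kP.isAffineHom (hF.leftSymmetric_stab eP hy) kG hB hsub (stabIncl_stabMul eP hy)
      (hF.stabIncl_transfer eP hy),
    isAffineMapToSpace_JH g M hB (comp_snd_leftSymmetric g M hBω)⟩
  · refine kG.isAssociatedTo hB (modelCoboundary (modelCovector g M)) fun x y z => ?_
    rw [kG.formAtOne_modelCoboundary, kG.formAtOne_modelCoboundary]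
    exact hBω x y z
  · obtain ⟨s, hs, hs'⟩ := exists_section eP eR hy
    exact ⟨s, kR.contMDiff_linear kP hs, hs'⟩
  -- The reduced form is again exact: it is the coboundary of `α` restricted to the linear part.
  · refine ⟨modelCoboundary (linCovector eP eR M),
      kR.isSymplectic_modelCoboundary _ (linCovector_separating eP eR hω hy), ?_, ?_⟩
    · refine kP.form_lieMap kR kG (linCoord_proj eP eR hy) hsub _
        (modelCoboundary (modelCovector g M)) fun x y => ?_
      rw [kG.formAtOne_modelCoboundary, kR.formAtOne_modelCoboundary]
      exact commForm_linProj eP eR hy x y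
    · refine kR.isAssociatedTo _ (modelCoboundary (linCovector eP eR M)) fun x y z => ?_
      rw [kR.formAtOne_modelCoboundary, kR.formAtOne_modelCoboundary]
      exact hF.commForm_lin eP eR hy x y z
  · obtain ⟨φ, L, h1, h2⟩ := exists_mulEquiv_GA eP eR hn hy
    exact ⟨φ, kR.contMDiff_linear isAlgebraCoord_gaCoord (L := (L : _ →L[ℝ] _)) h1,
      isAlgebraCoord_gaCoord.contMDiff_linear kR (L := (L.symm : _ →L[ℝ] _)) h2⟩
  · exact isPrincipalBundleOver_of_sections kG.toIsGlobalCoord kP.toIsGlobalCoord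
      (π := stabProj eP hy) (fun _ => rfl) (kP.contMDiff_linear kG hsub) (contMDiff_JH g M)
      (JH_ne_zero hy) (fun _ _ => JH_eq_iff) (fun _ hb => exists_smooth_section hy hb)

end
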